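/- Let $E=(E^0,E^1,r,s)$ be a row-finite directed graph with no sources (every $r^{-1}(v)$ is finite and nonempty). Let $E^*$ be the set of finite paths $\mu=\mu_1\cdots\mu_n$ ($s(\mu_i)=r(\mu_{i+1})$), the vertices being the paths of length $0$, and let $E^\infty=\{z\in\prod_{i\ge1}E^1 : s(z_i)=r(z_{i+1}) \text{ for all } i\}$ with the topology inherited from the product of discrete spaces; for $\mu\in E^*$ let $Z(\mu)\subseteq E^\infty$ be the compact open set of infinite paths that begin with $\mu$ (for a vertex, $Z(v)=\{z: r(z_1)=v\}$). Let $\widehat E$ be the topological graph with $\widehat E^0=\widehat E^1=E^\infty$, $\widehat r=\mathrm{id}$ and $\widehat s(z_1z_2z_3\cdots)=z_2z_3\cdots$. A Toeplitz representation of a topological graph $F=(F^0,F^1,r,s)$ in a $C^*$-algebra $B$ is a pair of a linear map $\psi:C_c(F^1)\to B$ and a $*$-homomorphism $\pi:C_0(F^0)\to B$ such that $\psi((f\circ r)x)=\pi(f)\psi(x)$; such that $\psi(x)^*\psi(x)=\pi(\widehat x)$ if $\operatorname{supp}(x)$ lies in an open $s$-section (a set on which $s$ is a homeomorphism onto its image),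 where $\widehat x(s(e))=|x(e)|^2$ if $x(e)\neq0$ and $\widehat x=0$ elsewhere; and such that $\psi(x)^*\psi(y)=0$ if $\operatorname{supp}(x)$ and $\operatorname{supp}(y)$ lie in disjoint open $s$-sections. Let $F^0_{\rm fin}$ be the set of points with a neighbourhood $N$ such that $r^{-1}(N)$ is compact, and $F^0_{\rm rg}=F^0_{\rm fin}\setminus\overline{F^0\setminus\overline{r(F^1)}}$. The representation is covariant if $C_0(F^0_{\rm rg})$ is generated as a $C^*$-algebra by a set of nonnegative $f\in C_c(F^0_{\rm rg})$ for each of which there are a finite cover $\mathcal N$ of $r^{-1}(\operatorname{supp} f)$ by open $s$-sections and nonnegative continuous functions $f_N$ $(N\in\mathcal N)$ with $\{f_N\ne0\}\subseteq N\cap r^{-1}(\operatorname{supp} f)$, $\sum_N f_N=f\circ r$ and $\pi(f)=\sum_N\psi(\sqrt{f_N})\psi(\sqrt{f_N})^*$. It is universal if every covariant Toeplitz representation of $F$ in a $C^*$-algebra $C$ is its composition with a $*$-homomorphism $B\to C$. Let $X(F)$ be the $C^*$-correspondence over $C_0(F^0)$ obtained by completing $C_c(F^1)$ for the inner product $\langle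 x,y\rangle(v)=\sum_{s(e)=v}\overline{x(e)}y(e)$, with actions $f\cdot x=(f\circ r)x$ and $x\cdot f=x(f\circ s)$. Let $\mathcal O(F)=\mathcal O_{X(F)}$ be Katsura's $C^*$-algebra of $X(F)$, generated by a universal covariant representation $(j_X,j_A)$ of $X(F)$, and put $j_1=j_X|_{C_c(F^1)}$, $j_0=j_A$. A Cuntz–Krieger $E$-family in a $C^*$-algebra $B$ consists of mutually orthogonal projections $q_v$ $(v\in E^0)$ and partial isometries $t_e$ $(e\in E^1)$ in $B$ with $t_e^*t_e=q_{s(e)}$, $q_v\ge\sum_{e\in G}t_et_e^*$ for finite $G\subseteq r^{-1}(v)$, and $q_v=\sum_{r(e)=v}t_et_e^*$ whenever $r^{-1}(v)$ is finite and nonempty; put $t_\mu=t_{\mu_1}\cdots t_{\mu_n}$ and $t_v=q_v$. Let $C^*(E)$ be the $C^*$-algebra generated by a universal Cuntz–Krieger $E$-family $\{p_v,s_e\}$. 1. If $(\psi,\pi)$ is a covariant Toeplitz representation of $\widehat E$ in a $C^*$-algebra $B$, then $q_v:=\pi(\chi_{Z(v)})$ and $t_e:=\psi(\chi_{Z(e)})$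 form a Cuntz–Krieger $E$-family in $B$. 2. If $\{q_v\},\{t_e\}$ is a Cuntz–Krieger $E$-family in a $C^*$-algebra $B$, then there is a unique covariant Toeplitz representation $(\psi,\pi)$ of $\widehat E$ in $B$ such that $\psi(\chi_{Z(e\mu)})=t_{e\mu}t_\mu^*$ and $\pi(\chi_{Z(\mu)})=t_\mu t_\mu^*$ for all $e\in E^1$ and $\mu\in E^*$ with $s(e)=r(\mu)$ (in the second formula, for all $\mu\in E^*$). 3. $\{p_v,s_e\}$ is a Cuntz–Krieger $E$-family, $(j_1,j_0)$ is a universal covariant Toeplitz representation of $\widehat E$ in $\mathcal O(\widehat E)$, and there is an isomorphism $\mathcal O(\widehat E)\cong C^*(E)$ of $C^*$-algebras which carries each $j_1(\chi_{Z(e\mu)})$ to $s_{e\mu}s_\mu^*$ and each $j_0(\chi_{Z(\mu)})$ to $s_\mu s_\mu^*$. -/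

import Mathlib

open scoped ENNReal NNReal ZeroAtInfty CompactlySupported Topology ComplexOrder

universe u v w

/-! ### Universal C*-algebras -/

/-- Non-unital `*`-polynomials in a set `G` of generators. -/
inductive StarTerm (G : Type*) : Type _
  | gen (g : G) : StarTerm G
  | add (a b : StarTerm G) : StarTerm G
  | mul (a b : StarTerm G) : StarTerm G
  | smul (c : ℂ) (a : StarTerm G) : StarTerm G
  | star (a : StarTerm G) : StarTerm G

/-- The value of a `*`-polynomial at a family of elements of a C*-algebra. -/
def StarTerm.eval {G B : Type*} [NonUnitalCStarAlgebra B] (f : G → B) : StarTerm G → B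
  | .gen g => f g
  | .add a b => a.eval f + b.eval f
  | .mul a b => a.eval f * b.eval f
  | .smul c a => c • a.eval f
  | .star a => Star.star (a.eval f)

/-- A set of generators together with a class of families in C*-algebras ("the families which
satisfy the relations"), in which each generator is uniformly bounded. -/
structure RelationClass (G : Type u) where
  Holds : ∀ (B : Type u) [NonUnitalCStarAlgebra B], (G → B) → Prop
  bound : G → ℝ
  norm_le : ∀ (B : Type u) [NonUnitalCStarAlgebra B] (f : G → B), Holds B f → ∀ g, ‖f g‖ ≤ bound g

namespace RelationClass

variable {G : Type u} (R : RelationClass G)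

/-- The norm functions `t ↦ ‖t(f)‖` on `*`-polynomials which come from families `f` satisfying
the relations. Two families with the same norm function generate isomorphic C*-algebras, so that
this is a set of isomorphism classes of generating families. -/
def Index : Type u :=
  {n : StarTerm G → ℝ // ∃ (B : Type u) (_ : NonUnitalCStarAlgebra B) (f : G → B),
    R.Holds B f ∧ ∀ t, n t = ‖t.eval f‖}

/-- The C*-algebra of a chosen family with the norm function `i`. -/
def Alg (i : R.Index) : Type u := i.2.choose

noncomputable instance (i : R.Index) : NonUnitalCStarAlgebra (R.Alg i) := i.2.choose_spec.choose

/-- The chosen family with the norm function `i`. -/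
noncomputable def family (i : R.Index) : G → R.Alg i := i.2.choose_spec.choose_spec.choose

theorem family_holds (i : R.Index) : R.Holds (R.Alg i) (R.family i) :=
  i.2.choose_spec.choose_spec.choose_spec.1

theorem norm_family (i : R.Index) (t : StarTerm G) : i.1 t = ‖t.eval (R.family i)‖ :=
  i.2.choose_spec.choose_spec.choose_spec.2 t

/-- The generators in the product of all the C*-algebras `R.Alg i`. -/
noncomputable def prodGen (g : G) : lp R.Alg ∞ :=
  ⟨fun i => R.family i g, memℓp_infty ⟨R.bound g, by
    rintro _ ⟨i, rfl⟩
    exact R.norm_le _ _ (R.family_holds i) g⟩⟩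

/-- The C*-subalgebra of the product of all the C*-algebras `R.Alg i` that is generated by the
generators. -/
noncomputable def subalg : NonUnitalStarSubalgebra ℂ (lp R.Alg ∞) :=
  (NonUnitalStarAlgebra.adjoin ℂ (Set.range R.prodGen)).topologicalClosure

instance : IsClosed (R.subalg : Set (lp R.Alg ∞)) :=
  NonUnitalStarSubalgebra.isClosed_topologicalClosure _

/-- The universal C*-algebra generated by a family satisfying the relations. -/
def UnivAlg : Type u := R.subalg

noncomputable instance : NonUnitalCStarAlgebra R.UnivAlg :=
  inferInstanceAs (NonUnitalCStarAlgebra R.subalg)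

/-- The universal generators. -/
noncomputable def gen (g : G) : R.UnivAlg :=
  ⟨R.prodGen g, NonUnitalStarSubalgebra.le_topologicalClosure _
    (NonUnitalStarAlgebra.subset_adjoin ℂ _ ⟨g, rfl⟩)⟩

/-- The coordinate projections of the universal C*-algebra. -/
noncomputable def proj (i : R.Index) : R.UnivAlg →⋆ₙₐ[ℂ] R.Alg i where
  toFun a := (a : R.subalg).1.1 i
  map_smul' _ _ := rfl
  map_zero' := rfl
  map_add' _ _ := rfl
  map_mul' _ _ := rfl
  map_star' _ := rfl

end RelationClass

theorem StarTerm.map_eval {G B C : Type*} [NonUnitalCStarAlgebra B] [NonUnitalCStarAlgebra C]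
    (φ : B →⋆ₙₐ[ℂ] C) (f : G → B) (t : StarTerm G) :
    φ (t.eval f) = t.eval (fun g => φ (f g)) := by
  induction t with
  | gen g => rfl
  | add a b ha hb => simp [StarTerm.eval, ha, hb]
  | mul a b ha hb => simp [StarTerm.eval, ha, hb]
  | smul c a ha => simp [StarTerm.eval, ha]
  | star a ha => simp [StarTerm.eval, ha, map_star]

theorem StarTerm.exists_eval {G B : Type*} [NonUnitalCStarAlgebra B] (f : G → B) {b : B}
    (hb : b ∈ NonUnitalStarAlgebra.adjoin ℂ (Set.range f)) : b = 0 ∨ ∃ t : StarTerm G, b = t.eval f := by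
  induction hb using NonUnitalStarAlgebra.adjoin_induction with
  | mem x hx => obtain ⟨g, rfl⟩ := hx; exact Or.inr ⟨.gen g, rfl⟩
  | add x y _ _ hx hy =>
    rcases hx with rfl | ⟨s, rfl⟩
    · simpa using hy
    · rcases hy with rfl | ⟨t, rfl⟩
      · exact Or.inr ⟨s, by simp⟩
      · exact Or.inr ⟨.add s t, rfl⟩
  | zero => exact Or.inl rfl
  | mul x y _ _ hx hy =>
    rcases hx with rfl | ⟨s, rfl⟩
    · simp
    · rcases hy with rfl | ⟨t, rfl⟩
      · simp
      · exact Or.inr ⟨.mul s t, rfl⟩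
  | smul r x _ hx =>
    rcases hx with rfl | ⟨s, rfl⟩
    · simp
    · exact Or.inr ⟨.smul r s, rfl⟩
  | star x _ hx =>
    rcases hx with rfl | ⟨s, rfl⟩
    · simp
    · exact Or.inr ⟨.star s, rfl⟩

namespace RelationClass

variable {G : Type u} (R : RelationClass G)

theorem proj_gen (i : R.Index) (g : G) : R.proj i (R.gen g) = R.family i g := rfl

theorem ext_proj {a b : R.UnivAlg} (h : ∀ i, R.proj i a = R.proj i b) : a = b :=
  Subtype.ext (Subtype.ext (funext h))

theorem norm_eval_le {C : Type u} [NonUnitalCStarAlgebra C] (f : G → C) (hf : R.Holds C f)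
    (t : StarTerm G) : ‖t.eval f‖ ≤ ‖t.eval R.gen‖ := by
  let i : R.Index := ⟨fun t => ‖t.eval f‖, C, _, f, hf, fun _ => rfl⟩
  have h1 : ‖t.eval f‖ = ‖t.eval (R.family i)‖ := R.norm_family i t
  have h2 : R.proj i (t.eval R.gen) = t.eval (R.family i) := StarTerm.map_eval _ _ _
  rw [h1, ← h2]
  exact NonUnitalStarAlgHom.norm_apply_le _ _

/-- The universal generators generate the universal C*-algebra. -/
theorem topologicalClosure_adjoin_gen :
    (NonUnitalStarAlgebra.adjoin ℂ (Set.range R.gen)).topologicalClosure = ⊤ := by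
  rw [eq_top_iff]
  intro a _
  let ι : R.UnivAlg →⋆ₙₐ[ℂ] lp R.Alg ∞ := NonUnitalStarSubalgebraClass.subtype R.subalg
  have hι : Isometry ι := isometry_subtype_coe
  have key : ∀ b ∈ NonUnitalStarAlgebra.adjoin ℂ (Set.range R.prodGen),
      ∃ c ∈ NonUnitalStarAlgebra.adjoin ℂ (Set.range R.gen), ι c = b := by
    intro b hb
    have h : NonUnitalStarAlgebra.adjoin ℂ (Set.range R.prodGen) ≤
        (NonUnitalStarAlgebra.adjoin ℂ (Set.range R.gen)).map ι := by
      refine NonUnitalStarAlgebra.adjoin_le ?_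
      rintro _ ⟨g, rfl⟩
      exact ⟨R.gen g, NonUnitalStarAlgebra.subset_adjoin ℂ _ ⟨g, rfl⟩, rfl⟩
    exact h hb
  have ha : ι a ∈ closure (NonUnitalStarAlgebra.adjoin ℂ (Set.range R.prodGen) : Set (lp R.Alg ∞)) :=
    (a : R.subalg).2
  have : a ∈ closure (NonUnitalStarAlgebra.adjoin ℂ (Set.range R.gen) : Set R.UnivAlg) := by
    rw [hι.isUniformInducing.isInducing.closure_eq_preimage_closure_image]
    refine closure_mono ?_ ha
    intro b hb
    obtain ⟨c, hc, rfl⟩ := key b hb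
    exact ⟨c, hc, rfl⟩
  exact this

theorem hom_ext {C : Type*} [NonUnitalCStarAlgebra C] {φ φ' : R.UnivAlg →⋆ₙₐ[ℂ] C}
    (h : ∀ g, φ (R.gen g) = φ' (R.gen g)) : φ = φ' := by
  have hc : ∀ ρ : R.UnivAlg →⋆ₙₐ[ℂ] C, Continuous ρ := fun ρ =>
    AddMonoidHomClass.continuous_of_bound ρ 1
      (fun x => by simpa using NonUnitalStarAlgHom.norm_apply_le ρ x)
  ext a
  have ha : a ∈ closure (NonUnitalStarAlgebra.adjoin ℂ (Set.range R.gen) : Set R.UnivAlg) := by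
    have : a ∈ (NonUnitalStarAlgebra.adjoin ℂ (Set.range R.gen)).topologicalClosure := by
      rw [R.topologicalClosure_adjoin_gen]; trivial
    exact this
  refine closure_minimal ?_ (isClosed_eq (hc φ) (hc φ')) ha
  intro b hb
  rcases StarTerm.exists_eval _ hb with rfl | ⟨t, rfl⟩
  · simp
  · simp [StarTerm.map_eval, h]

/-- The universal property. -/
theorem existsUnique_lift {C : Type u} [NonUnitalCStarAlgebra C] (f : G → C) (hf : R.Holds C f) :
    ∃! φ : R.UnivAlg →⋆ₙₐ[ℂ] C, ∀ g, φ (R.gen g) = f g := by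
  let p : G → R.UnivAlg × C := fun g => (R.gen g, f g)
  let T : NonUnitalStarSubalgebra ℂ (R.UnivAlg × C) :=
    (NonUnitalStarAlgebra.adjoin ℂ (Set.range p)).topologicalClosure
  have hTc : IsClosed (T : Set (R.UnivAlg × C)) :=
    NonUnitalStarSubalgebra.isClosed_topologicalClosure _
  have hpT : ∀ g, p g ∈ T := fun g => NonUnitalStarSubalgebra.le_topologicalClosure _
    (NonUnitalStarAlgebra.subset_adjoin ℂ _ ⟨g, rfl⟩)
  have hT : ∀ d ∈ T, ‖d.2‖ ≤ ‖d.1‖ := by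
    intro d hd
    have hd' : d ∈ closure (NonUnitalStarAlgebra.adjoin ℂ (Set.range p) : Set (R.UnivAlg × C)) := hd
    refine closure_minimal (t := {d : R.UnivAlg × C | ‖d.2‖ ≤ ‖d.1‖}) ?_
      (isClosed_le (by fun_prop) (by fun_prop)) hd'
    intro b hb
    rcases StarTerm.exists_eval _ hb with rfl | ⟨t, rfl⟩
    · simp
    · have h1 : (t.eval p).1 = t.eval R.gen :=
        StarTerm.map_eval (NonUnitalStarAlgHom.fst ℂ R.UnivAlg C) p t
      have h2 : (t.eval p).2 = t.eval f :=
        StarTerm.map_eval (NonUnitalStarAlgHom.snd ℂ R.UnivAlg C) p t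
      simpa [h1, h2] using R.norm_eval_le f hf t
  let F : T →⋆ₙₐ[ℂ] R.UnivAlg :=
    (NonUnitalStarAlgHom.fst ℂ R.UnivAlg C).comp (NonUnitalStarSubalgebraClass.subtype T)
  have hF : Isometry F := by
    refine AddMonoidHomClass.isometry_of_norm F fun d => ?_
    have h1 : ‖d‖ = max ‖d.1.1‖ ‖d.1.2‖ := rfl
    have h2 : ‖F d‖ = ‖d.1.1‖ := rfl
    rw [h1, h2, max_eq_left (hT _ d.2)]
  have hcomp : CompleteSpace T := hTc.completeSpace_coe
  have hsurj : Function.Surjective F := by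
    have hr : IsClosed (Set.range F) := hF.isClosedEmbedding.isClosed_range
    have hle : (NonUnitalStarAlgebra.adjoin ℂ (Set.range R.gen)).topologicalClosure ≤
        NonUnitalStarAlgHom.range F := by
      refine NonUnitalStarSubalgebra.topologicalClosure_minimal _ ?_ (by simpa using hr)
      refine NonUnitalStarAlgebra.adjoin_le ?_
      rintro _ ⟨g, rfl⟩
      exact ⟨⟨p g, hpT g⟩, rfl⟩
    rw [R.topologicalClosure_adjoin_gen] at hle
    intro a
    exact hle (show a ∈ ⊤ from trivial)
  let e : T ≃⋆ₐ[ℂ] R.UnivAlg := StarAlgEquiv.ofBijective F ⟨hF.injective, hsurj⟩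
  let φ : R.UnivAlg →⋆ₙₐ[ℂ] C :=
    ((NonUnitalStarAlgHom.snd ℂ R.UnivAlg C).comp (NonUnitalStarSubalgebraClass.subtype T)).comp
      (e.symm : R.UnivAlg →⋆ₙₐ[ℂ] T)
  have hφ : ∀ g, φ (R.gen g) = f g := by
    intro g
    have : e.symm (R.gen g) = ⟨p g, hpT g⟩ := by
      rw [StarAlgEquiv.symm_apply_eq]; rfl
    change (e.symm (R.gen g)).1.2 = f g
    rw [this]
  exact ⟨φ, hφ, fun φ' h' => R.hom_ext fun g => (h' g).trans (hφ g).symm⟩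

end RelationClass

/-! ### C*-correspondences and Katsura's algebra -/

/-- A C*-correspondence over `A`: a right Hilbert `A`-module `X` (complete for the norm of its
inner product `inner`, which is conjugate linear in the first variable) with right action
`right a x = x · a` and a left action `left a x = a · x` by adjointable operators. -/
structure CStarCorrespondence (A X : Type*) [NonUnitalCStarAlgebra A] [NormedAddCommGroup X]
    [NormedSpace ℂ X] [CompleteSpace X] where
  inner : X →L⋆[ℂ] X →L[ℂ] A
  right : A →L[ℂ] X →L[ℂ] X
  left : A →L[ℂ] X →L[ℂ] X
  right_mul : ∀ a b x, right (a * b) x = right b (right a x)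
  left_mul : ∀ a b x, left (a * b) x = left a (left b x)
  inner_right : ∀ x y a, inner x (right a y) = inner x y * a
  star_inner : ∀ x y, star (inner x y) = inner y x
  inner_self_nonneg : ∀ x, ∃ a, inner x x = star a * a
  norm_sq : ∀ x, ‖x‖ ^ 2 = ‖inner x x‖
  inner_left : ∀ a x y, inner (left (star a) y) x = inner y (left a x)

namespace CStarCorrespondence

variable {A X : Type*} [NonUnitalCStarAlgebra A] [NormedAddCommGroup X] [NormedSpace ℂ X]
  [CompleteSpace X] (𝓧 : CStarCorrespondence A X)

/-- The operator `Θ_{x,y} : z ↦ x · ⟨y, z⟩`. -/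
noncomputable def theta (x y : X) : X →L[ℂ] X := (𝓧.right.flip x).comp (𝓧.inner y)

theorem theta_apply (x y z : X) : 𝓧.theta x y z = 𝓧.right (𝓧.inner y z) x := rfl

/-- The compact operators, the closed linear span of the operators `Θ_{x,y}`. -/
noncomputable def compacts : Submodule ℂ (X →L[ℂ] X) :=
  (Submodule.span ℂ {T | ∃ x y, T = 𝓧.theta x y}).topologicalClosure

theorem theta_mem (x y : X) : 𝓧.theta x y ∈ 𝓧.compacts :=
  Submodule.le_topologicalClosure _ (Submodule.subset_span ⟨x, y, rfl⟩)

/-- Membership in the ideal `φ⁻¹(K(X)) ∩ (ker φ)^⊥`, where `φ` is the left action. -/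
def InKatsuraIdeal (a : A) : Prop :=
  𝓧.left a ∈ 𝓧.compacts ∧ ∀ b, 𝓧.left b = 0 → a * b = 0

variable {B : Type*} [NonUnitalCStarAlgebra B]

/-- Toeplitz representations of a C*-correspondence. -/
structure IsToeplitz (ψ : X →ₗ[ℂ] B) (π : A →⋆ₙₐ[ℂ] B) : Prop where
  map_left : ∀ a x, ψ (𝓧.left a x) = π a * ψ x
  star_mul : ∀ x y, star (ψ x) * ψ y = π (𝓧.inner x y)

/-- Covariant Toeplitz representations of a C*-correspondence. The map `ψ₁` is the homomorphism
`ψ⁽¹⁾ : K(X) → B`: since the `Θ_{x,y}` span a dense subspace, it is the only continuous linear map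
with `ψ⁽¹⁾(Θ_{x,y}) = ψ(x) ψ(y)*`, and it is automatically multiplicative and `*`-preserving. -/
structure IsCovariant (ψ : X →ₗ[ℂ] B) (π : A →⋆ₙₐ[ℂ] B) : Prop extends
    𝓧.IsToeplitz ψ π where
  covariant : ∃ ψ₁ : 𝓧.compacts →L[ℂ] B,
    (∀ x y, ψ₁ ⟨𝓧.theta x y, 𝓧.theta_mem x y⟩ = ψ x * star (ψ y)) ∧
    ∀ a (ha : 𝓧.InKatsuraIdeal a), ψ₁ ⟨𝓧.left a, ha.1⟩ = π a

variable {𝓧}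

theorem IsToeplitz.norm_le {ψ : X →ₗ[ℂ] B} {π : A →⋆ₙₐ[ℂ] B} (h : 𝓧.IsToeplitz ψ π) (x : X) :
    ‖ψ x‖ ≤ ‖x‖ := by
  refine (sq_le_sq₀ (norm_nonneg _) (norm_nonneg _)).1 ?_
  rw [𝓧.norm_sq, sq, ← CStarRing.norm_star_mul_self, h.star_mul]
  exact NonUnitalStarAlgHom.norm_apply_le _ _

end CStarCorrespondence

namespace CStarCorrespondence

variable {A X : Type u} [NonUnitalCStarAlgebra A] [NormedAddCommGroup X] [NormedSpace ℂ X]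
  [CompleteSpace X] (𝓧 : CStarCorrespondence A X)

/-- The covariant Toeplitz representations, as families indexed by the elements of `X` and `A`. -/
noncomputable def covariantClass : RelationClass (X ⊕ A) where
  Holds B _ f := ∃ (ψ : X →ₗ[ℂ] B) (π : A →⋆ₙₐ[ℂ] B), 𝓧.IsCovariant ψ π ∧ f = Sum.elim ψ π
  bound := Sum.elim (fun x => ‖x‖) (fun a => ‖a‖)
  norm_le := by
    rintro B _ f ⟨ψ, π, h, rfl⟩ (x | a)
    · exact h.toIsToeplitz.norm_le x
    · exact NonUnitalStarAlgHom.norm_apply_le π a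

/-- The algebra `O_X`, generated by a universal covariant Toeplitz representation of `X`. -/
abbrev KatsuraAlgebra : Type u := 𝓧.covariantClass.UnivAlg

/-- The linear part `j_X` of the universal covariant Toeplitz representation. -/
noncomputable def jX : X →ₗ[ℂ] 𝓧.KatsuraAlgebra where
  toFun x := 𝓧.covariantClass.gen (Sum.inl x)
  map_add' x y := 𝓧.covariantClass.ext_proj fun i => by
    obtain ⟨ψ, π, -, h⟩ := 𝓧.covariantClass.family_holds i
    simp only [map_add, RelationClass.proj_gen, h, Sum.elim_inl]
  map_smul' c x := 𝓧.covariantClass.ext_proj fun i => by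
    obtain ⟨ψ, π, -, h⟩ := 𝓧.covariantClass.family_holds i
    simp only [map_smul, RelationClass.proj_gen, h, Sum.elim_inl, RingHom.id_apply]

/-- The homomorphism `j_A` of the universal covariant Toeplitz representation. -/
noncomputable def jA : A →⋆ₙₐ[ℂ] 𝓧.KatsuraAlgebra where
  toFun a := 𝓧.covariantClass.gen (Sum.inr a)
  map_smul' c x := 𝓧.covariantClass.ext_proj fun i => by
    obtain ⟨ψ, π, -, h⟩ := 𝓧.covariantClass.family_holds i
    simp only [map_smul, RelationClass.proj_gen, h, Sum.elim_inr, MonoidHom.id_apply]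
  map_zero' := 𝓧.covariantClass.ext_proj fun i => by
    obtain ⟨ψ, π, -, h⟩ := 𝓧.covariantClass.family_holds i
    simp only [map_zero, RelationClass.proj_gen, h, Sum.elim_inr]
  map_add' x y := 𝓧.covariantClass.ext_proj fun i => by
    obtain ⟨ψ, π, -, h⟩ := 𝓧.covariantClass.family_holds i
    simp only [map_add, RelationClass.proj_gen, h, Sum.elim_inr]
  map_mul' x y := 𝓧.covariantClass.ext_proj fun i => by
    obtain ⟨ψ, π, -, h⟩ := 𝓧.covariantClass.family_holds i
    simp only [map_mul, RelationClass.proj_gen, h, Sum.elim_inr]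
  map_star' x := 𝓧.covariantClass.ext_proj fun i => by
    obtain ⟨ψ, π, -, h⟩ := 𝓧.covariantClass.family_holds i
    simp only [map_star, RelationClass.proj_gen, h, Sum.elim_inr]

/-- The universal property of `O_X`. -/
theorem existsUnique_lift {C : Type u} [NonUnitalCStarAlgebra C] {ψ : X →ₗ[ℂ] C}
    {π : A →⋆ₙₐ[ℂ] C} (h : 𝓧.IsCovariant ψ π) :
    ∃! ρ : 𝓧.KatsuraAlgebra →⋆ₙₐ[ℂ] C, (∀ x, ρ (𝓧.jX x) = ψ x) ∧ ∀ a, ρ (𝓧.jA a) = π a := by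
  have := 𝓧.covariantClass.existsUnique_lift (Sum.elim ψ π) ⟨ψ, π, h, rfl⟩
  simp only [Sum.forall] at this
  exact this

end CStarCorrespondence

/-! ### Topological graphs and their correspondences -/

/-- A topological graph `(E₀, E₁, r, s)`. -/
structure TopologicalGraph (E₀ E₁ : Type*) [TopologicalSpace E₀] [T2Space E₀]
    [LocallyCompactSpace E₀] [TopologicalSpace E₁] [T2Space E₁] [LocallyCompactSpace E₁] where
  r : E₁ → E₀
  s : E₁ → E₀
  continuous_r : Continuous r
  isLocalHomeomorph_s : IsLocalHomeomorph s

namespace TopologicalGraph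

variable {E₀ E₁ : Type*} [TopologicalSpace E₀] [T2Space E₀] [LocallyCompactSpace E₀]
  [TopologicalSpace E₁] [T2Space E₁] [LocallyCompactSpace E₁] (E : TopologicalGraph E₀ E₁)

/-- The action `(f · x)(e) = f(r(e)) x(e)`. -/
noncomputable def leftMul (f : C₀(E₀, ℂ)) (x : C_c(E₁, ℂ)) : C_c(E₁, ℂ) where
  toFun e := f (E.r e) * x e
  continuous_toFun := ((map_continuous f).comp E.continuous_r).mul (map_continuous x)
  hasCompactSupport' := x.hasCompactSupport.mul_left

/-- The action `(x · f)(e) = x(e) f(s(e))`. -/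
noncomputable def rightMul (x : C_c(E₁, ℂ)) (f : C₀(E₀, ℂ)) : C_c(E₁, ℂ) where
  toFun e := x e * f (E.s e)
  continuous_toFun :=
    (map_continuous x).mul ((map_continuous f).comp E.isLocalHomeomorph_s.continuous)
  hasCompactSupport' := x.hasCompactSupport.mul_right

theorem finite_fiber (x : C_c(E₁, ℂ)) (v : E₀) : (E.s ⁻¹' {v} ∩ tsupport x).Finite := by
  have hK : IsCompact (E.s ⁻¹' {v} ∩ tsupport x) :=
    x.hasCompactSupport.isCompact.inter_left
      (isClosed_singleton.preimage E.isLocalHomeomorph_s.continuous)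
  choose Φ hΦ hs using E.isLocalHomeomorph_s
  obtain ⟨t, -, ht⟩ := hK.elim_nhds_subcover (fun e => (Φ e).source)
    (fun e _ => (Φ e).open_source.mem_nhds (hΦ e))
  have : E.s ⁻¹' {v} ∩ tsupport x ⊆ ⋃ e ∈ t, ((Φ e).source ∩ E.s ⁻¹' {v}) := by
    intro e he
    obtain ⟨i, hi, hi'⟩ := Set.mem_iUnion₂.1 (ht he)
    exact Set.mem_iUnion₂.2 ⟨i, hi, hi', he.1⟩
  refine (t.finite_toSet.biUnion fun i _ => ?_).subset this
  refine Set.Subsingleton.finite ?_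
  rintro a ⟨ha, ha'⟩ b ⟨hb, hb'⟩
  refine (Φ i).injOn ha hb ?_
  rw [← hs i]
  exact ha'.trans hb'.symm

theorem finite_fiber_support (x : C_c(E₁, ℂ)) (v : E₀) :
    (E.s ⁻¹' {v} ∩ Function.support x).Finite :=
  (E.finite_fiber x v).subset (Set.inter_subset_inter_right _ (subset_tsupport _))

theorem continuous_fiberSum (x : C_c(E₁, ℂ)) :
    Continuous fun v => ∑ᶠ e ∈ E.s ⁻¹' {v}, x e := by
  classical
  rw [continuous_iff_continuousAt]
  intro v₀
  have hF := E.finite_fiber x v₀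
  choose Φ hΦ hs using E.isLocalHomeomorph_s
  obtain ⟨U, hU, hUd⟩ := hF.t2_separation
  set O : E₁ → Set E₁ := fun e => (Φ e).source ∩ U e with hO
  have hOo : ∀ e, IsOpen (O e) := fun e => (Φ e).open_source.inter (hU e).2
  have hOe : ∀ e, e ∈ O e := fun e => ⟨hΦ e, (hU e).1⟩
  set F : Finset E₁ := hF.toFinset with hFdef
  have hFm : ∀ e, e ∈ F ↔ E.s e = v₀ ∧ e ∈ tsupport x := by
    intro e; simp [hFdef]
  set K' : Set E₁ := tsupport x \ ⋃ e ∈ F, O e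
  have hK' : IsCompact K' := x.hasCompactSupport.isCompact.diff
    (isOpen_biUnion fun e _ => hOo e)
  have hsK' : IsClosed (E.s '' K') := (hK'.image E.isLocalHomeomorph_s.continuous).isClosed
  have hv₀ : v₀ ∉ E.s '' K' := by
    rintro ⟨e, ⟨he, he'⟩, hev⟩
    exact he' (Set.mem_iUnion₂.2 ⟨e, (hFm e).2 ⟨hev, he⟩, hOe e⟩)
  have hW : ∀ᶠ v in 𝓝 v₀, v ∉ E.s '' K' ∧ ∀ e ∈ F, v ∈ E.s '' O e := by
    refine Filter.Eventually.and (hsK'.isOpen_compl.mem_nhds hv₀) ?_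
    rw [Filter.eventually_all_finset]
    intro e he
    exact (E.isLocalHomeomorph_s.isOpenMap _ (hOo e)).mem_nhds ⟨e, hOe e, ((hFm e).1 he).1⟩
  have heq : (fun v => ∑ e ∈ F, x ((Φ e).symm v)) =ᶠ[𝓝 v₀]
      fun v => ∑ᶠ e ∈ E.s ⁻¹' {v}, x e := by
    filter_upwards [hW] with v hv
    have hsec : ∀ e ∈ F, (Φ e).symm v ∈ O e ∧ E.s ((Φ e).symm v) = v := by
      intro e he
      obtain ⟨a, ha, hav⟩ := hv.2 e he
      have : (Φ e).symm v = a := by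
        rw [← hav, hs e, (Φ e).left_inv ha.1]
      rw [this]; exact ⟨ha, hav⟩
    have hinj : Set.InjOn (fun e => (Φ e).symm v) (F : Set E₁) := by
      intro e he e' he' h
      by_contra hne
      have hd := hUd (by simpa [hFdef] using he) (by simpa [hFdef] using he') hne
      exact Set.disjoint_left.1 hd (hsec e he).1.2 (by
        have := (hsec e' he').1.2
        simp only at h
        rwa [← h] at this)
    rw [← Finset.sum_image (f := fun e => x e) hinj]
    symm
    refine finsum_mem_eq_sum_of_inter_support_eq _ ?_
    ext e
    simp only [Set.mem_inter_iff, Set.mem_preimage, Set.mem_singleton_iff, Function.mem_support,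
      Finset.coe_image, Set.mem_image, Finset.mem_coe]
    constructor
    · rintro ⟨hev, hxe⟩
      refine ⟨?_, hxe⟩
      have heK : e ∉ K' := fun h => hv.1 ⟨e, h, hev⟩
      have het : e ∈ tsupport x := subset_tsupport _ hxe
      have : e ∈ ⋃ e ∈ F, O e := by
        by_contra h; exact heK ⟨het, h⟩
      obtain ⟨i, hi, hei⟩ := Set.mem_iUnion₂.1 this
      refine ⟨i, hi, ?_⟩
      rw [← hev, hs i, (Φ i).left_inv hei.1]
    · rintro ⟨⟨i, hi, rfl⟩, hxe⟩
      exact ⟨(hsec i hi).2, hxe⟩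
  refine ContinuousAt.congr ?_ heq
  refine tendsto_finsetSum _ fun e he => ?_
  have hv : v₀ ∈ (Φ e).target := by
    rw [← ((hFm e).1 he).1, hs e]
    exact (Φ e).map_source (hΦ e)
  exact (map_continuous x).continuousAt.comp ((Φ e).continuousAt_symm hv)

/-- The function `v ↦ ∑_{s(e) = v} x(e)`. -/
noncomputable def fiberSum : C_c(E₁, ℂ) →ₗ[ℂ] C₀(E₀, ℂ) where
  toFun x :=
    { toFun := fun v => ∑ᶠ e ∈ E.s ⁻¹' {v}, x e
      continuous_toFun := E.continuous_fiberSum x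
      zero_at_infty' := by
        refine Filter.Tendsto.congr' ?_ tendsto_const_nhds
        have hK : IsCompact (E.s '' tsupport x) :=
          x.hasCompactSupport.isCompact.image E.isLocalHomeomorph_s.continuous
        filter_upwards [hK.compl_mem_cocompact] with v hv
        symm
        refine finsum_mem_eq_zero_of_forall_eq_zero fun e he => ?_
        by_contra h
        exact hv ⟨e, subset_tsupport _ h, he⟩ }
  map_add' x y := by
    ext v
    exact finsum_mem_add_distrib' (E.finite_fiber_support x v) (E.finite_fiber_support y v)
  map_smul' c x := by
    ext v
    exact (mul_finsum_mem x c).symm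

theorem fiberSum_apply (x : C_c(E₁, ℂ)) (v : E₀) :
    E.fiberSum x v = ∑ᶠ e ∈ E.s ⁻¹' {v}, x e := rfl

/-- The inner product `⟨x, y⟩(v) = ∑_{s(e) = v} conj(x(e)) y(e)` on `C_c(E₁)`. -/
noncomputable def ip (x y : C_c(E₁, ℂ)) : C₀(E₀, ℂ) := E.fiberSum (star x * y)

theorem ip_apply (x y : C_c(E₁, ℂ)) (v : E₀) :
    E.ip x y v = ∑ᶠ e ∈ E.s ⁻¹' {v}, star (x e) * y e := rfl

end TopologicalGraph

theorem norm_c0_le {Y : Type*} [TopologicalSpace Y] {f : C₀(Y, ℂ)} {C : ℝ} (hC : 0 ≤ C) (h : ∀ v, ‖f v‖ ≤ C) : ‖f‖ ≤ C := by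
  rw [← ZeroAtInftyContinuousMap.norm_toBCF_eq_norm, BoundedContinuousFunction.norm_le hC]
  exact h

theorem norm_c0_apply_le {Y : Type*} [TopologicalSpace Y] (f : C₀(Y, ℂ)) (v : Y) : ‖f v‖ ≤ ‖f‖ := by
  rw [← ZeroAtInftyContinuousMap.norm_toBCF_eq_norm]
  exact f.toBCF.norm_coe_le_norm v

theorem exists_star_mul_of_nonneg {Y : Type*} [TopologicalSpace Y] (f : C₀(Y, ℂ))
    (hf : ∀ v, f v = ((f v).re : ℂ) ∧ 0 ≤ (f v).re) :
    ∃ a : C₀(Y, ℂ), f = star a * a := by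
  refine ⟨⟨⟨fun v => (√(f v).re : ℂ), Complex.continuous_ofReal.comp
    (Real.continuous_sqrt.comp (Complex.continuous_re.comp (map_continuous f)))⟩, ?_⟩, ?_⟩
  · have h : Filter.Tendsto (fun z : ℂ => (√z.re : ℂ)) (𝓝 0) (𝓝 0) := by
      have : Continuous fun z : ℂ => (√z.re : ℂ) := by fun_prop
      simpa using this.tendsto 0
    exact h.comp (ZeroAtInftyContinuousMapClass.zero_at_infty f)
  · ext v
    change f v = star (√(f v).re : ℂ) * (√(f v).re : ℂ)
    rw [Complex.star_def, Complex.conj_ofReal, ← Complex.ofReal_mul, Real.mul_self_sqrt (hf v).2]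
    exact (hf v).1

namespace TopologicalGraph

variable {E₀ E₁ : Type*} [TopologicalSpace E₀] [T2Space E₀] [LocallyCompactSpace E₀]
  [TopologicalSpace E₁] [T2Space E₁] [LocallyCompactSpace E₁] (E : TopologicalGraph E₀ E₁)

theorem ip_add_right (x y z : C_c(E₁, ℂ)) : E.ip x (y + z) = E.ip x y + E.ip x z := by
  rw [ip, mul_add, map_add]; rfl

theorem ip_smul_right (c : ℂ) (x y : C_c(E₁, ℂ)) : E.ip x (c • y) = c • E.ip x y := by
  rw [ip, mul_smul_comm, map_smul]; rfl

theorem finite_fiber_ip (x y : C_c(E₁, ℂ)) (v : E₀) :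
    (E.s ⁻¹' {v} ∩ Function.support fun e => star (x e) * y e).Finite :=
  E.finite_fiber_support (star x * y) v

theorem star_ip (x y : C_c(E₁, ℂ)) : star (E.ip x y) = E.ip y x := by
  ext v
  change star (∑ᶠ e ∈ E.s ⁻¹' {v}, star (x e) * y e) = ∑ᶠ e ∈ E.s ⁻¹' {v}, star (y e) * x e
  have h := (starAddEquiv (R := ℂ)).toAddMonoidHom.map_finsum_mem'
    (f := fun e => star (x e) * y e) (s := E.s ⁻¹' {v}) (E.finite_fiber_ip x y v)
  change star _ = ∑ᶠ e ∈ E.s ⁻¹' {v}, star (star (x e) * y e) at h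
  rw [h]
  simp [mul_comm]

theorem ip_add_left (x y z : C_c(E₁, ℂ)) : E.ip (x + y) z = E.ip x z + E.ip y z := by
  rw [← star_ip, ip_add_right, star_add, star_ip, star_ip]

theorem ip_smul_left (c : ℂ) (x y : C_c(E₁, ℂ)) : E.ip (c • x) y = star c • E.ip x y := by
  rw [← star_ip, ip_smul_right, star_smul, star_ip]

/-- The sum `∑_{s(e) = v} |x(e)|²`. -/
noncomputable def normSqSum (x : C_c(E₁, ℂ)) (v : E₀) : ℝ := ∑ᶠ e ∈ E.s ⁻¹' {v}, ‖x e‖ ^ 2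

theorem finite_fiber_norm (x : C_c(E₁, ℂ)) (v : E₀) :
    (E.s ⁻¹' {v} ∩ Function.support fun e => ‖x e‖ ^ 2).Finite :=
  (E.finite_fiber_support x v).subset
    (Set.inter_subset_inter_right _ fun e he => by simpa using he)

theorem normSqSum_eq (x : C_c(E₁, ℂ)) (v : E₀) :
    E.normSqSum x v = ∑ e ∈ (E.finite_fiber x v).toFinset, ‖x e‖ ^ 2 := by
  refine finsum_mem_eq_sum_of_inter_support_eq _ ?_
  ext e
  simp only [Set.mem_inter_iff, Set.Finite.coe_toFinset, and_congr_left_iff]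
  intro he
  have : x e ≠ 0 := fun h => he (by simp [h])
  exact ⟨fun h => ⟨h, subset_tsupport _ this⟩, fun h => h.1⟩

theorem normSqSum_nonneg (x : C_c(E₁, ℂ)) (v : E₀) : 0 ≤ E.normSqSum x v := by
  rw [normSqSum_eq]
  exact Finset.sum_nonneg fun _ _ => sq_nonneg _

theorem ip_self_eq (x : C_c(E₁, ℂ)) (v : E₀) : E.ip x x v = (E.normSqSum x v : ℂ) := by
  have h := (Complex.ofRealHom : ℝ →+ ℂ).map_finsum_mem' (E.finite_fiber_norm x v)
  rw [ip_apply]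
  refine Eq.trans ?_ h.symm
  refine finsum_mem_congr rfl fun e _ => ?_
  simp [Complex.conj_mul']

theorem ip_self_re_nonneg (x : C_c(E₁, ℂ)) (v : E₀) : 0 ≤ (E.ip x x v).re := by
  rw [ip_self_eq, Complex.ofReal_re]
  exact E.normSqSum_nonneg x v

theorem ip_self_eq_re (x : C_c(E₁, ℂ)) (v : E₀) : E.ip x x v = ((E.ip x x v).re : ℂ) := by
  rw [ip_self_eq, Complex.ofReal_re]

/-- The semi-inner product `⟨x, y⟩(v)`. -/
noncomputable abbrev core (v : E₀) : PreInnerProductSpace.Core ℂ C_c(E₁, ℂ) where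
  inner x y := E.ip x y v
  conj_inner_symm x y := by
    rw [← E.star_ip y x]; rfl
  re_inner_nonneg x := E.ip_self_re_nonneg x v
  add_left x y z := by rw [ip_add_left]; rfl
  smul_left x y c := by rw [ip_smul_left]; rfl

theorem ip_cauchySchwarz (x y : C_c(E₁, ℂ)) (v : E₀) :
    ‖E.ip x y v‖ ^ 2 ≤ (E.ip x x v).re * (E.ip y y v).re := by
  have h := @InnerProductSpace.Core.inner_mul_inner_self_le ℂ _ _ _ _ (E.core v) x y
  change ‖E.ip x y v‖ * ‖E.ip y x v‖ ≤ (E.ip x x v).re * (E.ip y y v).re at h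
  rw [← E.star_ip x y] at h
  change _ * ‖star (E.ip x y v)‖ ≤ _ at h
  rw [norm_star] at h
  rwa [sq]

theorem re_ip_self_le (x : C_c(E₁, ℂ)) (v : E₀) : (E.ip x x v).re ≤ ‖E.ip x x‖ :=
  (Complex.re_le_norm _).trans (norm_c0_apply_le _ v)

/-- `C_c(E₁)`, to be normed by `‖x‖ = ‖⟨x, x⟩‖^{1/2}`. -/
def PreModule (_ : TopologicalGraph E₀ E₁) : Type _ := C_c(E₁, ℂ)

noncomputable instance : AddCommGroup E.PreModule := inferInstanceAs (AddCommGroup C_c(E₁, ℂ))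

noncomputable instance : Module ℂ E.PreModule := inferInstanceAs (Module ℂ C_c(E₁, ℂ))

/-- The identification of `C_c(E₁)` with its normed copy. -/
noncomputable def toPre : C_c(E₁, ℂ) ≃ₗ[ℂ] E.PreModule where
  toFun x := x
  invFun x := x
  map_add' _ _ := rfl
  map_smul' _ _ := rfl
  left_inv _ := rfl
  right_inv _ := rfl

/-- The underlying function in `C_c(E₁)`. -/
noncomputable def ofPre : E.PreModule →ₗ[ℂ] C_c(E₁, ℂ) := E.toPre.symm

theorem ofPre_toPre (x : C_c(E₁, ℂ)) : E.ofPre (E.toPre x) = x := rfl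

theorem toPre_ofPre (x : E.PreModule) : E.toPre (E.ofPre x) = x := rfl

noncomputable instance : Norm E.PreModule := ⟨fun x => √‖E.ip (E.ofPre x) (E.ofPre x)‖⟩

theorem norm_def (x : E.PreModule) : ‖x‖ = √‖E.ip (E.ofPre x) (E.ofPre x)‖ := rfl

theorem norm_sq_eq (x : E.PreModule) : ‖x‖ ^ 2 = ‖E.ip (E.ofPre x) (E.ofPre x)‖ :=
  Real.sq_sqrt (norm_nonneg _)

theorem norm_preModule_nonneg (x : E.PreModule) : 0 ≤ ‖x‖ := Real.sqrt_nonneg _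

theorem norm_ip_le (x y : E.PreModule) : ‖E.ip (E.ofPre x) (E.ofPre y)‖ ≤ ‖x‖ * ‖y‖ := by
  refine norm_c0_le (mul_nonneg (E.norm_preModule_nonneg x) (E.norm_preModule_nonneg y)) fun v => ?_
  refine (sq_le_sq₀ (norm_nonneg _)
    (mul_nonneg (E.norm_preModule_nonneg x) (E.norm_preModule_nonneg y))).1 ?_
  rw [mul_pow, norm_sq_eq, norm_sq_eq]
  exact (E.ip_cauchySchwarz _ _ v).trans
    (mul_le_mul (E.re_ip_self_le _ v) (E.re_ip_self_le _ v) (E.ip_self_re_nonneg _ v)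
      (norm_nonneg _))

theorem ip_self_eq_zero {x : C_c(E₁, ℂ)} (h : E.ip x x = 0) : x = 0 := by
  refine CompactlySupportedContinuousMap.ext fun e => ?_
  have h1 : E.ip x x (E.s e) = 0 := by rw [h]; rfl
  rw [ip_self_eq, Complex.ofReal_eq_zero] at h1
  by_contra hne
  have hpos : 0 < E.normSqSum x (E.s e) := by
    have hne' : x e ≠ 0 := hne
    rw [normSqSum_eq]
    refine Finset.sum_pos' (fun _ _ => sq_nonneg _) ⟨e, ?_, by positivity⟩
    simpa using subset_tsupport _ hne'
  exact hpos.ne' h1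

theorem normedSpaceCore : NormedSpace.Core ℂ E.PreModule where
  norm_nonneg := E.norm_preModule_nonneg
  norm_smul c x := by
    rw [norm_def, norm_def, map_smul, ip_smul_left, ip_smul_right, smul_smul, norm_smul, norm_mul,
      norm_star, Real.sqrt_mul (by positivity), Real.sqrt_mul_self (norm_nonneg _)]
  norm_triangle x y := by
    refine (sq_le_sq₀ (E.norm_preModule_nonneg _)
      (add_nonneg (E.norm_preModule_nonneg x) (E.norm_preModule_nonneg y))).1 ?_
    have h4 := E.norm_ip_le x y
    have h5 := E.norm_ip_le y x
    have h6 := E.norm_sq_eq x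
    have h7 := E.norm_sq_eq y
    rw [norm_sq_eq, map_add, ip_add_left, ip_add_right, ip_add_right]
    generalize E.ofPre x = x' at *
    generalize E.ofPre y = y' at *
    have h1 := norm_add_le (E.ip x' x' + E.ip x' y') (E.ip y' x' + E.ip y' y')
    have h2 := norm_add_le (E.ip y' x') (E.ip y' y')
    have h3 := norm_add_le (E.ip x' x') (E.ip x' y')
    nlinarith
  norm_eq_zero_iff x := by
    constructor
    · intro h
      have h0 : E.ip (E.ofPre x) (E.ofPre x) = 0 := by
        have := E.norm_sq_eq x
        rw [h] at this
        simpa using this.symm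
      exact E.ip_self_eq_zero h0
    · rintro rfl
      have : E.ip 0 0 = 0 := by simpa using E.ip_smul_right 0 0 0
      rw [norm_def, map_zero, this]; simp

noncomputable instance : NormedAddCommGroup E.PreModule := .ofCore E.normedSpaceCore

noncomputable instance : NormedSpace ℂ E.PreModule := .ofCore E.normedSpaceCore

theorem ip_leftMul (f : C₀(E₀, ℂ)) (x y : C_c(E₁, ℂ)) :
    E.ip (E.leftMul (star f) y) x = E.ip y (E.leftMul f x) := by
  ext v
  rw [ip_apply, ip_apply]
  refine finsum_mem_congr rfl fun e _ => ?_
  change star (star (f (E.r e)) * y e) * x e = star (y e) * (f (E.r e) * x e)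
  rw [star_mul, star_star]; ring

theorem ip_rightMul (f : C₀(E₀, ℂ)) (x y : C_c(E₁, ℂ)) :
    E.ip x (E.rightMul y f) = E.ip x y * f := by
  ext v
  change ∑ᶠ e ∈ E.s ⁻¹' {v}, star (x e) * (y e * f (E.s e)) =
    (∑ᶠ e ∈ E.s ⁻¹' {v}, star (x e) * y e) * f v
  rw [mul_comm, mul_finsum_mem]
  refine finsum_mem_congr rfl fun e he => ?_
  rw [show E.s e = v from he]; ring

theorem norm_leftMul_le (f : C₀(E₀, ℂ)) (x : E.PreModule) :
    ‖E.toPre (E.leftMul f (E.ofPre x))‖ ≤ 1 * ‖f‖ * ‖x‖ := by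
  rw [one_mul]
  refine (sq_le_sq₀ (norm_nonneg _) (by positivity)).1 ?_
  rw [mul_pow, norm_sq_eq, norm_sq_eq, ofPre_toPre]
  generalize E.ofPre x = x'
  refine norm_c0_le (by positivity) fun v => ?_
  rw [ip_self_eq]
  rw [Complex.norm_real, Real.norm_of_nonneg (E.normSqSum_nonneg _ v)]
  have h1 : E.normSqSum (E.leftMul f x') v ≤ ‖f‖ ^ 2 * E.normSqSum x' v := by
    have h2 : E.normSqSum (E.leftMul f x') v =
        ∑ e ∈ (E.finite_fiber x' v).toFinset, ‖E.leftMul f x' e‖ ^ 2 := by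
      refine finsum_mem_eq_sum_of_inter_support_eq _ ?_
      ext e
      simp only [Set.mem_inter_iff, Set.Finite.coe_toFinset, and_congr_left_iff]
      intro he
      have : x' e ≠ 0 := fun h => he (by
        change ‖f (E.r e) * x' e‖ ^ 2 = 0
        simp [h])
      exact ⟨fun h => ⟨h, subset_tsupport _ this⟩, fun h => h.1⟩
    rw [h2, normSqSum_eq, Finset.mul_sum]
    refine Finset.sum_le_sum fun e _ => ?_
    rw [← mul_pow]
    change ‖f (E.r e) * x' e‖ ^ 2 ≤ _
    rw [norm_mul]
    have := norm_c0_apply_le f (E.r e)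
    gcongr
  refine h1.trans (mul_le_mul_of_nonneg_left ?_ (by positivity))
  have := E.re_ip_self_le x' v
  rwa [ip_self_eq, Complex.ofReal_re] at this

theorem norm_rightMul_le (f : C₀(E₀, ℂ)) (x : E.PreModule) :
    ‖E.toPre (E.rightMul (E.ofPre x) f)‖ ≤ 1 * ‖f‖ * ‖x‖ := by
  rw [one_mul]
  refine (sq_le_sq₀ (norm_nonneg _) (by positivity)).1 ?_
  rw [mul_pow, norm_sq_eq, norm_sq_eq, ofPre_toPre, ip_rightMul, ← star_ip, ip_rightMul]
  generalize E.ofPre x = x'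
  have h : star (E.ip x' x' * f) = star f * E.ip x' x' := by
    rw [← E.star_ip x' x']
    ext v
    change star (star (E.ip x' x' v) * f v) = star (f v) * star (E.ip x' x' v)
    rw [star_mul, star_star, E.ip_self_eq x' v, Complex.star_def, Complex.conj_ofReal]
  rw [h]
  calc ‖star f * E.ip x' x' * f‖ ≤ ‖star f‖ * ‖E.ip x' x'‖ * ‖f‖ :=
        (norm_mul_le _ _).trans (mul_le_mul_of_nonneg_right (norm_mul_le _ _) (norm_nonneg _))
    _ = ‖f‖ ^ 2 * ‖E.ip x' x'‖ := by
        have hn : ‖star f‖ = ‖f‖ := norm_star f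
        rw [hn]; ring

/-- The inner product on `C_c(E₁)` as a bounded sesquilinear map. -/
noncomputable def preInner : E.PreModule →L⋆[ℂ] E.PreModule →L[ℂ] C₀(E₀, ℂ) :=
  LinearMap.mkContinuous₂
    (LinearMap.mk₂'ₛₗ (starRingEnd ℂ) (RingHom.id ℂ)
      (fun x y : E.PreModule => E.ip (E.ofPre x) (E.ofPre y))
      (fun _ _ _ => E.ip_add_left _ _ _) (fun _ _ _ => E.ip_smul_left _ _ _)
      (fun _ _ _ => E.ip_add_right _ _ _) (fun _ _ _ => E.ip_smul_right _ _ _)) 1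
    (fun x y => (E.norm_ip_le x y).trans_eq (by ring))

theorem preInner_toPre (x y : C_c(E₁, ℂ)) : E.preInner (E.toPre x) (E.toPre y) = E.ip x y := rfl

/-- The left action on `C_c(E₁)` as a bounded bilinear map. -/
noncomputable def preLeft : C₀(E₀, ℂ) →L[ℂ] E.PreModule →L[ℂ] E.PreModule :=
  LinearMap.mkContinuous₂
    (LinearMap.mk₂ ℂ (fun (f : C₀(E₀, ℂ)) (x : E.PreModule) => E.toPre (E.leftMul f (E.ofPre x)))
      (fun _ _ _ => CompactlySupportedContinuousMap.ext fun _ => add_mul _ _ _)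
      (fun _ _ _ => CompactlySupportedContinuousMap.ext fun _ => mul_assoc _ _ _)
      (fun _ _ _ => CompactlySupportedContinuousMap.ext fun _ => mul_add _ _ _)
      (fun _ _ _ => CompactlySupportedContinuousMap.ext fun _ => mul_left_comm _ _ _)) 1
    (fun f x => E.norm_leftMul_le f x)

theorem preLeft_toPre (f : C₀(E₀, ℂ)) (x : C_c(E₁, ℂ)) :
    E.preLeft f (E.toPre x) = E.toPre (E.leftMul f x) := rfl

/-- The right action on `C_c(E₁)` as a bounded bilinear map. -/
noncomputable def preRight : C₀(E₀, ℂ) →L[ℂ] E.PreModule →L[ℂ] E.PreModule :=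
  LinearMap.mkContinuous₂
    (LinearMap.mk₂ ℂ (fun (f : C₀(E₀, ℂ)) (x : E.PreModule) => E.toPre (E.rightMul (E.ofPre x) f))
      (fun _ _ _ => CompactlySupportedContinuousMap.ext fun _ => mul_add _ _ _)
      (fun _ _ _ => CompactlySupportedContinuousMap.ext fun _ => mul_left_comm _ _ _)
      (fun _ _ _ => CompactlySupportedContinuousMap.ext fun _ => add_mul _ _ _)
      (fun _ _ _ => CompactlySupportedContinuousMap.ext fun _ => mul_assoc _ _ _)) 1
    (fun f x => E.norm_rightMul_le f x)

theorem preRight_toPre (f : C₀(E₀, ℂ)) (x : C_c(E₁, ℂ)) :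
    E.preRight f (E.toPre x) = E.toPre (E.rightMul x f) := rfl

/-- The completion `X(E)` of `C_c(E₁)`. -/
abbrev GraphModule : Type _ := UniformSpace.Completion E.PreModule

/-- The inclusion of the normed space `C_c(E₁)` in its completion `X(E)`. -/
noncomputable def inclL : E.PreModule →L[ℂ] E.GraphModule := UniformSpace.Completion.toComplL

/-- The inclusion of `C_c(E₁)` in `X(E)`. -/
noncomputable def incl : C_c(E₁, ℂ) →ₗ[ℂ] E.GraphModule :=
  E.inclL.toLinearMap.comp E.toPre.toLinearMap

theorem incl_apply (x : C_c(E₁, ℂ)) : E.incl x = E.inclL (E.toPre x) := rfl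

theorem denseRange_inclL : DenseRange E.inclL :=
  UniformSpace.Completion.denseRange_coe (α := E.PreModule)

theorem denseRange_incl : DenseRange E.incl :=
  E.denseRange_inclL.comp E.toPre.surjective.denseRange E.inclL.continuous

theorem isUniformInducing_inclL : IsUniformInducing E.inclL :=
  UniformSpace.Completion.isUniformInducing_coe E.PreModule

theorem extend_incl {F : Type*} [AddCommGroup F] [UniformSpace F] [IsUniformAddGroup F] [T0Space F]
    [Module ℂ F] [ContinuousConstSMul ℂ F] [CompleteSpace F] {σ : ℂ →+* ℂ} (T : E.PreModule →SL[σ] F) (x : C_c(E₁, ℂ)) :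
    T.extend E.inclL (E.incl x) = T (E.toPre x) :=
  ContinuousLinearMap.extend_eq T E.denseRange_inclL E.isUniformInducing_inclL _

/-- The inner product of `X(E)`. -/
noncomputable def inner : E.GraphModule →L⋆[ℂ] E.GraphModule →L[ℂ] C₀(E₀, ℂ) :=
  ((E.preInner.extend E.inclL).flip.extend E.inclL).flip

theorem inner_incl (x y : C_c(E₁, ℂ)) : E.inner (E.incl x) (E.incl y) = E.ip x y := by
  rw [inner, ContinuousLinearMap.flip_apply, extend_incl, ContinuousLinearMap.flip_apply,
    extend_incl, preInner_toPre]

/-- The left action of `C₀(E₀)` on `X(E)`. -/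
noncomputable def left : C₀(E₀, ℂ) →L[ℂ] E.GraphModule →L[ℂ] E.GraphModule :=
  (((ContinuousLinearMap.compL ℂ _ _ _ E.inclL).comp E.preLeft).flip.extend E.inclL).flip

theorem left_incl (f : C₀(E₀, ℂ)) (x : C_c(E₁, ℂ)) :
    E.left f (E.incl x) = E.incl (E.leftMul f x) := by
  rw [left, ContinuousLinearMap.flip_apply, extend_incl]
  rfl

/-- The right action of `C₀(E₀)` on `X(E)`. -/
noncomputable def right : C₀(E₀, ℂ) →L[ℂ] E.GraphModule →L[ℂ] E.GraphModule :=
  (((ContinuousLinearMap.compL ℂ _ _ _ E.inclL).comp E.preRight).flip.extend E.inclL).flip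

theorem right_incl (f : C₀(E₀, ℂ)) (x : C_c(E₁, ℂ)) :
    E.right f (E.incl x) = E.incl (E.rightMul x f) := by
  rw [right, ContinuousLinearMap.flip_apply, extend_incl]
  rfl

theorem inner_self_nonneg (x : E.GraphModule) (v : E₀) :
    E.inner x x v = ((E.inner x x v).re : ℂ) ∧ 0 ≤ (E.inner x x v).re := by
  have hev : Continuous fun f : C₀(E₀, ℂ) => f v :=
    (LipschitzWith.of_dist_le_mul (K := 1) fun f g => by
      rw [dist_eq_norm, dist_eq_norm, NNReal.coe_one, one_mul]
      exact norm_c0_apply_le (f - g) v).continuous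
  have hc : Continuous fun x : E.GraphModule => E.inner x x v := 
    hev.comp (E.inner.continuous.clm_apply continuous_id)
  refine E.denseRange_incl.induction_on x ?_ fun a => ?_
  · exact (isClosed_eq hc (Complex.continuous_ofReal.comp (Complex.continuous_re.comp hc))).inter
      (isClosed_le continuous_const (Complex.continuous_re.comp hc))
  · rw [inner_incl]
    exact ⟨E.ip_self_eq_re a v, E.ip_self_re_nonneg a v⟩

theorem norm_incl_sq (x : C_c(E₁, ℂ)) : ‖E.incl x‖ ^ 2 = ‖E.ip x x‖ := by
  have : ‖E.incl x‖ = ‖E.toPre x‖ := UniformSpace.Completion.norm_coe _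
  rw [this, norm_sq_eq, ofPre_toPre]

/-- The graph correspondence `X(E)` of a topological graph. -/
noncomputable def correspondence : CStarCorrespondence C₀(E₀, ℂ) E.GraphModule where
  inner := E.inner
  right := E.right
  left := E.left
  right_mul f g x := by
    refine E.denseRange_incl.induction_on x (isClosed_eq (by fun_prop) (by fun_prop)) fun a => ?_
    rw [right_incl, right_incl, right_incl]
    congr 1
    exact CompactlySupportedContinuousMap.ext fun _ => (mul_assoc _ _ _).symm
  left_mul f g x := by
    refine E.denseRange_incl.induction_on x (isClosed_eq (by fun_prop) (by fun_prop)) fun a => ?_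
    rw [left_incl, left_incl, left_incl]
    congr 1
    exact CompactlySupportedContinuousMap.ext fun _ => mul_assoc _ _ _
  inner_right x y f := by
    refine E.denseRange_incl.induction_on₂ (isClosed_eq (by fun_prop) (by fun_prop))
      (fun a b => ?_) x y
    rw [right_incl, inner_incl, inner_incl, ip_rightMul]
  star_inner x y := by
    refine E.denseRange_incl.induction_on₂ (isClosed_eq (by fun_prop) (by fun_prop))
      (fun a b => ?_) x y
    rw [inner_incl, inner_incl, star_ip]
  inner_self_nonneg x := exists_star_mul_of_nonneg _ (E.inner_self_nonneg x)
  norm_sq x := by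
    refine E.denseRange_incl.induction_on x (isClosed_eq (by fun_prop) (by fun_prop)) fun a => ?_
    rw [inner_incl, norm_incl_sq]
  inner_left f x y := by
    refine E.denseRange_incl.induction_on₂ (isClosed_eq (by fun_prop) (by fun_prop))
      (fun a b => ?_) x y
    rw [left_incl, left_incl, inner_incl, inner_incl, ip_leftMul]

end TopologicalGraph

/-! ### Representations of topological graphs -/

/-- The square root of a nonnegative compactly supported function. -/
noncomputable def sqrtCc {Y : Type*} [TopologicalSpace Y] (g : C_c(Y, ℝ≥0)) : C_c(Y, ℂ) where
  toFun e := ((NNReal.sqrt (g e) : ℝ) : ℂ)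
  continuous_toFun := Complex.continuous_ofReal.comp
    (NNReal.continuous_coe.comp (NNReal.continuous_sqrt.comp (map_continuous g)))
  hasCompactSupport' :=
    g.hasCompactSupport.comp_left (g := fun c : ℝ≥0 => ((NNReal.sqrt c : ℝ) : ℂ)) (by simp)

namespace TopologicalGraph

variable {E₀ E₁ : Type*} [TopologicalSpace E₀] [T2Space E₀] [LocallyCompactSpace E₀]
  [TopologicalSpace E₁] [T2Space E₁] [LocallyCompactSpace E₁] (E : TopologicalGraph E₀ E₁)

/-- `U` is an `s`-section: `s` restricts to a homeomorphism of `U` onto its image. -/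
def IsSSection (U : Set E₁) : Prop := Topology.IsEmbedding (U.domRestrict E.s)

/-- `f` is the function `x̂` with `x̂(s(e)) = |x(e)|²` if `x(e) ≠ 0`, which vanishes off
`s({x ≠ 0})`. -/
def IsHat (x : C_c(E₁, ℂ)) (f : C₀(E₀, ℂ)) : Prop :=
  (∀ e, x e ≠ 0 → f (E.s e) = ((‖x e‖ ^ 2 : ℝ) : ℂ)) ∧
    ∀ v, v ∉ E.s '' {e | x e ≠ 0} → f v = 0

/-- If `{x ≠ 0}` is contained in an `s`-section, then `x̂` exists, and `x̂ = ⟨x, x⟩`. -/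
theorem isHat_iff {x : C_c(E₁, ℂ)} {U : Set E₁} (hU : E.IsSSection U) (hx : {e | x e ≠ 0} ⊆ U)
    (f : C₀(E₀, ℂ)) : E.IsHat x f ↔ f = E.ip x x := by
  have h1 : ∀ e, x e ≠ 0 → E.normSqSum x (E.s e) = ‖x e‖ ^ 2 := by
    intro e he
    have h : E.normSqSum x (E.s e) = ∑ e' ∈ {e}, ‖x e'‖ ^ 2 := by
      refine finsum_mem_eq_sum_of_inter_support_eq _ ?_
      ext e'
      simp only [Set.mem_inter_iff, Set.mem_preimage, Set.mem_singleton_iff, Finset.coe_singleton,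
        and_congr_left_iff]
      intro he'
      have hne : x e' ≠ 0 := fun h => he' (by simp [h])
      refine ⟨fun h => ?_, fun h => by rw [h]⟩
      exact congrArg Subtype.val (hU.injective (a₁ := ⟨e', hx hne⟩) (a₂ := ⟨e, hx he⟩) h)
    rw [h, Finset.sum_singleton]
  have h2 : ∀ v, v ∉ E.s '' {e | x e ≠ 0} → E.ip x x v = 0 := by
    intro v hv
    rw [ip_apply]
    refine finsum_mem_eq_zero_of_forall_eq_zero fun e he => ?_
    have : x e = 0 := by
      by_contra h
      exact hv ⟨e, h, he⟩
    rw [this, mul_zero]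
  constructor
  · rintro ⟨ha, hb⟩
    ext v
    by_cases hv : v ∈ E.s '' {e | x e ≠ 0}
    · obtain ⟨e, he, rfl⟩ := hv
      rw [ha e he, ip_self_eq, h1 e he]
    · rw [hb v hv, h2 v hv]
  · rintro rfl
    exact ⟨fun e he => by rw [ip_self_eq, h1 e he], h2⟩

/-- The complement of the closure of the range of `r`. -/
def sce : Set E₀ := (closure (Set.range E.r))ᶜ

/-- The vertices with a neighbourhood `N` such that `r⁻¹(N)` is compact. -/
def fin : Set E₀ := {v | ∃ N ∈ 𝓝 v, IsCompact (E.r ⁻¹' N)}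

/-- The regular vertices. -/
def rg : Set E₀ := E.fin \ closure E.sce

variable {B : Type*} [NonUnitalCStarAlgebra B]

/-- Toeplitz representations of a topological graph. -/
structure IsToeplitz (ψ : C_c(E₁, ℂ) →ₗ[ℂ] B) (π : C₀(E₀, ℂ) →⋆ₙₐ[ℂ] B) : Prop where
  map_leftMul : ∀ f x, ψ (E.leftMul f x) = π f * ψ x
  map_hat : ∀ (x : C_c(E₁, ℂ)) (U : Set E₁), IsOpen U → E.IsSSection U → tsupport x ⊆ U →
    ∀ f, E.IsHat x f → π f = star (ψ x) * ψ x
  star_mul_eq_zero : ∀ (x y : C_c(E₁, ℂ)) (U V : Set E₁), IsOpen U → E.IsSSection U → IsOpen V →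
    E.IsSSection V → Disjoint U V → tsupport x ⊆ U → tsupport y ⊆ V → star (ψ x) * ψ y = 0

/-- Covariant Toeplitz representations of a topological graph. The set `𝒢` consists of nonnegative
functions in `C_c(E_rg)` and generates `C₀(E_rg)`, regarded as an ideal of `C₀(E₀)`. -/
structure IsCovariant (ψ : C_c(E₁, ℂ) →ₗ[ℂ] B) (π : C₀(E₀, ℂ) →⋆ₙₐ[ℂ] B) : Prop extends
    E.IsToeplitz ψ π where
  covariant : ∃ 𝒢 : Set C₀(E₀, ℂ),
    (∀ f ∈ 𝒢, (∀ v, 0 ≤ f v) ∧ HasCompactSupport f ∧ tsupport f ⊆ E.rg) ∧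
    ((NonUnitalStarAlgebra.adjoin ℂ 𝒢).topologicalClosure : Set C₀(E₀, ℂ)) =
      {f | ∀ v, v ∉ E.rg → f v = 0} ∧
    ∀ f ∈ 𝒢, ∃ (𝒩 : Finset (Set E₁)) (g : Set E₁ → C_c(E₁, ℝ≥0)),
      (∀ N ∈ 𝒩, IsOpen N ∧ E.IsSSection N) ∧
      E.r ⁻¹' tsupport f ⊆ ⋃ N ∈ 𝒩, N ∧
      (∀ N ∈ 𝒩, {e | g N e ≠ 0} ⊆ N ∩ E.r ⁻¹' tsupport f) ∧
      (∀ e, ∑ N ∈ 𝒩, ((g N e : ℝ) : ℂ) = f (E.r e)) ∧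
      π f = ∑ N ∈ 𝒩, ψ (sqrtCc (g N)) * star (ψ (sqrtCc (g N)))

end TopologicalGraph

namespace TopologicalGraph

variable {E₀ E₁ : Type u} [TopologicalSpace E₀] [T2Space E₀] [LocallyCompactSpace E₀]
  [TopologicalSpace E₁] [T2Space E₁] [LocallyCompactSpace E₁] (E : TopologicalGraph E₀ E₁)

/-- Universal covariant Toeplitz representations of a topological graph. -/
def IsUniversalCovariant {B : Type u} [NonUnitalCStarAlgebra B] (ψ : C_c(E₁, ℂ) →ₗ[ℂ] B)
    (π : C₀(E₀, ℂ) →⋆ₙₐ[ℂ] B) : Prop :=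
  E.IsCovariant ψ π ∧ ∀ (C : Type u) [NonUnitalCStarAlgebra C] (ψ' : C_c(E₁, ℂ) →ₗ[ℂ] C)
    (π' : C₀(E₀, ℂ) →⋆ₙₐ[ℂ] C), E.IsCovariant ψ' π' →
      ∃ h : B →⋆ₙₐ[ℂ] C, (∀ x, h (ψ x) = ψ' x) ∧ ∀ f, h (π f) = π' f

/-- The topological graph algebra `O(E)`, which is the algebra `O_X` of the correspondence
`X = X(E)`. -/
abbrev O : Type u := E.correspondence.KatsuraAlgebra

/-- The restriction `j₁` of `j_X` to `C_c(E₁)`. -/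
noncomputable def j₁ : C_c(E₁, ℂ) →ₗ[ℂ] E.O := E.correspondence.jX.comp E.incl

/-- The homomorphism `j₀ : C₀(E₀) → O(E)`. -/
noncomputable def j₀ : C₀(E₀, ℂ) →⋆ₙₐ[ℂ] E.O := E.correspondence.jA

end TopologicalGraph

/-! ### Directed graphs -/

/-- A directed graph; an edge `e` points from `s e` to `r e`. -/
structure DirectedGraph (V Ed : Type*) where
  r : Ed → V
  s : Ed → V

namespace DirectedGraph

variable {V Ed : Type*} (E : DirectedGraph V Ed)

/-- Each vertex receives only finitely many edges. -/
class RowFinite : Prop where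
  finite_preimage : ∀ v, (E.r ⁻¹' {v}).Finite

/-- Each vertex receives an edge. -/
class NoSources : Prop where
  exists_edge : ∀ v, ∃ e, E.r e = v

/-- `E.IsPath v [e₁, …, eₙ]` holds if `r(e₁) = v` and `s(eᵢ) = r(eᵢ₊₁)` for all `i < n`. -/
def IsPath : V → List Ed → Prop
  | _, [] => True
  | v, e :: l => E.r e = v ∧ IsPath (E.s e) l

/-- The finite paths, including the vertices as the paths of length `0`; `start` is the range of
the path. -/
structure FinPath where
  start : V
  edges : List Ed
  isPath : E.IsPath start edges

/-- The path of length `0` at `v`. -/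
def vertexPath (v : V) : E.FinPath := ⟨v, [], trivial⟩

/-- The path `eμ`. -/
def consPath (e : Ed) (μ : E.FinPath) (h : E.s e = μ.start) : E.FinPath :=
  ⟨E.r e, e :: μ.edges, rfl, by rw [h]; exact μ.isPath⟩

/-- The path of length `1` with the edge `e`. -/
def edgePath (e : Ed) : E.FinPath := E.consPath e (E.vertexPath (E.s e)) rfl

/-- The infinite path space `E^∞`. -/
def InfPath : Type _ := {z : ℕ → Ed // ∀ i, E.s (z i) = E.r (z (i + 1))}

/-- The topology of `E^∞` as a subspace of the product of discrete spaces. -/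
instance : TopologicalSpace E.InfPath :=
  .induced Subtype.val (@Pi.topologicalSpace ℕ (fun _ => Ed) fun _ => ⊥)

/-- The cylinder set `Z(μ)`. -/
def cylinder (μ : E.FinPath) : Set E.InfPath :=
  {z | E.r (z.1 0) = μ.start ∧ ∀ i : Fin μ.edges.length, z.1 i = μ.edges.get i}

theorem isOpen_coord (i : ℕ) (S : Set Ed) : IsOpen {z : E.InfPath | z.1 i ∈ S} := by
  let _ : TopologicalSpace Ed := ⊥
  have _ : DiscreteTopology Ed := ⟨rfl⟩
  have h : Continuous fun z : E.InfPath => z.1 i :=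
    (continuous_apply i).comp continuous_induced_dom
  exact (isOpen_discrete S).preimage h

theorem isClopen_coord (i : ℕ) (S : Set Ed) : IsClopen {z : E.InfPath | z.1 i ∈ S} :=
  ⟨⟨E.isOpen_coord i Sᶜ⟩, E.isOpen_coord i S⟩

theorem isClopen_cylinder (μ : E.FinPath) : IsClopen (E.cylinder μ) := by
  have : E.cylinder μ = {z | z.1 0 ∈ E.r ⁻¹' {μ.start}} ∩
      ⋂ i : Fin μ.edges.length, {z : E.InfPath | z.1 i ∈ ({μ.edges.get i} : Set Ed)} := by
    ext z; simp [cylinder]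
  rw [this]
  exact (E.isClopen_coord 0 _).inter (isClopen_iInter_of_finite fun i => E.isClopen_coord i _)

instance : T2Space E.InfPath := by
  let _ : TopologicalSpace Ed := ⊥
  have _ : DiscreteTopology Ed := ⟨rfl⟩
  exact T2Space.of_injective_continuous (f := (Subtype.val : E.InfPath → ℕ → Ed))
    Subtype.val_injective continuous_induced_dom

/-- The edges that can occur at the place `n` in an infinite path with range `v`. -/
def reach (v : V) : ℕ → Set Ed
  | 0 => E.r ⁻¹' {v}
  | n + 1 => ⋃ e ∈ reach v n, E.r ⁻¹' {E.s e}

theorem finite_reach [E.RowFinite] (v : V) (n : ℕ) : (E.reach v n).Finite := by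
  induction n with
  | zero => exact RowFinite.finite_preimage v
  | succ n ih => exact ih.biUnion fun e _ => RowFinite.finite_preimage (E.s e)

theorem isCompact_range_eq [E.RowFinite] (v : V) :
    IsCompact {z : E.InfPath | z.1 0 ∈ E.r ⁻¹' {v}} := by
  have hcl := (E.isClopen_coord 0 (E.r ⁻¹' {v})).1
  let _ : TopologicalSpace Ed := ⊥
  have _ : DiscreteTopology Ed := ⟨rfl⟩
  have hemb : Topology.IsClosedEmbedding (Subtype.val : E.InfPath → ℕ → Ed) := by
    refine ⟨⟨⟨rfl⟩, Subtype.val_injective⟩, ?_⟩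
    have : Set.range (Subtype.val : E.InfPath → ℕ → Ed) =
        ⋂ i, {z : ℕ → Ed | E.s (z i) = E.r (z (i + 1))} := by
      ext z
      simp only [Set.mem_range, Set.mem_iInter, Set.mem_ofPred_eq]
      exact ⟨fun ⟨w, hw⟩ => hw ▸ w.2, fun h => ⟨⟨z, h⟩, rfl⟩⟩
    rw [this]
    refine isClosed_iInter fun i => ?_
    have h : Continuous fun z : ℕ → Ed => (z i, z (i + 1)) := by fun_prop
    exact (isClosed_discrete {p : Ed × Ed | E.s p.1 = E.r p.2}).preimage h
  have hK : IsCompact (Set.univ.pi (E.reach v)) :=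
    isCompact_univ_pi fun n => (E.finite_reach v n).isCompact
  refine (hemb.isCompact_preimage hK).of_isClosed_subset hcl ?_
  intro z hz n _
  induction n with
  | zero => exact hz
  | succ n ih => exact Set.mem_iUnion₂.2 ⟨z.1 n, ih (Set.mem_univ _), (z.2 n).symm⟩

theorem isCompact_cylinder [E.RowFinite] (μ : E.FinPath) : IsCompact (E.cylinder μ) :=
  (E.isCompact_range_eq μ.start).of_isClosed_subset (E.isClopen_cylinder μ).1 fun _ h => h.1

instance [E.RowFinite] : LocallyCompactSpace E.InfPath := by
  have _ : WeaklyLocallyCompactSpace E.InfPath := ⟨fun z =>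
    ⟨_, E.isCompact_range_eq (E.r (z.1 0)), (E.isOpen_coord 0 _).mem_nhds rfl⟩⟩
  infer_instance

/-- The left shift on `E^∞`. -/
def shift (z : E.InfPath) : E.InfPath := ⟨fun i => z.1 (i + 1), fun i => z.2 (i + 1)⟩

theorem continuous_infPath {Y : Type*} [TopologicalSpace Y] {f : Y → E.InfPath}
    (h : ∀ i e, IsOpen {y | (f y).1 i = e}) : Continuous f := by
  let _ : TopologicalSpace Ed := ⊥
  have _ : DiscreteTopology Ed := ⟨rfl⟩
  refine continuous_induced_rng.2 (continuous_pi fun i => ?_)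
  exact continuous_discrete_rng.2 fun e => h i e

/-- The infinite path `ez`. -/
def consInf (e : Ed) (z : E.InfPath) (h : E.s e = E.r (z.1 0)) : E.InfPath :=
  ⟨fun i => match i with
    | 0 => e
    | i + 1 => z.1 i, fun i => match i with
    | 0 => h
    | i + 1 => z.2 i⟩

theorem isLocalHomeomorph_shift : IsLocalHomeomorph E.shift := by
  rw [isLocalHomeomorph_iff_isOpenEmbedding_restrict]
  intro z
  refine ⟨{w | w.1 0 ∈ ({z.1 0} : Set Ed)}, (E.isOpen_coord 0 _).mem_nhds rfl, ?_⟩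
  let T : Set E.InfPath := {w | w.1 0 ∈ E.r ⁻¹' {E.s (z.1 0)}}
  let H : {w : E.InfPath | w.1 0 ∈ ({z.1 0} : Set Ed)} ≃ₜ T :=
    { toFun := fun w => ⟨E.shift w.1, by
        have h1 : w.1.1 0 = z.1 0 := w.2
        have h2 := w.1.2 0
        rw [h1] at h2
        exact h2.symm⟩
      invFun := fun w => ⟨E.consInf (z.1 0) w.1
        (show E.r (w.1.1 0) = E.s (z.1 0) from w.2).symm, Set.mem_singleton _⟩
      left_inv := fun w => by
        refine Subtype.ext (Subtype.ext (funext fun i => ?_))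
        cases i with
        | zero => exact (show w.1.1 0 = z.1 0 from w.2).symm
        | succ i => rfl
      right_inv := fun w => rfl
      continuous_toFun := by
        refine Continuous.subtype_mk (E.continuous_infPath fun i e => ?_) _
        exact (E.isOpen_coord (i + 1) {e}).preimage continuous_subtype_val
      continuous_invFun := by
        refine Continuous.subtype_mk (E.continuous_infPath fun i e => ?_) _
        cases i with
        | zero => exact (isOpen_const (p := z.1 0 = e))
        | succ i => exact (E.isOpen_coord i {e}).preimage continuous_subtype_val }
  have hT : IsOpen T := E.isOpen_coord 0 _
  exact hT.isOpenEmbedding_subtypeVal.comp H.isOpenEmbedding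

/-- The topological graph `Ê` on `E^∞`, with the identity as range map and the shift as source
map. -/
def hat [E.RowFinite] : TopologicalGraph E.InfPath E.InfPath where
  r := id
  s := E.shift
  continuous_r := continuous_id
  isLocalHomeomorph_s := E.isLocalHomeomorph_shift

/-- The characteristic function of `Z(μ)` in `C_c(E^∞)`. -/
noncomputable def chi [E.RowFinite] (μ : E.FinPath) : C_c(E.InfPath, ℂ) where
  toFun := (E.cylinder μ).indicator fun _ => 1
  continuous_toFun := continuous_const.indicator (by simp [(E.isClopen_cylinder μ).frontier_eq])
  hasCompactSupport' := HasCompactSupport.intro (E.isCompact_cylinder μ) fun _ h =>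
    Set.indicator_of_notMem h _

/-- The characteristic function of `Z(μ)` in `C₀(E^∞)`. -/
noncomputable def chi₀ [E.RowFinite] (μ : E.FinPath) : C₀(E.InfPath, ℂ) where
  toFun := (E.cylinder μ).indicator fun _ => 1
  continuous_toFun := (E.chi μ).continuous
  zero_at_infty' := (E.chi μ).hasCompactSupport.is_zero_at_infty

variable {B : Type*} [NonUnitalCStarAlgebra B]

/-- Cuntz-Krieger `E`-families. The relation `relation_le` says that `q_v ≥ ∑_{e ∈ F} t_e t_e*`. -/
structure IsCuntzKriegerFamily (q : V → B) (t : Ed → B) : Prop where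
  star_vertex : ∀ v, star (q v) = q v
  vertex_mul_self : ∀ v, q v * q v = q v
  vertex_mul_vertex : ∀ v w, v ≠ w → q v * q w = 0
  partialIsometry : ∀ e, t e * star (t e) * t e = t e
  star_edge_mul_edge : ∀ e, star (t e) * t e = q (E.s e)
  relation_le : ∀ (v : V) (F : Finset Ed), (∀ e ∈ F, E.r e = v) →
    ∃ b : B, q v - ∑ e ∈ F, t e * star (t e) = star b * b
  relation_sum : ∀ (v : V) (h : (E.r ⁻¹' {v}).Finite), (E.r ⁻¹' {v}).Nonempty →
    q v = ∑ e ∈ h.toFinset, t e * star (t e)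

/-- The product `t_{e₁} t_{e₂} ⋯ t_{eₙ}` for the nonempty list `e₁, e₂, …, eₙ`. -/
def pathProd (t : Ed → B) : Ed → List Ed → B
  | e, [] => t e
  | e, e' :: l => t e * pathProd t e' l

/-- The element `t_μ`, which is `q_v` if `μ` is the vertex `v` and `t_{μ₁} ⋯ t_{μₙ}` otherwise. -/
def FinPath.elem {E : DirectedGraph V Ed} (q : V → B) (t : Ed → B) (μ : E.FinPath) : B :=
  match μ.edges with
  | [] => q μ.start
  | e :: l => pathProd t e l

variable {E}

theorem IsCuntzKriegerFamily.norm_vertex_le {q : V → B} {t : Ed → B}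
    (h : E.IsCuntzKriegerFamily q t) (v : V) : ‖q v‖ ≤ 1 := by
  have h1 : ‖q v‖ * ‖q v‖ = ‖q v‖ := by
    rw [← CStarRing.norm_star_mul_self, h.star_vertex, h.vertex_mul_self]
  nlinarith [norm_nonneg (q v)]

theorem IsCuntzKriegerFamily.norm_edge_le {q : V → B} {t : Ed → B}
    (h : E.IsCuntzKriegerFamily q t) (e : Ed) : ‖t e‖ ≤ 1 := by
  have h1 : ‖t e‖ * ‖t e‖ = ‖q (E.s e)‖ := by
    rw [← CStarRing.norm_star_mul_self, h.star_edge_mul_edge]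
  nlinarith [norm_nonneg (t e), h.norm_vertex_le (E.s e)]

end DirectedGraph

namespace DirectedGraph

variable {V Ed : Type u} (E : DirectedGraph V Ed)

/-- The Cuntz-Krieger `E`-families, as families indexed by the vertices and the edges. -/
noncomputable def cuntzKriegerClass : RelationClass (V ⊕ Ed) where
  Holds B _ f := ∃ (q : V → B) (t : Ed → B), E.IsCuntzKriegerFamily q t ∧ f = Sum.elim q t
  bound _ := 1
  norm_le := by
    rintro B _ f ⟨q, t, h, rfl⟩ (v | e)
    · exact h.norm_vertex_le v
    · exact h.norm_edge_le e

/-- The graph algebra `C*(E)`, generated by a universal Cuntz-Krieger `E`-family. -/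
abbrev CStar : Type u := E.cuntzKriegerClass.UnivAlg

/-- The universal projections `p_v`. -/
noncomputable def p (v : V) : E.CStar := E.cuntzKriegerClass.gen (Sum.inl v)

/-- The universal partial isometries `s_e`. -/
noncomputable def S (e : Ed) : E.CStar := E.cuntzKriegerClass.gen (Sum.inr e)

/-- The universal property of `C*(E)`. -/
theorem existsUnique_lift {C : Type u} [NonUnitalCStarAlgebra C] {q : V → C} {t : Ed → C}
    (h : E.IsCuntzKriegerFamily q t) :
    ∃! ρ : E.CStar →⋆ₙₐ[ℂ] C, (∀ v, ρ (E.p v) = q v) ∧ ∀ e, ρ (E.S e) = t e := by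
  have := E.cuntzKriegerClass.existsUnique_lift (Sum.elim q t) ⟨q, t, h, rfl⟩
  simp only [Sum.forall] at this
  exact this

end DirectedGraph

/-! ### Cylinder sets -/

namespace DirectedGraph

variable {V Ed : Type*} {E : DirectedGraph V Ed}

/-! The shift is injective on each `Z(e)`, and the sets `Z(e)` partition `E^∞` into compact open
`s`-sections. A function in `C_c(E^∞)` therefore splits into finitely many pieces `x χ_{Z(e)}`, and
everything is governed by the elements `t_e = ψ(χ_{Z(e)})` and the pull-backs `g ↦ (z ↦ g(ez))`. A
Toeplitz representation amounts to the two relations `ψ(x) = ∑ π(x) t_e` and `t_e* π(g) t_f = δ_{ef}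
π(pullback e g)`, from which `ψ(x)* ψ(y) = π⟨x, y⟩` follows (`star_mul_eq_map_ip`). Products of
cylinder functions are cylinder functions or zero and their span is dense in `C₀(E^∞)`
(`dense_chiSpan`), so closed linear statements are checked on them (`chi_induction`).

From covariant representations to families, the essential point is `q_v = ∑ t_e t_e*`. Since the
range map is the identity, every point is regular. The difference of the two sides is self-adjoint
and annihilates the range of `ψ`; covariance on any generating set then makes it annihilate the
range of `π`, and multiplying by `χ_{Z(v)}` gives the equality (`IsCovariant.vertex_eq_sum`).

From families to representations, `π` must satisfy `π(χ_{Z(μ)}) = t_μ t_μ*`. It is obtained as a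
pointwise limit of homomorphisms `approxHom` that sample a function at one infinite path behind each
finite path of length `n`. Being `*`-homomorphisms they are contractive, and they are eventually
constant on cylinder functions, so the limit exists everywhere. Then `ψ(x) = ∑ π(x) t_e` is the only
possible linear part.

For the algebras, `χ_{Z(eμ)}` acts on `X(Ê)` as the rank-one operator `Θ_{χ,χ}`. Hence the left
action is injective and by compact operators, Katsura's ideal is all of `C₀(E^∞)`, and covariance on
the correspondence is the relation `π(χ) = ψ(χ) ψ(χ)*` for cylinder functions `χ` of paths of
positive length. Extending a representation to the correspondence needs the map `ψ⁽¹⁾`, whose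
contractivity is `norm_le_of_mem_thetaSpan`. The two universal properties then give mutually inverse
homomorphisms between `O(Ê)` and `C*(E)`. -/

theorem mem_cylinder_vertexPath {v : V} {z : E.InfPath} :
    z ∈ E.cylinder (E.vertexPath v) ↔ E.r (z.1 0) = v :=
  ⟨fun h => h.1, fun h => ⟨h, fun i => i.elim0⟩⟩

theorem range_shift (z : E.InfPath) : E.r ((E.shift z).1 0) = E.s (z.1 0) := (z.2 0).symm

theorem mem_cylinder_consPath {e : Ed} {μ : E.FinPath} {h : E.s e = μ.start} {z : E.InfPath} :
    z ∈ E.cylinder (E.consPath e μ h) ↔ z.1 0 = e ∧ E.shift z ∈ E.cylinder μ := by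
  constructor
  · rintro ⟨_, h2⟩
    have h0 : z.1 0 = e := h2 ⟨0, Nat.succ_pos _⟩
    refine ⟨h0, by rw [range_shift, h0, h], fun i => ?_⟩
    exact h2 ⟨i + 1, Nat.succ_lt_succ i.2⟩
  · rintro ⟨h0, _, h2⟩
    refine ⟨congrArg E.r h0, fun i => ?_⟩
    obtain ⟨i, hi⟩ := i
    cases i with
    | zero => exact h0
    | succ i => exact h2 ⟨i, Nat.lt_of_succ_lt_succ hi⟩

theorem mem_cylinder_edgePath {e : Ed} {z : E.InfPath} :
    z ∈ E.cylinder (E.edgePath e) ↔ z.1 0 = e := by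
  refine (mem_cylinder_consPath (h := rfl)).trans ⟨fun h => h.1, fun h => ⟨h, ?_⟩⟩
  rw [mem_cylinder_vertexPath, range_shift, h]

theorem FinPath.induction {C : E.FinPath → Prop} (vertex : ∀ v, C (E.vertexPath v))
    (cons : ∀ e μ (h : E.s e = μ.start), C μ → C (E.consPath e μ h)) (μ : E.FinPath) : C μ := by
  obtain ⟨v, l, hl⟩ := μ
  induction l generalizing v with
  | nil => exact vertex v
  | cons e l ih =>
    obtain ⟨rfl, hl'⟩ := hl
    exact cons e ⟨E.s e, l, hl'⟩ rfl (ih _ hl')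

/-- Without sources a path can be prolonged forever. The resulting point of `Z(v)` later serves as a
sample point. -/
theorem exists_infPath [E.NoSources] (v : V) : ∃ z : E.InfPath, E.r (z.1 0) = v := by
  choose edge hedge using NoSources.exists_edge (E := E)
  refine ⟨⟨fun n => Nat.rec (edge v) (fun _ e => edge (E.s e)) n, fun i => ?_⟩, hedge v⟩
  exact (hedge _).symm

/-- This is the injectivity of the shift on `Z(e)`: the lost edge is known. -/
theorem consInf_shift {e : Ed} {z w : E.InfPath} (h : E.s e = E.r (z.1 0)) (h0 : w.1 0 = e)
    (hw : E.shift w = z) : w = E.consInf e z h := by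
  subst hw
  refine Subtype.ext (funext fun i => ?_)
  cases i with
  | zero => exact h0
  | succ i => rfl

/-- The path `μ` is the initial segment of `x` of length `n`. The condition on the range matters
only for `n = 0`, where no edge is prescribed. -/
theorem exists_prefix (n : ℕ) (x : E.InfPath) : ∃ μ : E.FinPath, ∀ z, z ∈ E.cylinder μ ↔
    E.r (z.1 0) = E.r (x.1 0) ∧ ∀ i < n, z.1 i = x.1 i := by
  induction n generalizing x with
  | zero => exact ⟨E.vertexPath (E.r (x.1 0)), fun z => by simp [mem_cylinder_vertexPath]⟩
  | succ n ih =>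
    obtain ⟨μ, hμ⟩ := ih (E.shift x)
    have hs : E.s (x.1 0) = μ.start := by
      rw [← range_shift]
      exact ((hμ (E.shift x)).2 ⟨rfl, fun _ _ => rfl⟩).1
    refine ⟨E.consPath (x.1 0) μ hs, fun z => ?_⟩
    rw [mem_cylinder_consPath, hμ]
    constructor
    · rintro ⟨h0, -, h2⟩
      refine ⟨by rw [h0], fun i hi => ?_⟩
      cases i with
      | zero => exact h0
      | succ i => exact h2 i (Nat.lt_of_succ_lt_succ hi)
    · rintro ⟨-, h2⟩
      have h0 := h2 0 (Nat.succ_pos n)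
      exact ⟨h0, by rw [range_shift, range_shift, h0], fun i hi => h2 (i + 1) (Nat.succ_lt_succ hi)⟩

/-- The cylinder sets of the paths of positive length form a base of the topology. -/
theorem exists_cylinder_subset {U : Set E.InfPath} (hU : IsOpen U) {x : E.InfPath} (hx : x ∈ U) :
    ∃ (e : Ed) (μ : E.FinPath) (h : E.s e = μ.start),
      x ∈ E.cylinder (E.consPath e μ h) ∧ E.cylinder (E.consPath e μ h) ⊆ U := by
  let _ : TopologicalSpace Ed := ⊥
  obtain ⟨W, hW, rfl⟩ := isOpen_induced_iff.1 hU
  obtain ⟨I, u, hu, hsub⟩ := isOpen_pi_iff.1 hW x.1 hx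
  -- A basic open set restricts only the coordinates in the finite set `I`. The first edge of `x`
  -- followed by the prefix of its shift of length `sup I` fixes the coordinates `0, …, sup I`, and
  -- it has positive length.
  obtain ⟨μ, hμ⟩ := exists_prefix (I.sup id) (E.shift x)
  have hμx : E.shift x ∈ E.cylinder μ := (hμ _).2 ⟨rfl, fun _ _ => rfl⟩
  have hs : E.s (x.1 0) = μ.start := by
    rw [← range_shift]; exact hμx.1
  refine ⟨x.1 0, μ, hs, mem_cylinder_consPath.2 ⟨rfl, hμx⟩, fun z hz => hsub ?_⟩
  obtain ⟨h0, h1⟩ := mem_cylinder_consPath.1 hz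
  intro i hi
  have : z.1 i = x.1 i := by
    cases i with
    | zero => exact h0
    | succ i => exact ((hμ _).1 h1).2 i (Nat.lt_of_succ_le (Finset.le_sup (f := id) hi))
  rw [this]
  exact (hu i hi).2

/-- Either one of two paths extends the other, so that the cylinders are nested and `κ` can be taken
to be the longer path, or the paths disagree somewhere and the cylinders are disjoint. The equality
of starting points carries the induction; the clause on empty edge lists keeps products inside the
span of cylinder functions of positive length. -/
theorem cylinder_inter (μ ν : E.FinPath) :
    E.cylinder μ ∩ E.cylinder ν = ∅ ∨ ∃ κ : E.FinPath, κ.start = ν.start ∧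
      (E.cylinder κ = E.cylinder μ ∩ E.cylinder ν) ∧ (κ.edges = [] → ν.edges = []) := by
  induction μ using FinPath.induction generalizing ν with
  | vertex v =>
    by_cases h : ν.start = v
    · refine Or.inr ⟨ν, rfl, ?_, id⟩
      refine (Set.inter_eq_right.2 fun z hz => ?_).symm
      exact mem_cylinder_vertexPath.2 (hz.1.trans h)
    · refine Or.inl (Set.eq_empty_of_forall_notMem fun z hz => h ?_)
      rw [← hz.2.1, mem_cylinder_vertexPath.1 hz.1]
  | cons e μ hμ ih =>
    induction ν using FinPath.induction with
    | vertex v =>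
      by_cases h : E.r e = v
      · refine Or.inr ⟨E.consPath e μ hμ, h, ?_, fun _ => rfl⟩
        refine (Set.inter_eq_left.2 fun z hz => ?_).symm
        exact mem_cylinder_vertexPath.2 (hz.1.trans h)
      · refine Or.inl (Set.eq_empty_of_forall_notMem fun z hz => h ?_)
        rw [← mem_cylinder_vertexPath.1 hz.2]; exact hz.1.1.symm
    | cons f ν hν _ =>
      by_cases hef : e = f
      · subst hef
        rcases ih ν with h | ⟨κ, h1, h2, -⟩
        · refine Or.inl (Set.eq_empty_of_forall_notMem fun z hz => ?_)
          have : E.shift z ∈ E.cylinder μ ∩ E.cylinder ν :=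
            ⟨(mem_cylinder_consPath.1 hz.1).2, (mem_cylinder_consPath.1 hz.2).2⟩
          rw [h] at this
          exact this
        · refine Or.inr ⟨E.consPath e κ (hν.trans h1.symm), rfl, ?_, fun h => by cases h⟩
          ext z
          rw [Set.mem_inter_iff, mem_cylinder_consPath, mem_cylinder_consPath,
            mem_cylinder_consPath, h2, Set.mem_inter_iff]
          tauto
      · refine Or.inl (Set.eq_empty_of_forall_notMem fun z hz => hef ?_)
        rw [← (mem_cylinder_consPath.1 hz.1).1, (mem_cylinder_consPath.1 hz.2).1]

/-! ### Characteristic functions of cylinder sets -/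

section RowFinite

variable [E.RowFinite]

open Classical in
theorem chi₀_apply (μ : E.FinPath) (z : E.InfPath) :
    E.chi₀ μ z = if z ∈ E.cylinder μ then 1 else 0 :=
  Set.indicator_apply (E.cylinder μ) (fun _ => (1 : ℂ)) z

open Classical in
theorem chi_apply (μ : E.FinPath) (z : E.InfPath) :
    E.chi μ z = if z ∈ E.cylinder μ then 1 else 0 :=
  Set.indicator_apply (E.cylinder μ) (fun _ => (1 : ℂ)) z

theorem chi₀_mul_self (μ : E.FinPath) : E.chi₀ μ * E.chi₀ μ = E.chi₀ μ := by
  ext z; simp [chi₀_apply]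

theorem star_chi₀ (μ : E.FinPath) : star (E.chi₀ μ) = E.chi₀ μ := by
  ext z; simp [chi₀_apply, apply_ite (starRingEnd ℂ)]

theorem chi₀_mul_chi₀ (μ ν : E.FinPath) :
    E.chi₀ μ * E.chi₀ ν = 0 ∨
      ∃ κ, E.chi₀ μ * E.chi₀ ν = E.chi₀ κ ∧ (κ.edges = [] → ν.edges = []) := by
  rcases cylinder_inter μ ν with H | ⟨κ, -, h2, h3⟩
  · refine Or.inl ?_
    ext z
    have hz : ¬ (z ∈ E.cylinder μ ∧ z ∈ E.cylinder ν) := by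
      rw [← Set.mem_inter_iff, H]; exact id
    simp only [ZeroAtInftyContinuousMap.mul_apply, chi₀_apply, ZeroAtInftyContinuousMap.zero_apply]
    rcases not_and_or.1 hz with h | h <;> simp [h]
  · refine Or.inr ⟨κ, ?_, h3⟩
    ext z
    have hz : z ∈ E.cylinder κ ↔ z ∈ E.cylinder μ ∧ z ∈ E.cylinder ν := by
      rw [h2, Set.mem_inter_iff]
    simp only [ZeroAtInftyContinuousMap.mul_apply, chi₀_apply]
    by_cases h : z ∈ E.cylinder μ <;> by_cases h' : z ∈ E.cylinder ν <;> simp [hz, h, h']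

variable (E) in
/-- The linear span of the characteristic functions of the cylinder sets of the paths of positive
length. -/
noncomputable def chiSpan : Submodule ℂ C₀(E.InfPath, ℂ) :=
  Submodule.span ℂ {f | ∃ (e : Ed) (μ : E.FinPath) (h : E.s e = μ.start),
    f = E.chi₀ (E.consPath e μ h)}

theorem chi₀_mem_chiSpan (e : Ed) (μ : E.FinPath) (h : E.s e = μ.start) :
    E.chi₀ (E.consPath e μ h) ∈ E.chiSpan := Submodule.subset_span ⟨e, μ, h, rfl⟩

/-- The span is stable under cutting down to a cylinder, which allows an approximant to be altered
on one cylinder at a time. -/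
theorem chi₀_mul_mem_chiSpan (μ : E.FinPath) {g : C₀(E.InfPath, ℂ)} (hg : g ∈ E.chiSpan) :
    E.chi₀ μ * g ∈ E.chiSpan := by
  induction hg using Submodule.span_induction with
  | mem g hg =>
    obtain ⟨f, ν, hν, rfl⟩ := hg
    rcases chi₀_mul_chi₀ μ (E.consPath f ν hν) with h | ⟨κ, h, h1⟩
    · rw [h]; exact zero_mem _
    · rw [h]
      induction κ using FinPath.induction with
      | vertex v => cases h1 rfl
      | cons a κ hκ _ => exact chi₀_mem_chiSpan a κ hκ
  | zero => rw [mul_zero]; exact zero_mem _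
  | add x y _ _ hx hy => rw [mul_add]; exact add_mem hx hy
  | smul c x _ hx => rw [mul_smul_comm]; exact Submodule.smul_mem _ c hx

/-- Outside a compact set `f` is small, and the compact set is covered by finitely many cylinders on
which `f` varies by less than `ε / 2`. A locally constant approximant is built over this cover. -/
theorem dense_chiSpan : Dense (E.chiSpan : Set C₀(E.InfPath, ℂ)) := by
  intro f
  rw [Metric.mem_closure_iff]
  intro ε hε
  have hε2 : 0 < ε / 2 := half_pos hε
  have hK : ∃ K : Set E.InfPath, IsCompact K ∧ ∀ z ∉ K, ‖f z‖ < ε / 2 := by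
    have h := (f.zero_at_infty').eventually (Metric.ball_mem_nhds 0 hε2)
    obtain ⟨K, hK, h⟩ := Filter.mem_cocompact.1 h
    exact ⟨K, hK, fun z hz => by simpa using h hz⟩
  obtain ⟨K, hK, hfK⟩ := hK
  have hcov : ∀ x : E.InfPath, ∃ (e : Ed) (μ : E.FinPath) (h : E.s e = μ.start),
      x ∈ E.cylinder (E.consPath e μ h) ∧
      ∀ z ∈ E.cylinder (E.consPath e μ h), ‖f z - f x‖ < ε / 2 := by
    intro x
    have hU : IsOpen {z | ‖f z - f x‖ < ε / 2} :=
      isOpen_lt ((map_continuous f).sub continuous_const).norm continuous_const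
    obtain ⟨e, μ, h, h1, h2⟩ := exists_cylinder_subset hU (x := x) (by simpa using hε2)
    exact ⟨e, μ, h, h1, h2⟩
  choose a μ hμ hx hfx using hcov
  obtain ⟨t, -, ht⟩ := hK.elim_nhds_subcover (fun x => E.cylinder (E.consPath (a x) (μ x) (hμ x)))
    (fun x _ => (E.isClopen_cylinder _).2.mem_nhds (hx x))
  -- The approximant has to vanish off the union of the cylinders, where only the smallness of `f`
  -- outside the compact set is available.
  have key : ∀ t : Finset E.InfPath, ∃ g ∈ E.chiSpan, ∀ z,
      ((∃ x ∈ t, z ∈ E.cylinder (E.consPath (a x) (μ x) (hμ x))) → ‖f z - g z‖ < ε / 2) ∧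
      ((∀ x ∈ t, z ∉ E.cylinder (E.consPath (a x) (μ x) (hμ x))) → g z = 0) := by
    intro t
    induction t using Finset.cons_induction with
    | empty => exact ⟨0, zero_mem _, fun z => by simp⟩
    | cons x t hxt ih =>
      obtain ⟨g, hg, hgz⟩ := ih
      -- This function is `f x` on the new cylinder and `g` elsewhere, so overlapping cylinders need
      -- not be made disjoint.
      refine ⟨g + f x • E.chi₀ (E.consPath (a x) (μ x) (hμ x)) -
        E.chi₀ (E.consPath (a x) (μ x) (hμ x)) * g, sub_mem (add_mem hg (Submodule.smul_mem _ _
          (chi₀_mem_chiSpan _ _ _))) (chi₀_mul_mem_chiSpan _ hg), fun z => ?_⟩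
      simp only [ZeroAtInftyContinuousMap.sub_apply, ZeroAtInftyContinuousMap.add_apply,
        ZeroAtInftyContinuousMap.smul_apply, ZeroAtInftyContinuousMap.mul_apply, chi₀_apply,
        Finset.mem_cons, smul_eq_mul]
      by_cases hz : z ∈ E.cylinder (E.consPath (a x) (μ x) (hμ x))
      · refine ⟨fun _ => ?_, fun h => absurd hz (h x (Or.inl rfl))⟩
        simpa [hz] using hfx x z hz
      · simp only [hz, if_false, mul_zero, add_zero, zero_mul, sub_zero]
        refine ⟨?_, fun h => (hgz z).2 fun y hy => h y (Or.inr hy)⟩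
        rintro ⟨y, rfl | hy, hyz⟩
        · exact absurd hyz hz
        · exact (hgz z).1 ⟨y, hy, hyz⟩
  obtain ⟨g, hg, hgz⟩ := key t
  refine ⟨g, hg, ?_⟩
  rw [dist_eq_norm]
  refine lt_of_le_of_lt (norm_c0_le hε2.le fun z => ?_) (half_lt_self hε)
  rw [ZeroAtInftyContinuousMap.sub_apply]
  by_cases hz : ∃ x ∈ t, z ∈ E.cylinder (E.consPath (a x) (μ x) (hμ x))
  · exact ((hgz z).1 hz).le
  · push Not at hz
    rw [(hgz z).2 hz, sub_zero]
    refine (hfK z fun hzK => ?_).le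
    obtain ⟨x, hxt, hxz⟩ := Set.mem_iUnion₂.1 (ht hzK)
    exact hz x hxt hxz

/-- A closed linear property holds for all functions in `C₀(E^∞)` if it holds for the
characteristic functions of the cylinder sets of the paths of positive length. -/
theorem chi_induction {p : C₀(E.InfPath, ℂ) → Prop} (closed : IsClosed {g | p g})
    (add : ∀ f g, p f → p g → p (f + g)) (smul : ∀ (c : ℂ) f, p f → p (c • f))
    (chi : ∀ e μ (h : E.s e = μ.start), p (E.chi₀ (E.consPath e μ h))) (zero : p 0)
    (g : C₀(E.InfPath, ℂ)) : p g := by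
  have h : (E.chiSpan : Set C₀(E.InfPath, ℂ)) ⊆ {g | p g} := by
    intro g hg
    refine Submodule.span_induction ?_ zero (fun f g _ _ => add f g) (fun c f _ => smul c f) hg
    rintro _ ⟨e, μ, h, rfl⟩
    exact chi e μ h
  exact closure_minimal h closed (dense_chiSpan g)

theorem continuous_starAlgHom {A B : Type*} [NonUnitalCStarAlgebra A] [NonUnitalCStarAlgebra B]
    (φ : A →⋆ₙₐ[ℂ] B) : Continuous φ :=
  AddMonoidHomClass.continuous_of_bound φ 1
    (fun x => by simpa using NonUnitalStarAlgHom.norm_apply_le φ x)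

theorem ext_chi₀ {B : Type*} [NonUnitalCStarAlgebra B] {π π' : C₀(E.InfPath, ℂ) →⋆ₙₐ[ℂ] B}
    (h : ∀ e μ (h : E.s e = μ.start), π (E.chi₀ (E.consPath e μ h)) =
      π' (E.chi₀ (E.consPath e μ h))) : π = π' := by
  ext g
  refine chi_induction (p := fun g => π g = π' g)
    (isClosed_eq (continuous_starAlgHom π) (continuous_starAlgHom π')) (fun f g hf hg => ?_)
    (fun c f hf => ?_) h (by simp) g
  · rw [map_add, map_add, hf, hg]
  · rw [map_smul, map_smul, hf]

end RowFinite

end DirectedGraph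

/-! ### Functions on the path space -/

/-- A compactly supported function, regarded as a function which vanishes at infinity. -/
noncomputable def CompactlySupportedContinuousMap.toC₀ {Y : Type*} [TopologicalSpace Y]
    (x : C_c(Y, ℂ)) : C₀(Y, ℂ) where
  toFun := x
  continuous_toFun := map_continuous x
  zero_at_infty' := x.hasCompactSupport.is_zero_at_infty

theorem CompactlySupportedContinuousMap.toC₀_apply {Y : Type*} [TopologicalSpace Y]
    (x : C_c(Y, ℂ)) (y : Y) : x.toC₀ y = x y := rfl

namespace DirectedGraph

variable {V Ed : Type*} {E : DirectedGraph V Ed}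

theorem consInf_zero (e : Ed) (z : E.InfPath) (h : E.s e = E.r (z.1 0)) :
    (E.consInf e z h).1 0 = e := rfl

theorem consInf_mem_consPath {e : Ed} {μ : E.FinPath} {hμ : E.s e = μ.start} {z : E.InfPath}
    {h : E.s e = E.r (z.1 0)} : E.consInf e z h ∈ E.cylinder (E.consPath e μ hμ) ↔
      z ∈ E.cylinder μ :=
  mem_cylinder_consPath.trans ⟨fun h => h.2, fun h => ⟨rfl, h⟩⟩

/-- The open sets `{z | z.1 0 = e}` partition the path space, so a compact support meets only
finitely many of them. This makes the sums over edges below finite, although `E` may have infinitely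
many edges. -/
theorem exists_finset_edges (x : C_c(E.InfPath, ℂ)) :
    ∃ F : Finset Ed, ∀ z, x z ≠ 0 → z.1 0 ∈ F := by
  obtain ⟨t, -, ht⟩ := x.hasCompactSupport.isCompact.elim_nhds_subcover
    (fun w : E.InfPath => {z : E.InfPath | z.1 0 ∈ ({w.1 0} : Set Ed)})
    (fun w _ => (E.isOpen_coord 0 _).mem_nhds rfl)
  classical
  refine ⟨t.image fun w => w.1 0, fun z hz => ?_⟩
  obtain ⟨w, hw, hzw⟩ := Set.mem_iUnion₂.1 (ht (subset_tsupport _ hz))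
  exact Finset.mem_image.2 ⟨w, hw, (show z.1 0 = w.1 0 from hzw).symm⟩

variable [E.RowFinite]

theorem toC₀_chi (μ : E.FinPath) : (E.chi μ).toC₀ = E.chi₀ μ := rfl

theorem leftMul_apply (g : C₀(E.InfPath, ℂ)) (x : C_c(E.InfPath, ℂ)) (z : E.InfPath) :
    E.hat.leftMul g x z = g z * x z := rfl

/-- The sum over the fibre of the shift, for a function supported in `Z(e)`. -/
theorem fiberSum_apply_of_support {x : C_c(E.InfPath, ℂ)} {e : Ed}
    (hx : ∀ z, x z ≠ 0 → z.1 0 = e) (z : E.InfPath) [Decidable (E.s e = E.r (z.1 0))] :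
    E.hat.fiberSum x z = if h : E.s e = E.r (z.1 0) then x (E.consInf e z h) else 0 := by
  rw [TopologicalGraph.fiberSum_apply]
  split_ifs with h
  · have : ∑ᶠ w ∈ E.hat.s ⁻¹' {z}, x w = ∑ w ∈ {E.consInf e z h}, x w := by
      refine finsum_mem_eq_sum_of_inter_support_eq _ ?_
      ext w
      simp only [Set.mem_inter_iff, Set.mem_preimage, Set.mem_singleton_iff,
        Function.mem_support, Finset.coe_singleton, and_congr_left_iff]
      intro hw
      refine ⟨fun hs => consInf_shift h (hx w hw) hs, ?_⟩
      rintro rfl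
      rfl
    rw [this, Finset.sum_singleton]
  · refine finsum_mem_eq_zero_of_forall_eq_zero fun w hw => ?_
    by_contra hne
    refine h ?_
    have hs : E.shift w = z := hw
    rw [← hx w hne, ← hs, range_shift]

theorem leftMul_edge_support (g : C₀(E.InfPath, ℂ)) (e : Ed) (z : E.InfPath)
    (hz : E.hat.leftMul g (E.chi (E.edgePath e)) z ≠ 0) : z.1 0 = e := by
  by_contra h
  refine hz ?_
  rw [leftMul_apply, chi_apply, if_neg (mt mem_cylinder_edgePath.1 h), mul_zero]

theorem leftMul_edge_consInf (g : C₀(E.InfPath, ℂ)) (e : Ed) (z : E.InfPath)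
    (h : E.s e = E.r (z.1 0)) :
    E.hat.leftMul g (E.chi (E.edgePath e)) (E.consInf e z h) = g (E.consInf e z h) := by
  rw [leftMul_apply, chi_apply, if_pos (mem_cylinder_edgePath.2 (consInf_zero e z h)), mul_one]

variable (E) in
/-- The pull-back `g ↦ (z ↦ g(ez))`, extended by zero to the infinite paths `z` with
`r(z) ≠ s(e)`. -/
noncomputable def pullbackFun (e : Ed) (g : C₀(E.InfPath, ℂ)) : C₀(E.InfPath, ℂ) :=
  E.hat.fiberSum (E.hat.leftMul g (E.chi (E.edgePath e)))

open Classical in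
-- The fibre of the shift over `z` meets `Z(e)` in at most the point `ez`, so the fibre sum has at
-- most one term. Writing the pull-back as a fibre sum supplies its continuity and its decay at
-- infinity.
theorem pullbackFun_apply (e : Ed) (g : C₀(E.InfPath, ℂ)) (z : E.InfPath) :
    E.pullbackFun e g z = if h : E.s e = E.r (z.1 0) then g (E.consInf e z h) else 0 := by
  rw [pullbackFun, fiberSum_apply_of_support (leftMul_edge_support g e)]
  simp only [leftMul_edge_consInf]

variable (E) in
/-- The pull-back along `z ↦ ez` as a homomorphism. -/
noncomputable def pullback (e : Ed) : C₀(E.InfPath, ℂ) →⋆ₙₐ[ℂ] C₀(E.InfPath, ℂ) where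
  toFun := E.pullbackFun e
  map_smul' c g := by
    ext z; simp only [pullbackFun_apply, ZeroAtInftyContinuousMap.smul_apply]; split_ifs <;> simp
  map_zero' := by
    ext z; simp [pullbackFun_apply]
  map_add' f g := by
    ext z; simp only [pullbackFun_apply, ZeroAtInftyContinuousMap.add_apply]; split_ifs <;> simp
  map_mul' f g := by
    ext z; simp only [pullbackFun_apply, ZeroAtInftyContinuousMap.mul_apply]; split_ifs <;> simp
  map_star' g := by
    ext z; simp only [pullbackFun_apply, ZeroAtInftyContinuousMap.star_apply]; split_ifs <;> simp

open Classical in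
theorem pullback_apply (e : Ed) (g : C₀(E.InfPath, ℂ)) (z : E.InfPath) :
    E.pullback e g z = if h : E.s e = E.r (z.1 0) then g (E.consInf e z h) else 0 :=
  pullbackFun_apply e g z

theorem pullback_eq_fiberSum (e : Ed) (g : C₀(E.InfPath, ℂ)) :
    E.pullback e g = E.hat.fiberSum (E.hat.leftMul g (E.chi (E.edgePath e))) := rfl

theorem pullback_consPath (e : Ed) (μ : E.FinPath) (h : E.s e = μ.start) :
    E.pullback e (E.chi₀ (E.consPath e μ h)) = E.chi₀ μ := by
  ext z
  rw [pullback_apply, chi₀_apply]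
  by_cases hz : z ∈ E.cylinder μ
  · have h' : E.s e = E.r (z.1 0) := by rw [hz.1, h]
    rw [dif_pos h', chi₀_apply, if_pos hz, if_pos (consInf_mem_consPath.2 hz)]
  · rw [if_neg hz]
    split_ifs with h'
    · rw [chi₀_apply, if_neg fun h'' => hz (mem_cylinder_consPath.1 h'').2]
    · rfl

theorem pullback_consPath_of_ne {e a : Ed} (hea : e ≠ a) (μ : E.FinPath) (h : E.s a = μ.start) :
    E.pullback e (E.chi₀ (E.consPath a μ h)) = 0 := by
  ext z
  rw [pullback_apply]
  split_ifs with h'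
  · rw [chi₀_apply, if_neg fun h'' => hea (mem_cylinder_consPath.1 h'').1]; rfl
  · rfl

theorem pullback_vertexPath (e : Ed) :
    E.pullback e (E.chi₀ (E.vertexPath (E.r e))) = E.chi₀ (E.vertexPath (E.s e)) := by
  ext z
  rw [pullback_apply, chi₀_apply]
  by_cases hz : E.s e = E.r (z.1 0)
  · rw [dif_pos hz, chi₀_apply,
      if_pos (mem_cylinder_vertexPath.2 (congrArg E.r (consInf_zero e z hz))),
      if_pos (mem_cylinder_vertexPath.2 hz.symm)]
  · rw [dif_neg hz, if_neg fun h => hz (mem_cylinder_vertexPath.1 h).symm]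

theorem pullback_vertexPath_of_ne {e : Ed} {v : V} (h : E.r e ≠ v) :
    E.pullback e (E.chi₀ (E.vertexPath v)) = 0 := by
  ext z
  rw [pullback_apply]
  split_ifs with h'
  · rw [chi₀_apply, if_neg fun h'' => h (mem_cylinder_vertexPath.1 h'')]; rfl
  · rfl

theorem chi₀_vertexPath_mul_pullback (e : Ed) (g : C₀(E.InfPath, ℂ)) :
    E.chi₀ (E.vertexPath (E.s e)) * E.pullback e g = E.pullback e g := by
  ext z
  rw [ZeroAtInftyContinuousMap.mul_apply, pullback_apply, chi₀_apply]
  split_ifs with h1 h2 h2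
  · rw [one_mul]
  · rw [mul_zero]
  · exact absurd (mem_cylinder_vertexPath.2 h2.symm) h1
  · rw [mul_zero]

/-- Each path lies in exactly one `Z(e)`. The decomposition reduces the study of `ψ` to functions
supported in a single `s`-section. -/
theorem eq_sum_leftMul {x : C_c(E.InfPath, ℂ)} {F : Finset Ed} (hF : ∀ z, x z ≠ 0 → z.1 0 ∈ F) :
    x = ∑ e ∈ F, E.hat.leftMul x.toC₀ (E.chi (E.edgePath e)) := by
  classical
  refine CompactlySupportedContinuousMap.ext fun z => ?_
  rw [CompactlySupportedContinuousMap.sum_apply]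
  simp only [leftMul_apply, chi_apply, mem_cylinder_edgePath,
    CompactlySupportedContinuousMap.toC₀_apply, mul_ite, mul_one, mul_zero, Finset.sum_ite_eq]
  split_ifs with h
  · rfl
  · by_contra hne
    exact h (hF z hne)

/-- The fibre of the shift over `z` consists of the paths `ez` with `s(e) = r(z)`. Only the first
edges that occur in `x` matter, because the integrand vanishes where `x` does. -/
theorem ip_eq_sum_pullback (x y : C_c(E.InfPath, ℂ)) {F : Finset Ed}
    (hF : ∀ z, x z ≠ 0 → z.1 0 ∈ F) :
    E.hat.ip x y = ∑ e ∈ F, E.pullback e (star x.toC₀ * y.toC₀) := by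
  have hF' : ∀ z, (star x * y) z ≠ 0 → z.1 0 ∈ F := by
    intro z hz
    refine hF z fun h => hz ?_
    rw [CompactlySupportedContinuousMap.mul_apply, CompactlySupportedContinuousMap.star_apply, h,
      star_zero, zero_mul]
  rw [TopologicalGraph.ip, eq_sum_leftMul hF', map_sum]
  rfl

theorem finite_range_eq (v : V) : (E.r ⁻¹' {v}).Finite := RowFinite.finite_preimage v

end DirectedGraph

/-! ### Toeplitz representations of `Ê` -/

/-- Expanding `(a - b)* (a - b)` gives zero. This turns equalities of inner products into equalities
in `B`. -/
theorem eq_of_star_mul_eq {B : Type*} [NonUnitalCStarAlgebra B] {a b : B}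
    (h1 : star a * b = star a * a) (h2 : star b * a = star a * a) (h3 : star b * b = star a * a) :
    a = b := by
  rw [← sub_eq_zero, ← CStarRing.star_mul_self_eq_zero_iff, star_sub, sub_mul, mul_sub, mul_sub,
    h1, h2, h3]
  simp

namespace DirectedGraph

variable {V Ed : Type*} {E : DirectedGraph V Ed}

theorem isOpen_edge (e : Ed) : IsOpen {z : E.InfPath | z.1 0 = e} := E.isOpen_coord 0 {e}

theorem tsupport_subset_edge {x : C_c(E.InfPath, ℂ)} {e : Ed} (hx : ∀ z, x z ≠ 0 → z.1 0 = e) :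
    tsupport x ⊆ {z : E.InfPath | z.1 0 = e} :=
  closure_minimal hx (E.isClopen_coord 0 {e}).1

variable [E.RowFinite] {B : Type*} [NonUnitalCStarAlgebra B]

/-- The restricted shift is continuous and open, and it is injective because the missing first edge
is `e`. -/
theorem isSSection_edge (e : Ed) : E.hat.IsSSection {z : E.InfPath | z.1 0 = e} := by
  refine (Topology.IsOpenEmbedding.of_continuous_injective_isOpenMap
    (E.isLocalHomeomorph_shift.continuous.comp continuous_subtype_val) ?_
    (E.isLocalHomeomorph_shift.isOpenMap.comp (isOpen_edge e).isOpenMap_subtype_val)).isEmbedding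
  rintro ⟨z, hz⟩ ⟨w, hw⟩ h
  have hz' : z.1 0 = e := hz
  have h' : E.shift z = E.shift w := h
  have hs : E.s e = E.r ((E.shift w).1 0) := by rw [← h', range_shift, hz']
  exact Subtype.ext ((consInf_shift hs hz h').trans (consInf_shift hs hw rfl).symm)

theorem chi_edge_support (e : Ed) (z : E.InfPath) (hz : E.chi (E.edgePath e) z ≠ 0) :
    z.1 0 = e := by
  by_contra h
  exact hz (by rw [chi_apply, if_neg (mt mem_cylinder_edgePath.1 h)])

open Classical in
-- In the double sum for `ψ(x)* ψ(y)` only the diagonal terms survive, and they add up to the inner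
-- product by `ip_eq_sum_pullback`. The hypotheses are available both for a given representation of
-- `Ê` and for the one built from a Cuntz-Krieger family.
theorem star_mul_eq_map_ip {ψ : C_c(E.InfPath, ℂ) → B} {π : C₀(E.InfPath, ℂ) →⋆ₙₐ[ℂ] B}
    {t : Ed → B}
    (ht : ∀ e f g, star (t e) * (π g * t f) = if e = f then π (E.pullback e g) else 0)
    (hψ : ∀ x (F : Finset Ed), (∀ z, x z ≠ 0 → z.1 0 ∈ F) → ψ x = ∑ e ∈ F, π x.toC₀ * t e)
    (x y : C_c(E.InfPath, ℂ)) : star (ψ x) * ψ y = π (E.hat.ip x y) := by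
  obtain ⟨F, hF⟩ := exists_finset_edges x
  obtain ⟨G, hG⟩ := exists_finset_edges y
  have hF' : ∀ z, x z ≠ 0 → z.1 0 ∈ F ∪ G := fun z hz => Finset.mem_union_left _ (hF z hz)
  have hG' : ∀ z, y z ≠ 0 → z.1 0 ∈ F ∪ G := fun z hz => Finset.mem_union_right _ (hG z hz)
  rw [hψ x _ hF', hψ y _ hG', ip_eq_sum_pullback x y hF', star_sum, Finset.sum_mul, map_sum]
  refine Finset.sum_congr rfl fun e he => ?_
  rw [Finset.mul_sum]
  have : ∀ f ∈ F ∪ G, star (π x.toC₀ * t e) * (π y.toC₀ * t f) =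
      if e = f then π (E.pullback e (star x.toC₀ * y.toC₀)) else 0 := by
    intro f _
    rw [← ht, star_mul, ← map_star, map_mul]
    simp only [mul_assoc]
  rw [Finset.sum_congr rfl this, Finset.sum_ite_eq, if_pos he]

section Toeplitz

variable {ψ : C_c(E.InfPath, ℂ) →ₗ[ℂ] B} {π : C₀(E.InfPath, ℂ) →⋆ₙₐ[ℂ] B}

/-- The axioms give only `ψ(x)* ψ(x)` on an `s`-section. Since `x + c • y` is supported in the same
section, polarization with `c = 1` and `c = i` recovers the mixed term. -/
theorem IsToeplitz.star_mul_of_edge (h : E.hat.IsToeplitz ψ π) {e : Ed} {x y : C_c(E.InfPath, ℂ)}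
    (hx : ∀ z, x z ≠ 0 → z.1 0 = e) (hy : ∀ z, y z ≠ 0 → z.1 0 = e) :
    star (ψ x) * ψ y = π (E.hat.ip x y) := by
  have key : ∀ x : C_c(E.InfPath, ℂ), (∀ z, x z ≠ 0 → z.1 0 = e) →
      star (ψ x) * ψ x = π (E.hat.ip x x) := by
    intro x hx
    refine (h.map_hat x _ (isOpen_edge e) (isSSection_edge e) (tsupport_subset_edge hx) _ ?_).symm
    exact (E.hat.isHat_iff (isSSection_edge e) hx _).2 rfl
  have hxy : ∀ c : ℂ, ∀ z, (x + c • y) z ≠ 0 → z.1 0 = e := by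
    intro c z hz
    by_contra hne
    refine hz ?_
    have h1 : x z = 0 := by by_contra h; exact hne (hx z h)
    have h2 : y z = 0 := by by_contra h; exact hne (hy z h)
    rw [CompactlySupportedContinuousMap.add_apply, CompactlySupportedContinuousMap.smul_apply,
      h1, h2, smul_zero, add_zero]
  have h1 := key _ (hxy 1)
  have h2 := key _ (hxy Complex.I)
  simp only [map_add, map_smul, star_add, star_smul, add_mul, mul_add, TopologicalGraph.ip_add_left,
    TopologicalGraph.ip_add_right, TopologicalGraph.ip_smul_left, TopologicalGraph.ip_smul_right,
    key x hx, key y hy, smul_mul_assoc, mul_smul_comm, one_smul] at h1 h2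
  generalize π (E.hat.ip x x) = a at *
  generalize π (E.hat.ip y y) = b at *
  generalize π (E.hat.ip x y) = c at *
  generalize π (E.hat.ip y x) = d at *
  generalize star (ψ x) * ψ y = c' at *
  generalize star (ψ y) * ψ x = d' at *
  have h3 : c' + d' = c + d := by
    have := congrArg (fun u => u - a - b) h1
    calc c' + d' = a + d' + (c' + b) - a - b := by abel
      _ = _ := this
      _ = c + d := by abel
  -- The choice `c = i` gives the difference of the two mixed terms, because the first variable is
  -- conjugated; together with their sum this determines each of them.
  have h4 : Complex.I • (c' - d') = Complex.I • (c - d) := by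
    have := congrArg (fun u => u - a - Complex.I • star Complex.I • b) h2
    simp only [Complex.star_def, Complex.conj_I, smul_sub, neg_smul, smul_add, smul_neg] at this ⊢
    calc Complex.I • c' - Complex.I • d' = _ := ?_
      _ = _ := this
      _ = _ := ?_
    · abel
    · abel
  have h5 : c' - d' = c - d := smul_right_injective B Complex.I_ne_zero h4
  have h6 : (2 : ℂ) • c' = (2 : ℂ) • c := by
    rw [two_smul, two_smul]
    calc c' + c' = (c' + d') + (c' - d') := by abel
      _ = (c + d) + (c - d) := by rw [h3, h5]
      _ = c + c := by abel
  exact smul_right_injective B two_ne_zero h6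

theorem ip_chi_leftMul (e : Ed) (g : C₀(E.InfPath, ℂ)) :
    E.hat.ip (E.chi (E.edgePath e)) (E.hat.leftMul g (E.chi (E.edgePath e))) = E.pullback e g := by
  rw [pullback_eq_fiberSum, TopologicalGraph.ip]
  congr 1
  refine CompactlySupportedContinuousMap.ext fun z => ?_
  rw [CompactlySupportedContinuousMap.mul_apply, CompactlySupportedContinuousMap.star_apply,
    leftMul_apply, chi_apply]
  split_ifs <;> simp

open Classical in
-- For `e = f` both functions live on `Z(e)` and polarization applies; for `e ≠ f` they live on
-- disjoint `s`-sections and the orthogonality axiom applies.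
theorem IsToeplitz.star_edge_mul (h : E.hat.IsToeplitz ψ π) (e f : Ed) (g : C₀(E.InfPath, ℂ)) :
    star (ψ (E.chi (E.edgePath e))) * (π g * ψ (E.chi (E.edgePath f))) =
      if e = f then π (E.pullback e g) else 0 := by
  rw [← h.map_leftMul]
  split_ifs with hef
  · subst hef
    rw [IsToeplitz.star_mul_of_edge h (chi_edge_support e) (leftMul_edge_support g e),
      ip_chi_leftMul]
  · refine h.star_mul_eq_zero _ _ _ _ (isOpen_edge e) (isSSection_edge e) (isOpen_edge f)
      (isSSection_edge f) ?_ (tsupport_subset_edge (chi_edge_support e))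
      (tsupport_subset_edge (leftMul_edge_support g f))
    exact Set.disjoint_left.2 fun z hz hz' => hef (hz.symm.trans hz')

theorem IsToeplitz.map_eq_sum (h : E.hat.IsToeplitz ψ π) (x : C_c(E.InfPath, ℂ)) (F : Finset Ed)
    (hF : ∀ z, x z ≠ 0 → z.1 0 ∈ F) :
    ψ x = ∑ e ∈ F, π x.toC₀ * ψ (E.chi (E.edgePath e)) := by
  conv_lhs => rw [eq_sum_leftMul hF]
  rw [map_sum]
  exact Finset.sum_congr rfl fun e _ => h.map_leftMul _ _

/-- The local axioms on `s`-sections thus yield the global axiom for the correspondence `X(Ê)`. -/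
theorem IsToeplitz.star_mul (h : E.hat.IsToeplitz ψ π) (x y : C_c(E.InfPath, ℂ)) :
    star (ψ x) * ψ y = π (E.hat.ip x y) :=
  star_mul_eq_map_ip (IsToeplitz.star_edge_mul h) (IsToeplitz.map_eq_sum h) x y

/-- Compatibility with the right action is not an axiom; it follows because both sides have the same
inner products with themselves and with each other. -/
theorem IsToeplitz.map_rightMul (h : E.hat.IsToeplitz ψ π) (x : C_c(E.InfPath, ℂ))
    (g : C₀(E.InfPath, ℂ)) : ψ (E.hat.rightMul x g) = ψ x * π g := by
  have h1 : ∀ y, E.hat.ip (E.hat.rightMul x g) y = star g * E.hat.ip x y := by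
    intro y
    rw [← E.hat.star_ip, E.hat.ip_rightMul, ← E.hat.star_ip y x]
    ext z
    simp [mul_comm]
  refine eq_of_star_mul_eq ?_ ?_ ?_
  · rw [← mul_assoc, IsToeplitz.star_mul h, IsToeplitz.star_mul h, E.hat.ip_rightMul, map_mul]
  · rw [StarMul.star_mul, mul_assoc, IsToeplitz.star_mul h, IsToeplitz.star_mul h, h1, map_mul,
      map_star]
  · rw [StarMul.star_mul, mul_assoc, ← mul_assoc (star (ψ x)), IsToeplitz.star_mul h,
      IsToeplitz.star_mul h, h1, E.hat.ip_rightMul, map_mul, map_mul, map_star]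

theorem rightMul_edge (e : Ed) (g : C₀(E.InfPath, ℂ)) :
    E.hat.rightMul (E.chi (E.edgePath e)) (E.pullback e g) =
      E.hat.leftMul g (E.chi (E.edgePath e)) := by
  refine CompactlySupportedContinuousMap.ext fun z => ?_
  change E.chi (E.edgePath e) z * E.pullback e g (E.shift z) = g z * E.chi (E.edgePath e) z
  rw [chi_apply]
  split_ifs with hz
  · have h0 := mem_cylinder_edgePath.1 hz
    have hs : E.s e = E.r ((E.shift z).1 0) := by rw [range_shift, h0]
    rw [one_mul, mul_one, pullback_apply, dif_pos hs, ← consInf_shift hs h0 rfl]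
  · rw [zero_mul, mul_zero]

/-- On `Z(e)` the function `g` depends only on the shifted path, through its pull-back, so a left
multiplication can be traded for a right one. This is the rule for moving `π` past `t_e`. -/
theorem IsToeplitz.edge_mul_pullback (h : E.hat.IsToeplitz ψ π) (e : Ed) (g : C₀(E.InfPath, ℂ)) :
    ψ (E.chi (E.edgePath e)) * π (E.pullback e g) = π g * ψ (E.chi (E.edgePath e)) := by
  rw [← IsToeplitz.map_rightMul h, rightMul_edge, h.map_leftMul]

theorem leftMul_chi₀_chi {μ ν : E.FinPath} (h : E.cylinder ν ⊆ E.cylinder μ) :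
    E.hat.leftMul (E.chi₀ μ) (E.chi ν) = E.chi ν := by
  refine CompactlySupportedContinuousMap.ext fun z => ?_
  rw [leftMul_apply, chi_apply, chi₀_apply]
  by_cases hz : z ∈ E.cylinder ν
  · rw [if_pos hz, if_pos (h hz), one_mul]
  · rw [if_neg hz, mul_zero]

theorem IsToeplitz.chi₀_mul_edge (h : E.hat.IsToeplitz ψ π) (e : Ed) :
    π (E.chi₀ (E.edgePath e)) * ψ (E.chi (E.edgePath e)) = ψ (E.chi (E.edgePath e)) := by
  rw [← h.map_leftMul, leftMul_chi₀_chi subset_rfl]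

end Toeplitz

end DirectedGraph

namespace DirectedGraph

variable {V Ed : Type*} {E : DirectedGraph V Ed} {B : Type*} [NonUnitalCStarAlgebra B]

theorem cylinder_edgePath_subset (e : Ed) :
    E.cylinder (E.edgePath e) ⊆ E.cylinder (E.vertexPath (E.r e)) := fun z hz => by
  rw [mem_cylinder_vertexPath, mem_cylinder_edgePath.1 hz]

theorem sum_mul_sum_of_orthogonal {ι : Type*} {a : ι → B} (F : Finset ι)
    (h1 : ∀ i, a i * a i = a i) (h2 : ∀ i j, i ≠ j → a i * a j = 0) :
    (∑ i ∈ F, a i) * ∑ i ∈ F, a i = ∑ i ∈ F, a i := by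
  classical
  rw [Finset.sum_mul]
  refine Finset.sum_congr rfl fun i hi => ?_
  rw [Finset.mul_sum, Finset.sum_eq_single_of_mem i hi fun j _ hj => h2 i j hj.symm, h1]

/-! ### The elements `t_μ` -/

section Elem

variable {q : V → B} {t : Ed → B}

theorem elem_vertexPath (v : V) : (E.vertexPath v).elem q t = q v := rfl

theorem IsCuntzKriegerFamily.edge_mul_vertex (h : E.IsCuntzKriegerFamily q t) (e : Ed) :
    t e * q (E.s e) = t e := by
  rw [← h.star_edge_mul_edge, ← mul_assoc, h.partialIsometry]

/-- The product over a nonempty list ends in an edge, not in a vertex projection. For `μ` of length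
`0` the extra factor `q_{s(e)}` is absorbed by `t_e`. -/
theorem IsCuntzKriegerFamily.elem_consPath (h : E.IsCuntzKriegerFamily q t) (e : Ed)
    (μ : E.FinPath) (hμ : E.s e = μ.start) :
    (E.consPath e μ hμ).elem q t = t e * μ.elem q t := by
  obtain ⟨v, l, hl⟩ := μ
  cases l with
  | nil =>
    obtain rfl : E.s e = v := hμ
    exact (h.edge_mul_vertex e).symm
  | cons f l => rfl

theorem map_elem {C : Type*} [NonUnitalCStarAlgebra C] (φ : B →⋆ₙₐ[ℂ] C) (μ : E.FinPath) :
    φ (μ.elem q t) = μ.elem (fun v => φ (q v)) (fun e => φ (t e)) := by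
  have key : ∀ (l : List Ed) (e : Ed), φ (pathProd t e l) = pathProd (fun e => φ (t e)) e l := by
    intro l
    induction l with
    | nil => exact fun e => rfl
    | cons f l ih => exact fun e => by rw [pathProd, pathProd, map_mul, ih]
  obtain ⟨v, l, hl⟩ := μ
  cases l with
  | nil => rfl
  | cons f l => exact key l f

end Elem

/-! ### The Cuntz-Krieger family of a covariant representation -/

variable [E.RowFinite]

/-- The relations of a Cuntz-Krieger family in terms of equations. -/
theorem isCuntzKriegerFamily_of_eq {q : V → B} {t : Ed → B} (h1 : ∀ v, star (q v) = q v)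
    (h2 : ∀ v, q v * q v = q v) (h3 : ∀ v w, v ≠ w → q v * q w = 0)
    (h4 : ∀ e, t e * star (t e) * t e = t e) (h5 : ∀ e, star (t e) * t e = q (E.s e))
    (h6 : ∀ e f, e ≠ f → star (t e) * t f = 0)
    (h7 : ∀ v, q v = ∑ e ∈ (finite_range_eq (E := E) v).toFinset, t e * star (t e)) :
    E.IsCuntzKriegerFamily q t where
  star_vertex := h1
  vertex_mul_self := h2
  vertex_mul_vertex := h3
  partialIsometry := h4
  star_edge_mul_edge := h5
  relation_le v F hF := by
    classical
    have hsub : F ⊆ (finite_range_eq (E := E) v).toFinset := fun e he => by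
      simpa using hF e he
    -- The difference is the sum of the remaining range projections, which is itself a projection
    -- and can serve as its own root.
    refine ⟨∑ e ∈ (finite_range_eq (E := E) v).toFinset \ F, t e * star (t e), ?_⟩
    rw [star_sum]
    simp only [star_mul, star_star]
    rw [sum_mul_sum_of_orthogonal, h7, sub_eq_iff_eq_add, Finset.sum_sdiff hsub]
    · intro e
      rw [← mul_assoc, h4]
    · intro e f hef
      rw [mul_assoc, ← mul_assoc (star (t e)), h6 e f hef, zero_mul, mul_zero]
  relation_sum v _ _ := h7 v

/-- The range map is the identity: it is surjective, and compact neighbourhoods are their own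
preimages. Covariance therefore concerns all of `C₀(E^∞)`. -/
theorem rg_hat : E.hat.rg = Set.univ := by
  have h1 : E.hat.sce = ∅ := by
    have : Set.range E.hat.r = Set.univ := Set.range_id
    rw [TopologicalGraph.sce, this, closure_univ, Set.compl_univ]
  have h2 : E.hat.fin = Set.univ := by
    refine Set.eq_univ_of_forall fun z => ?_
    obtain ⟨K, hK, hz⟩ := exists_compact_mem_nhds z
    exact ⟨K, hz, hK⟩
  rw [TopologicalGraph.rg, h1, h2, closure_empty, Set.sdiff_empty]

section Toeplitz

variable {ψ : C_c(E.InfPath, ℂ) →ₗ[ℂ] B} {π : C₀(E.InfPath, ℂ) →⋆ₙₐ[ℂ] B}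

theorem IsToeplitz.star_edge_mul_map (h : E.hat.IsToeplitz ψ π) (e : Ed) (x : C_c(E.InfPath, ℂ)) :
    star (ψ (E.chi (E.edgePath e))) * ψ x = π (E.pullback e x.toC₀) := by
  classical
  obtain ⟨F, hF⟩ := exists_finset_edges x
  rw [IsToeplitz.map_eq_sum h x (insert e F) fun z hz => Finset.mem_insert_of_mem (hF z hz),
    Finset.mul_sum]
  simp only [IsToeplitz.star_edge_mul h]
  rw [Finset.sum_ite_eq, if_pos (Finset.mem_insert_self _ _)]

theorem chi₀_vertexPath_mul_edge_of_ne {e : Ed} {v : V} (hev : E.r e ≠ v) :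
    E.hat.leftMul (E.chi₀ (E.vertexPath v)) (E.chi (E.edgePath e)) = 0 := by
  refine CompactlySupportedContinuousMap.ext fun z => ?_
  rw [leftMul_apply, chi_apply, chi₀_apply]
  split_ifs with h1 h2 h2
  · rw [mem_cylinder_vertexPath] at h1
    rw [mem_cylinder_edgePath] at h2
    exact absurd (by rw [← h2, h1]) hev
  all_goals simp

open Classical in
theorem IsToeplitz.vertex_mul_edge (h : E.hat.IsToeplitz ψ π) (v : V) (e : Ed) :
    π (E.chi₀ (E.vertexPath v)) * ψ (E.chi (E.edgePath e)) =
      if E.r e = v then ψ (E.chi (E.edgePath e)) else 0 := by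
  rw [← h.map_leftMul]
  split_ifs with hev
  · subst hev
    rw [leftMul_chi₀_chi (cylinder_edgePath_subset e)]
  · rw [chi₀_vertexPath_mul_edge_of_ne hev, map_zero]

/-- The projection `∑_{r(e) = v} t_e t_e*` acts as `q_v` on the range of `ψ`. -/
theorem IsToeplitz.sum_mul_map (h : E.hat.IsToeplitz ψ π) (v : V) (x : C_c(E.InfPath, ℂ)) :
    (∑ e ∈ (finite_range_eq (E := E) v).toFinset,
      ψ (E.chi (E.edgePath e)) * star (ψ (E.chi (E.edgePath e)))) * ψ x =
      π (E.chi₀ (E.vertexPath v)) * ψ x := by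
  classical
  obtain ⟨F, hF⟩ := exists_finset_edges x
  rw [Finset.sum_mul]
  -- Here `t_e t_e* ψ(x) = t_e π(pullback e x) = π(x) t_e`, the component of `ψ(x)` at the edge `e`.
  -- Multiplication by `q_v` keeps exactly the components with `r(e) = v`.
  simp only [mul_assoc, IsToeplitz.star_edge_mul_map h, IsToeplitz.edge_mul_pullback h]
  rw [IsToeplitz.map_eq_sum h x (F ∪ (finite_range_eq (E := E) v).toFinset)
    fun z hz => Finset.mem_union_left _ (hF z hz), Finset.mul_sum]
  have : ∀ f, π (E.chi₀ (E.vertexPath v)) * (π x.toC₀ * ψ (E.chi (E.edgePath f))) =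
      if E.r f = v then π x.toC₀ * ψ (E.chi (E.edgePath f)) else 0 := by
    intro f
    rw [← mul_assoc, ← map_mul, mul_comm, map_mul, mul_assoc, IsToeplitz.vertex_mul_edge h,
      mul_ite, mul_zero]
  simp only [this]
  rw [← Finset.sum_filter]
  refine Finset.sum_congr ?_ fun _ _ => rfl
  ext f
  simp +contextual

/-- A self-adjoint element which annihilates the range of `ψ` annihilates the range of `π`. -/
theorem IsCovariant.map_mul_eq_zero (h : E.hat.IsCovariant ψ π) {R : B} (hR : star R = R)
    (hψ : ∀ x, star (ψ x) * R = 0) (g : C₀(E.InfPath, ℂ)) : π g * R = 0 := by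
  obtain ⟨𝒢, -, h2, h3⟩ := h.covariant
  have hg : g ∈ ((NonUnitalStarAlgebra.adjoin ℂ 𝒢).topologicalClosure : Set C₀(E.InfPath, ℂ)) := by
    rw [h2, rg_hat]
    exact fun v hv => absurd (Set.mem_univ v) hv
  -- On a generator `π f` is a sum of terms `ψ(a) ψ(a)*`, hence it kills `R`. Annihilation is
  -- carried on both sides because the adjoint interchanges them.
  have hmem : ∀ f ∈ NonUnitalStarAlgebra.adjoin ℂ 𝒢, π f * R = 0 ∧ R * π f = 0 := by
    intro f hf
    induction hf using NonUnitalStarAlgebra.adjoin_induction with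
    | mem f hf =>
      obtain ⟨𝒩, a, -, -, -, -, ha⟩ := h3 f hf
      have h0 : π f * R = 0 := by
        rw [ha, Finset.sum_mul]
        refine Finset.sum_eq_zero fun N _ => ?_
        rw [mul_assoc, hψ, mul_zero]
      have h0' : star (π f) = π f := by
        rw [ha, star_sum]
        simp only [star_mul, star_star]
      refine ⟨h0, ?_⟩
      have := congrArg star h0
      rwa [star_mul, hR, h0', star_zero] at this
    | add x y _ _ hx hy => rw [map_add, add_mul, mul_add, hx.1, hx.2, hy.1, hy.2]; simp
    | zero => simp
    | mul x y _ _ hx hy => rw [map_mul, mul_assoc, hy.1, ← mul_assoc, hx.2]; simp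
    | smul c x _ hx => rw [map_smul, smul_mul_assoc, mul_smul_comm, hx.1, hx.2]; simp
    | star x _ hx =>
      have h1 := congrArg star hx.1
      have h2 := congrArg star hx.2
      rw [star_mul, hR, star_zero] at h1 h2
      rw [map_star]
      exact ⟨h2, h1⟩
  have hcl : IsClosed {g | π g * R = 0} :=
    isClosed_eq ((continuous_starAlgHom π).mul continuous_const) continuous_const
  exact closure_minimal (fun f hf => (hmem f hf).1) hcl hg

/-- This is where covariance enters. The difference `R = q_v - ∑ t_e t_e*` is self-adjoint with `R
ψ(x) = 0`, so `π(g) R = 0` for all `g`. For `g = χ_{Z(v)}` this says `q_v = q_v ∑ t_e t_e*`, and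
`q_v` fixes each summand. -/
theorem IsCovariant.vertex_eq_sum (h : E.hat.IsCovariant ψ π) (v : V) :
    π (E.chi₀ (E.vertexPath v)) = ∑ e ∈ (finite_range_eq (E := E) v).toFinset,
      ψ (E.chi (E.edgePath e)) * star (ψ (E.chi (E.edgePath e))) := by
  have hT := h.toIsToeplitz
  have hself : ∀ v, star (π (E.chi₀ (E.vertexPath v))) = π (E.chi₀ (E.vertexPath v)) := fun v => by
    rw [← map_star, star_chi₀]
  set Q := ∑ e ∈ (finite_range_eq (E := E) v).toFinset,
      ψ (E.chi (E.edgePath e)) * star (ψ (E.chi (E.edgePath e))) with hQ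
  have hQs : star Q = Q := by rw [hQ, star_sum]; simp only [star_mul, star_star]
  have hR : star (π (E.chi₀ (E.vertexPath v)) - Q) = π (E.chi₀ (E.vertexPath v)) - Q := by
    rw [star_sub, hself, hQs]
  have h1 := IsCovariant.map_mul_eq_zero h hR (fun x => by
    rw [← star_star (_ - Q), ← star_mul, hR, sub_mul, hQ, IsToeplitz.sum_mul_map hT, sub_self,
      star_zero]) (E.chi₀ (E.vertexPath v))
  rw [mul_sub, ← map_mul, chi₀_mul_self, hQ, Finset.mul_sum, sub_eq_zero] at h1
  rw [h1]
  refine Finset.sum_congr rfl fun e he => ?_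
  classical
  rw [← mul_assoc, IsToeplitz.vertex_mul_edge hT, if_pos (by simpa using he)]

theorem chi₀_vertexPath_mul_of_ne {v w : V} (hvw : v ≠ w) :
    E.chi₀ (E.vertexPath v) * E.chi₀ (E.vertexPath w) = 0 := by
  ext z
  rw [ZeroAtInftyContinuousMap.mul_apply, chi₀_apply, chi₀_apply]
  split_ifs with h1 h2 h2
  · rw [mem_cylinder_vertexPath] at h1 h2
    exact absurd (h1.symm.trans h2) hvw
  all_goals simp

/-- A covariant representation of `Ê` yields a Cuntz-Krieger family. -/
theorem IsCovariant.isCuntzKriegerFamily (h : E.hat.IsCovariant ψ π) :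
    E.IsCuntzKriegerFamily (fun v => π (E.chi₀ (E.vertexPath v)))
        (fun e => ψ (E.chi (E.edgePath e))) := by
  classical
  have hT := h.toIsToeplitz
  have h5 : ∀ e, star (ψ (E.chi (E.edgePath e))) * ψ (E.chi (E.edgePath e)) =
      π (E.chi₀ (E.vertexPath (E.s e))) := fun e => by
    rw [IsToeplitz.star_edge_mul_map hT, toC₀_chi]
    exact congrArg π (pullback_consPath e _ rfl)
  refine isCuntzKriegerFamily_of_eq (fun v => ?_) (fun v => ?_) (fun v w hvw => ?_) (fun e => ?_)
    h5 (fun e f hef => ?_) (IsCovariant.vertex_eq_sum h)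
  · rw [← map_star, star_chi₀]
  · rw [← map_mul, chi₀_mul_self]
  · rw [← map_mul, chi₀_vertexPath_mul_of_ne hvw, map_zero]
  -- Since `χ_{Z(s(e))}` is the pull-back of `χ_{Z(r(e))}`, the product `t_e q_{s(e)}` equals
  -- `q_{r(e)} t_e = t_e`.
  · rw [mul_assoc, h5, ← pullback_vertexPath, IsToeplitz.edge_mul_pullback hT,
      IsToeplitz.vertex_mul_edge hT, if_pos rfl]
  · have := IsToeplitz.star_edge_mul hT e f (E.chi₀ (E.edgePath f))
    rwa [if_neg hef, IsToeplitz.chi₀_mul_edge hT] at this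

end Toeplitz

/-! ### Values of a covariant representation on cylinder functions. -/

theorem chi₀_mul_of_subset {μ ν : E.FinPath} (h : E.cylinder μ ⊆ E.cylinder ν) :
    E.chi₀ μ * E.chi₀ ν = E.chi₀ μ := by
  ext z
  rw [ZeroAtInftyContinuousMap.mul_apply, chi₀_apply, chi₀_apply]
  split_ifs with h1 h2 h2
  · rw [mul_one]
  · exact absurd (h h1) h2
  all_goals rw [zero_mul]

theorem leftMul_chi₀_chi_eq_left {μ ν : E.FinPath} (h : E.cylinder μ ⊆ E.cylinder ν) :
    E.hat.leftMul (E.chi₀ μ) (E.chi ν) = E.chi μ := by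
  refine CompactlySupportedContinuousMap.ext fun z => ?_
  rw [leftMul_apply, chi_apply, chi₀_apply, chi_apply]
  split_ifs with h1 h2 h2
  · rw [mul_one]
  · exact absurd (h h1) h2
  all_goals rw [zero_mul]

/-- The range projection of `ψ(χ_{Z(e)})`. -/
theorem IsCovariant.map_edge {ψ : C_c(E.InfPath, ℂ) →ₗ[ℂ] B} {π : C₀(E.InfPath, ℂ) →⋆ₙₐ[ℂ] B}
    (h : E.hat.IsCovariant ψ π) (e : Ed) : π (E.chi₀ (E.edgePath e)) =
      ψ (E.chi (E.edgePath e)) * star (ψ (E.chi (E.edgePath e))) := by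
  have hT := h.toIsToeplitz
  classical
  have h2 : E.chi₀ (E.edgePath e) = E.chi₀ (E.edgePath e) * E.chi₀ (E.vertexPath (E.r e)) := by
    ext z
    rw [ZeroAtInftyContinuousMap.mul_apply, chi₀_apply, chi₀_apply]
    split_ifs with h3 h4 h4
    · simp
    · exact absurd (cylinder_edgePath_subset e h3) h4
    all_goals simp
  have h3 : ∀ f, π (E.chi₀ (E.edgePath e)) * ψ (E.chi (E.edgePath f)) =
      if e = f then ψ (E.chi (E.edgePath f)) else 0 := by
    intro f
    split_ifs with hef
    · rw [hef, IsToeplitz.chi₀_mul_edge hT]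
    · rw [← hT.map_leftMul]
      convert map_zero ψ using 2
      refine CompactlySupportedContinuousMap.ext fun z => ?_
      by_contra hne
      have h4 := leftMul_edge_support _ f z hne
      refine hne ?_
      rw [leftMul_apply, chi₀_apply, if_neg, zero_mul]; rfl
      rw [mem_cylinder_edgePath, h4]
      exact Ne.symm hef
  -- Multiplying `q_{r(e)} = ∑ t_f t_f*` by `π(χ_{Z(e)})` leaves only the term `f = e`.
  rw [h2, map_mul, IsCovariant.vertex_eq_sum h, Finset.mul_sum]
  simp only [← mul_assoc, h3, ite_mul, zero_mul]
  rw [Finset.sum_ite_eq, if_pos (by simp)]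

/-- The values of a covariant representation on the characteristic functions. -/
theorem IsCovariant.map_chi₀ {ψ : C_c(E.InfPath, ℂ) →ₗ[ℂ] B} {π : C₀(E.InfPath, ℂ) →⋆ₙₐ[ℂ] B}
    (h : E.hat.IsCovariant ψ π) (μ : E.FinPath) :
    π (E.chi₀ μ) =
      μ.elem (fun v => π (E.chi₀ (E.vertexPath v))) (fun e => ψ (E.chi (E.edgePath e))) *
      star (μ.elem (fun v => π (E.chi₀ (E.vertexPath v))) (fun e => ψ (E.chi (E.edgePath e)))) := by
  have hT := h.toIsToeplitz
  have hCK := IsCovariant.isCuntzKriegerFamily h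
  induction μ using FinPath.induction with
  | vertex v => rw [elem_vertexPath, hCK.star_vertex, hCK.vertex_mul_self]
  | cons e μ hμ ih =>
    have hsub : E.cylinder (E.consPath e μ hμ) ⊆ E.cylinder (E.edgePath e) := fun z hz =>
      mem_cylinder_edgePath.2 (mem_cylinder_consPath.1 hz).1
    -- With `π(χ_{Z(e)}) = t_e t_e*` the left side becomes `π(χ_{Z(eμ)}) t_e t_e* = t_e π(χ_{Z(μ)})
    -- t_e*`.
    rw [← chi₀_mul_of_subset hsub, map_mul, IsCovariant.map_edge h, ← mul_assoc,
      ← IsToeplitz.edge_mul_pullback hT, pullback_consPath,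
      hCK.elem_consPath, ih, star_mul]
    simp only [mul_assoc]

/-- Because `Z(eμ) ⊆ Z(e)`, the element `ψ(χ_{Z(eμ)})` is `π(χ_{Z(eμ)}) t_e`, and `t_e t_e* =
π(χ_{Z(e)})`. This is the form of covariance that is compared with `ψ⁽¹⁾` later. -/
theorem IsCovariant.map_chi_mul_star {ψ : C_c(E.InfPath, ℂ) →ₗ[ℂ] B}
    {π : C₀(E.InfPath, ℂ) →⋆ₙₐ[ℂ] B} (h : E.hat.IsCovariant ψ π) (e : Ed) (μ : E.FinPath)
    (hμ : E.s e = μ.start) :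
    ψ (E.chi (E.consPath e μ hμ)) * star (ψ (E.chi (E.consPath e μ hμ))) =
      π (E.chi₀ (E.consPath e μ hμ)) := by
  have hT := h.toIsToeplitz
  have hsub : E.cylinder (E.consPath e μ hμ) ⊆ E.cylinder (E.edgePath e) := fun z hz =>
    mem_cylinder_edgePath.2 (mem_cylinder_consPath.1 hz).1
  have h1 : ψ (E.chi (E.consPath e μ hμ)) =
      π (E.chi₀ (E.consPath e μ hμ)) * ψ (E.chi (E.edgePath e)) := by
    rw [← hT.map_leftMul, leftMul_chi₀_chi_eq_left hsub]
  rw [h1, star_mul, ← mul_assoc, mul_assoc (π _), ← IsCovariant.map_edge h, ← map_mul,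
    chi₀_mul_of_subset hsub, ← map_star, star_chi₀, ← map_mul, chi₀_mul_self]

end DirectedGraph

/-! ### Orthogonality in Cuntz-Krieger families -/

/-- In the spectral order `0 ≤ a* a = -b* b ≤ 0`. This is how the inequality in the Cuntz-Krieger
relations, recorded as `q - ∑ t t* = b* b`, is exploited. -/
theorem eq_zero_of_star_mul_add_eq_zero {B : Type*} [NonUnitalCStarAlgebra B] {a b : B}
    (h : star a * a + star b * b = 0) : a = 0 := by
  let _ := CStarAlgebra.spectralOrder B
  have _ := CStarAlgebra.spectralOrderedRing B
  rw [← CStarRing.star_mul_self_eq_zero_iff]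
  refine le_antisymm ?_ (star_mul_self_nonneg a)
  rw [eq_neg_of_add_eq_zero_left h]
  exact neg_nonpos.2 (star_mul_self_nonneg b)

namespace DirectedGraph

variable {V Ed : Type*} {E : DirectedGraph V Ed} {B : Type*} [NonUnitalCStarAlgebra B]
  {q : V → B} {t : Ed → B}

/-- The range projection `p = t_e t_e*` satisfies `p ≤ Q = q_{r(e)}`, and a projection below `Q` is
fixed by `Q`. -/
theorem IsCuntzKriegerFamily.vertex_mul_edge (h : E.IsCuntzKriegerFamily q t) (e : Ed) :
    q (E.r e) * t e = t e := by
  obtain ⟨c, hc⟩ := h.relation_le (E.r e) {e} (by simp)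
  rw [Finset.sum_singleton] at hc
  obtain ⟨p, hp⟩ : ∃ p, p = t e * star (t e) := ⟨_, rfl⟩
  rw [← hp] at hc
  have hps : star p = p := by rw [hp, star_mul, star_star]
  have hpp : p * p = p := by rw [hp, ← mul_assoc, h.partialIsometry]
  set Q := q (E.r e)
  have hQs : star Q = Q := h.star_vertex _
  have hQQ : Q * Q = Q := h.vertex_mul_self _
  -- This is `(1 - Q) p (1 - Q) + (1 - Q)(Q - p)(1 - Q) = (1 - Q) Q (1 - Q) = 0`, written without a
  -- unit.
  have h1 : star (p - p * Q) * (p - p * Q) + star (c - c * Q) * (c - c * Q) = 0 := by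
    have h2 : star (c - c * Q) * (c - c * Q) =
        (Q - p) - Q * (Q - p) - ((Q - p) - Q * (Q - p)) * Q := by
      rw [hc, star_sub, star_mul, hQs]
      simp only [sub_mul, mul_sub, mul_assoc]
    rw [h2, star_sub, star_mul, hps, hQs]
    simp only [sub_mul, mul_sub, ← mul_assoc, hQQ, hpp]
    simp only [mul_assoc, hpp]
    simp only [← mul_assoc]
    abel
  have h2 := eq_zero_of_star_mul_add_eq_zero h1
  have h3 : p = Q * p := by
    have := congrArg star (sub_eq_zero.1 h2)
    rwa [star_mul, hps, hQs] at this
  calc Q * t e = Q * (p * t e) := by rw [hp, h.partialIsometry]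
    _ = p * t e := by rw [← mul_assoc, ← h3]
    _ = t e := by rw [hp, h.partialIsometry]

/-- Edges with different ranges are separated by orthogonal vertex projections. For a common range
`v`, compressing `q_v - t_e t_e* - t_f t_f* ≥ 0` by `t_f` gives `-t_f* t_e t_e* t_f ≥ 0`. -/
theorem IsCuntzKriegerFamily.star_edge_mul_of_ne (h : E.IsCuntzKriegerFamily q t) {e f : Ed}
    (hef : e ≠ f) : star (t e) * t f = 0 := by
  classical
  by_cases hr : E.r e = E.r f
  · obtain ⟨b, hb⟩ := h.relation_le (E.r e) {e, f} (by simp [hr])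
    rw [Finset.sum_pair hef] at hb
    have hqf := h.vertex_mul_edge f
    rw [← hr] at hqf
    have h0 : star (t e * star (t e) * t f) * (t e * star (t e) * t f) +
        star (b * t f) * (b * t f) = 0 := by
      have h1 : star (b * t f) * (b * t f) = star (t f) * (star b * b) * t f := by
        simp only [star_mul, mul_assoc]
      have h2 : star (t f) * (t f * star (t f)) * t f = star (t f) * t f := by
        rw [mul_assoc, h.partialIsometry]
      rw [h1, ← hb]
      simp only [mul_sub, sub_mul, mul_add, add_mul, star_mul, star_star]
      rw [h2, mul_assoc (star (t f)) (q (E.r e)), hqf]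
      have h3 : star (t f) * (t e * star (t e)) * (t e * star (t e) * t f) =
          star (t f) * (t e * star (t e)) * t f := by
        rw [mul_assoc, ← mul_assoc (t e * star (t e)), ← mul_assoc (t e * star (t e)),
          h.partialIsometry, ← mul_assoc]
      rw [h3]
      abel
    have h1 := eq_zero_of_star_mul_add_eq_zero h0
    have h2 : star (t e) * (t e * star (t e) * t f) = star (t e) * t f := by
      have := congrArg star (h.partialIsometry e)
      rw [star_mul, star_mul, star_star] at this
      rw [← mul_assoc, this]
    rw [← h2, h1, mul_zero]
  · rw [← h.vertex_mul_edge e, ← h.vertex_mul_edge f, star_mul, h.star_vertex, mul_assoc,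
      ← mul_assoc (q _), h.vertex_mul_vertex _ _ hr, zero_mul, mul_zero]

theorem IsCuntzKriegerFamily.vertex_mul_elem (h : E.IsCuntzKriegerFamily q t) (μ : E.FinPath) :
    q μ.start * μ.elem q t = μ.elem q t := by
  induction μ using FinPath.induction with
  | vertex v => exact h.vertex_mul_self v
  | cons e μ hμ _ =>
    rw [h.elem_consPath, ← mul_assoc]
    exact congrArg (· * _) (h.vertex_mul_edge e)

/-- The vertex `v` is the source of `μ`: inner factors collapse by `t_e* t_e = q_{s(e)}`, and that
projection is absorbed by the next edge. -/
theorem IsCuntzKriegerFamily.star_elem_mul_elem (h : E.IsCuntzKriegerFamily q t) (μ : E.FinPath) :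
    ∃ v, star (μ.elem q t) * μ.elem q t = q v ∧ μ.elem q t * q v = μ.elem q t := by
  induction μ using FinPath.induction with
  | vertex v =>
    exact ⟨v, by rw [elem_vertexPath, h.star_vertex, h.vertex_mul_self],
      by rw [elem_vertexPath, h.vertex_mul_self]⟩
  | cons e μ hμ ih =>
    obtain ⟨v, h1, h2⟩ := ih
    refine ⟨v, ?_, ?_⟩
    · rw [h.elem_consPath, star_mul, mul_assoc, ← mul_assoc (star (t e)), h.star_edge_mul_edge, hμ,
        h.vertex_mul_elem, h1]
    · rw [h.elem_consPath, mul_assoc, h2]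

/-! ### The homomorphism `π` of a Cuntz-Krieger family -/

variable [E.RowFinite]

theorem IsCuntzKriegerFamily.vertex_eq_sum [E.NoSources] (h : E.IsCuntzKriegerFamily q t) (v : V) :
    q v = ∑ e ∈ (finite_range_eq (E := E) v).toFinset, t e * star (t e) :=
  h.relation_sum v _ (NoSources.exists_edge v)

variable (E q t) in
/-- Approximations to the homomorphism `π`, restricted to `Z(v)`: on the functions which depend only
on the first `n` edges, `approx n v` is `f ↦ ∑ f(μ) t_μ t_μ*`, where `μ` runs through the paths of
length `n` with range `v`. -/
noncomputable def approx [E.NoSources] : ℕ → V → C₀(E.InfPath, ℂ) → B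
  -- The chosen path in `Z(v)` is an arbitrary sample point. Point evaluation is multiplicative, and
  -- it is exact on functions that are constant on `Z(v)`.
  | 0, v, f => f (exists_infPath (E := E) v).choose • q v
  | n + 1, v, f => ∑ e ∈ (finite_range_eq (E := E) v).toFinset,
      t e * approx n (E.s e) (E.pullback e f) * star (t e)

section Approx

variable [E.NoSources]

theorem approx_add (n : ℕ) (v : V) (f g : C₀(E.InfPath, ℂ)) :
    E.approx q t n v (f + g) = E.approx q t n v f + E.approx q t n v g := by
  induction n generalizing v f g with
  | zero => simp [approx, add_smul]
  | succ n ih => simp only [approx, map_add, ih, mul_add, add_mul, Finset.sum_add_distrib]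

theorem approx_smul (n : ℕ) (v : V) (c : ℂ) (f : C₀(E.InfPath, ℂ)) :
    E.approx q t n v (c • f) = c • E.approx q t n v f := by
  induction n generalizing v f with
  | zero => simp [approx, mul_smul]
  | succ n ih =>
    simp only [approx, map_smul, ih, mul_smul_comm, smul_mul_assoc, Finset.smul_sum]

theorem approx_zero (n : ℕ) (v : V) : E.approx q t n v (0 : C₀(E.InfPath, ℂ)) = 0 := by
  have := approx_smul (q := q) (t := t) n v 0 (0 : C₀(E.InfPath, ℂ))
  rwa [zero_smul, zero_smul] at this

theorem IsCuntzKriegerFamily.approx_star (h : E.IsCuntzKriegerFamily q t) (n : ℕ) (v : V)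
    (f : C₀(E.InfPath, ℂ)) : E.approx q t n v (star f) = star (E.approx q t n v f) := by
  induction n generalizing v f with
  | zero => simp [approx, h.star_vertex]
  | succ n ih => simp only [approx, map_star, ih, star_sum, star_mul, star_star, mul_assoc]

theorem IsCuntzKriegerFamily.vertex_mul_approx (h : E.IsCuntzKriegerFamily q t) (n : ℕ) (v : V)
    (f : C₀(E.InfPath, ℂ)) : q v * E.approx q t n v f = E.approx q t n v f := by
  cases n with
  | zero => simp only [approx, mul_smul_comm, h.vertex_mul_self]
  | succ n =>
    simp only [approx, Finset.mul_sum]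
    refine Finset.sum_congr rfl fun e he => ?_
    obtain rfl : E.r e = v := by simpa using he
    rw [← mul_assoc, ← mul_assoc, h.vertex_mul_edge]

theorem IsCuntzKriegerFamily.approx_mul_vertex (h : E.IsCuntzKriegerFamily q t) (n : ℕ) (v : V)
    (f : C₀(E.InfPath, ℂ)) : E.approx q t n v f * q v = E.approx q t n v f := by
  have := congrArg star (h.vertex_mul_approx n v (star f))
  rwa [star_mul, h.star_vertex, h.approx_star, star_star] at this

/-- Different edges give orthogonal corners, and within one corner the middle factor `t_e* t_e =
q_{s(e)}` acts as a unit. Multiplicativity on all of `C₀(E^∞)` makes the approximations contractive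
without any estimate. -/
theorem IsCuntzKriegerFamily.approx_mul (h : E.IsCuntzKriegerFamily q t) (n : ℕ) (v : V)
    (f g : C₀(E.InfPath, ℂ)) :
    E.approx q t n v (f * g) = E.approx q t n v f * E.approx q t n v g := by
  classical
  induction n generalizing v f g with
  | zero =>
    simp only [approx, ZeroAtInftyContinuousMap.mul_apply, smul_mul_smul_comm, h.vertex_mul_self]
  | succ n ih =>
    simp only [approx, map_mul, ih, Finset.sum_mul]
    refine Finset.sum_congr rfl fun e he => ?_
    rw [Finset.mul_sum, Finset.sum_eq_single_of_mem e he]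
    · simp only [mul_assoc]
      rw [← mul_assoc (star (t e)) (t e), h.star_edge_mul_edge, ← mul_assoc (q (E.s e)),
        h.vertex_mul_approx]
    · intro f _ hfe
      simp only [mul_assoc]
      rw [← mul_assoc (star (t e)) (t f), h.star_edge_mul_of_ne hfe.symm]
      simp

open Classical in
-- Once the depth reaches the length of `μ`, sampling loses nothing. Each level strips the first
-- edge of `μ`; when `μ` is a vertex, the extra levels are undone by `q_v = ∑ t_e t_e*`.
theorem IsCuntzKriegerFamily.approx_chi₀ (h : E.IsCuntzKriegerFamily q t) (n : ℕ) (v : V)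
    (μ : E.FinPath) (hn : μ.edges.length ≤ n) :
    E.approx q t n v (E.chi₀ μ) =
      if μ.start = v then μ.elem q t * star (μ.elem q t) else 0 := by
  induction n generalizing v μ with
  | zero =>
    induction μ using FinPath.induction with
    | vertex w =>
      have hz : (exists_infPath (E := E) v).choose ∈ E.cylinder (E.vertexPath w) ↔ w = v := by
        rw [mem_cylinder_vertexPath, (exists_infPath (E := E) v).choose_spec, eq_comm]
      change _ = if w = v then _ else _
      simp only [approx, chi₀_apply, hz]
      split_ifs with hwv
      · rw [elem_vertexPath, h.star_vertex, h.vertex_mul_self, hwv, one_smul]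
      · rw [zero_smul]
    | cons e μ hμ _ => exact absurd hn (Nat.not_succ_le_zero _)
  | succ n ih =>
    induction μ using FinPath.induction with
    | vertex w =>
      have : ∀ e ∈ (finite_range_eq (E := E) v).toFinset,
          t e * E.approx q t n (E.s e) (E.pullback e (E.chi₀ (E.vertexPath w))) * star (t e) =
          if w = v then t e * star (t e) else 0 := by
        intro e he
        obtain rfl : E.r e = v := by simpa using he
        split_ifs with hwv
        · subst hwv
          rw [pullback_vertexPath, ih _ _ (Nat.zero_le _)]
          change t e * (if E.s e = E.s e then _ else _) * _ = _
          rw [if_pos rfl, elem_vertexPath, h.star_vertex, h.vertex_mul_self, h.edge_mul_vertex]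
        · rw [pullback_vertexPath_of_ne (Ne.symm hwv), approx_zero, mul_zero, zero_mul]
      rw [approx, Finset.sum_congr rfl this]
      change _ = if w = v then _ else _
      split_ifs with hwv
      · rw [elem_vertexPath, h.star_vertex, h.vertex_mul_self, hwv, ← h.vertex_eq_sum]
      · exact Finset.sum_const_zero
    | cons a μ hμ _ =>
      have : ∀ e, t e * E.approx q t n (E.s e) (E.pullback e (E.chi₀ (E.consPath a μ hμ))) *
          star (t e) = if e = a then
            (E.consPath a μ hμ).elem q t * star ((E.consPath a μ hμ).elem q t) else 0 := by
        intro e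
        split_ifs with hea
        · subst hea
          rw [pullback_consPath, ih _ _ (Nat.le_of_succ_le_succ hn), if_pos hμ.symm,
            h.elem_consPath, star_mul]
          simp only [mul_assoc]
        · rw [pullback_consPath_of_ne hea, approx_zero, mul_zero, zero_mul]
      simp only [approx, this]
      rw [Finset.sum_ite_eq']
      refine if_congr ?_ rfl rfl
      rw [Set.Finite.mem_toFinset]
      rfl

theorem IsCuntzKriegerFamily.approx_mul_of_ne (h : E.IsCuntzKriegerFamily q t) (n : ℕ) {v w : V}
    (hvw : v ≠ w) (f g : C₀(E.InfPath, ℂ)) :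
    E.approx q t n v f * E.approx q t n w g = 0 := by
  rw [← h.approx_mul_vertex, ← h.vertex_mul_approx n w, mul_assoc, ← mul_assoc (q v),
    h.vertex_mul_vertex v w hvw, zero_mul, mul_zero]

/-- The sum of the homomorphisms `approx n v` over a finite set of vertices. -/
noncomputable def IsCuntzKriegerFamily.approxHom (h : E.IsCuntzKriegerFamily q t)
    (i : ℕ × Finset V) : C₀(E.InfPath, ℂ) →⋆ₙₐ[ℂ] B where
  toFun f := ∑ v ∈ i.2, E.approx q t i.1 v f
  map_smul' c f := by simp only [approx_smul, Finset.smul_sum, MonoidHom.id_apply]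
  map_zero' := by simp only [approx_zero, Finset.sum_const_zero]
  map_add' f g := by simp only [approx_add, Finset.sum_add_distrib]
  map_mul' f g := by
    rw [Finset.sum_mul]
    refine Finset.sum_congr rfl fun v hv => ?_
    rw [Finset.mul_sum, Finset.sum_eq_single_of_mem v hv, h.approx_mul]
    exact fun w _ hwv => h.approx_mul_of_ne _ hwv.symm _ _
  map_star' f := by simp only [h.approx_star, star_sum]

/-- The net is constant as soon as the depth is at least the length of `μ` and the finite vertex set
contains the range of `μ`. -/
theorem IsCuntzKriegerFamily.tendsto_approxHom_chi₀ (h : E.IsCuntzKriegerFamily q t)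
    (μ : E.FinPath) : Filter.Tendsto (fun i => h.approxHom i (E.chi₀ μ)) Filter.atTop
      (𝓝 (μ.elem q t * star (μ.elem q t))) := by
  classical
  refine Filter.Tendsto.congr' ?_ tendsto_const_nhds
  filter_upwards [Filter.eventually_ge_atTop ((μ.edges.length, {μ.start}) : ℕ × Finset V)] with i hi
  change _ = ∑ v ∈ i.2, E.approx q t i.1 v (E.chi₀ μ)
  simp only [h.approx_chi₀ i.1 _ μ hi.1]
  rw [Finset.sum_ite_eq, if_pos (hi.2 (Finset.mem_singleton_self _))]

instance : (Filter.atTop : Filter (ℕ × Finset V)).NeBot := by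
  classical
  infer_instance

/-- The homomorphisms are uniformly contractive, so the functions on which the net converges form a
closed subspace; it contains the cylinder functions. -/
theorem IsCuntzKriegerFamily.exists_tendsto_approxHom (h : E.IsCuntzKriegerFamily q t)
    (f : C₀(E.InfPath, ℂ)) :
    ∃ b, Filter.Tendsto (fun i => h.approxHom i f) Filter.atTop (𝓝 b) := by
  classical
  refine chi_induction
    (p := fun f => ∃ b, Filter.Tendsto (fun i => h.approxHom i f) Filter.atTop (𝓝 b))
    ?_ ?_ ?_ (fun e μ hμ => ⟨_, h.tendsto_approxHom_chi₀ _⟩) ?_ f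
  · refine isClosed_of_closure_subset fun f hf => ?_
    refine cauchy_map_iff_exists_tendsto.1 (Metric.cauchy_iff.2 ⟨Filter.map_neBot, fun ε hε => ?_⟩)
    -- Two values of the net at `f` are joined through the values at `g` and the limit `b`, in four
    -- steps of length below `ε / 4`.
    obtain ⟨g, ⟨b, hb⟩, hg⟩ := Metric.mem_closure_iff.1 hf (ε / 4) (by positivity)
    refine ⟨_, Filter.image_mem_map (hb.eventually (Metric.ball_mem_nhds b (ε := ε / 4)
      (by positivity))), ?_⟩
    have hd : ∀ i, dist (h.approxHom i f) (h.approxHom i g) < ε / 4 := fun i => by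
      rw [dist_eq_norm, ← map_sub]
      refine lt_of_le_of_lt (NonUnitalStarAlgHom.norm_apply_le _ _) ?_
      rwa [← dist_eq_norm]
    rintro _ ⟨i, hi, rfl⟩ _ ⟨j, hj, rfl⟩
    have hi' : dist (h.approxHom i g) b < ε / 4 := hi
    have hj' : dist (h.approxHom j g) b < ε / 4 := hj
    have h1 := dist_triangle4 (h.approxHom i f) (h.approxHom i g) (h.approxHom j g)
      (h.approxHom j f)
    have h2 := dist_triangle_right (h.approxHom i g) (h.approxHom j g) b
    have h3 := hd i
    have h4 := hd j
    rw [dist_comm] at h4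
    linarith
  · rintro f g ⟨b, hb⟩ ⟨c, hc⟩
    exact ⟨b + c, by simpa only [map_add] using hb.add hc⟩
  · rintro c f ⟨b, hb⟩
    exact ⟨c • b, by simpa only [map_smul] using hb.const_smul c⟩
  · exact ⟨0, by simpa only [map_zero] using tendsto_const_nhds⟩

/-- The homomorphism `π` with `π(χ_{Z(μ)}) = t_μ t_μ*`. -/
noncomputable def IsCuntzKriegerFamily.hom (h : E.IsCuntzKriegerFamily q t) :
    C₀(E.InfPath, ℂ) →⋆ₙₐ[ℂ] B where
  -- The algebraic identities of the approximations pass to the limit by uniqueness of limits.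
  toFun f := (h.exists_tendsto_approxHom f).choose
  map_smul' c f := tendsto_nhds_unique (h.exists_tendsto_approxHom _).choose_spec
    (by
      simpa only [map_smul, MonoidHom.id_apply] using
        (h.exists_tendsto_approxHom f).choose_spec.const_smul c)
  map_zero' := tendsto_nhds_unique (h.exists_tendsto_approxHom _).choose_spec
    (by simpa only [map_zero] using tendsto_const_nhds)
  map_add' f g := tendsto_nhds_unique (h.exists_tendsto_approxHom _).choose_spec
    (by
      simpa only [map_add] using (h.exists_tendsto_approxHom f).choose_spec.add
        (h.exists_tendsto_approxHom g).choose_spec)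
  map_mul' f g := tendsto_nhds_unique (h.exists_tendsto_approxHom _).choose_spec
    (by
      simpa only [map_mul] using (h.exists_tendsto_approxHom f).choose_spec.mul
        (h.exists_tendsto_approxHom g).choose_spec)
  map_star' f := tendsto_nhds_unique (h.exists_tendsto_approxHom _).choose_spec
    (by simpa only [map_star] using (h.exists_tendsto_approxHom f).choose_spec.star)

theorem IsCuntzKriegerFamily.hom_chi₀ (h : E.IsCuntzKriegerFamily q t) (μ : E.FinPath) :
    h.hom (E.chi₀ μ) = μ.elem q t * star (μ.elem q t) :=
  tendsto_nhds_unique (h.exists_tendsto_approxHom _).choose_spec (h.tendsto_approxHom_chi₀ μ)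

end Approx

end DirectedGraph

/-! ### The covariant representation of a Cuntz-Krieger family -/

namespace DirectedGraph

variable {V Ed : Type*} {E : DirectedGraph V Ed} [E.RowFinite] {B : Type*} [NonUnitalCStarAlgebra B]

section Covariant

variable {ψ : C_c(E.InfPath, ℂ) →ₗ[ℂ] B} {π : C₀(E.InfPath, ℂ) →⋆ₙₐ[ℂ] B}

/-- The global inner product relation contains the local axioms: on an `s`-section `x̂` is `⟨x, x⟩`,
and functions with disjoint supports have inner product zero. -/
theorem isToeplitz_of_star_mul (h1 : ∀ f x, ψ (E.hat.leftMul f x) = π f * ψ x)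
    (h2 : ∀ x y, star (ψ x) * ψ y = π (E.hat.ip x y)) : E.hat.IsToeplitz ψ π where
  map_leftMul := h1
  map_hat x U _ hU hx f hf := by
    rw [h2, (E.hat.isHat_iff hU ((subset_tsupport _).trans hx) f).1 hf]
  star_mul_eq_zero x y U V _ _ _ _ hUV hx hy := by
    have h0 : star x * y = 0 := by
      refine CompactlySupportedContinuousMap.ext fun z => ?_
      rw [CompactlySupportedContinuousMap.mul_apply, CompactlySupportedContinuousMap.star_apply]
      by_contra hne
      obtain ⟨hxz, hyz⟩ := mul_ne_zero_iff.1 hne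
      exact Set.disjoint_left.1 hUV (hx (subset_tsupport _ (star_ne_zero.1 hxz)))
        (hy (subset_tsupport _ hyz))
    rw [h2, TopologicalGraph.ip, h0, map_zero, map_zero]

variable (E) in
/-- The characteristic function of `Z(μ)` with values in `ℝ≥0`. -/
noncomputable def chiNN (μ : E.FinPath) : C_c(E.InfPath, ℝ≥0) where
  toFun := (E.cylinder μ).indicator fun _ => 1
  continuous_toFun := continuous_const.indicator (by simp [(E.isClopen_cylinder μ).frontier_eq])
  hasCompactSupport' := HasCompactSupport.intro (E.isCompact_cylinder μ) fun _ h =>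
    Set.indicator_of_notMem h _

open Classical in
theorem chiNN_apply (μ : E.FinPath) (z : E.InfPath) :
    E.chiNN μ z = if z ∈ E.cylinder μ then 1 else 0 :=
  Set.indicator_apply (E.cylinder μ) (fun _ => (1 : ℝ≥0)) z

theorem sqrtCc_chiNN (μ : E.FinPath) : sqrtCc (E.chiNN μ) = E.chi μ := by
  refine CompactlySupportedContinuousMap.ext fun z => ?_
  change ((NNReal.sqrt (E.chiNN μ z) : ℝ) : ℂ) = _
  rw [chiNN_apply, chi_apply]
  split_ifs <;> simp

/-- The cylinder functions of paths of positive length generate `C₀(E^∞)`. Each is supported in a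
single `s`-section `Z(e)` and equals its own square root, so the partition in the covariance
condition needs only one function. -/
theorem isCovariant_of_isToeplitz (h : E.hat.IsToeplitz ψ π)
    (hc : ∀ e μ (hμ : E.s e = μ.start), π (E.chi₀ (E.consPath e μ hμ)) =
      ψ (E.chi (E.consPath e μ hμ)) * star (ψ (E.chi (E.consPath e μ hμ)))) :
    E.hat.IsCovariant ψ π where
  toIsToeplitz := h
  covariant := by
    refine ⟨{f | ∃ (e : Ed) (μ : E.FinPath) (h : E.s e = μ.start),
      f = E.chi₀ (E.consPath e μ h)}, ?_, ?_, ?_⟩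
    · rintro _ ⟨e, μ, hμ, rfl⟩
      refine ⟨fun z => ?_, (E.chi (E.consPath e μ hμ)).hasCompactSupport, ?_⟩
      · rw [chi₀_apply]
        split_ifs
        · exact zero_le_one
        · exact le_rfl
      · rw [rg_hat]
        exact Set.subset_univ _
    · rw [rg_hat]
      refine Set.Subset.antisymm (fun f _ v hv => absurd (Set.mem_univ v) hv) fun f _ => ?_
      have hle : E.chiSpan ≤ (NonUnitalStarAlgebra.adjoin ℂ {f | ∃ (e : Ed) (μ : E.FinPath)
          (h : E.s e = μ.start), f = E.chi₀ (E.consPath e μ h)}).toSubmodule :=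
        Submodule.span_le.2 (NonUnitalStarAlgebra.subset_adjoin ℂ _)
      exact closure_mono hle (dense_chiSpan f)
    · rintro _ ⟨e, μ, hμ, rfl⟩
      have hsub : tsupport (E.chi (E.consPath e μ hμ)) ⊆ {z : E.InfPath | z.1 0 = e} := by
        refine tsupport_subset_edge fun z hz => ?_
        by_contra hne
        rw [chi_apply, if_neg fun hz => hne (mem_cylinder_consPath.1 hz).1] at hz
        exact hz rfl
      refine ⟨{{z : E.InfPath | z.1 0 = e}}, fun _ => E.chiNN (E.consPath e μ hμ), ?_, ?_, ?_, ?_,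
        ?_⟩
      · intro N hN
        rw [Finset.mem_singleton.1 hN]
        exact ⟨isOpen_edge e, isSSection_edge e⟩
      · rw [Finset.set_biUnion_singleton]
        exact hsub
      · intro N hN z hz
        have hz' : E.chi (E.consPath e μ hμ) z ≠ 0 := by
          intro h0
          refine hz ?_
          rw [chi_apply] at h0
          rw [chiNN_apply]
          split_ifs at h0 ⊢ with h1
          · exact absurd h0 one_ne_zero
          · rfl
        have hz'' := subset_tsupport _ hz'
        rw [Finset.mem_singleton.1 hN]
        exact ⟨hsub hz'', hz''⟩
      · intro z
        rw [Finset.sum_singleton, chiNN_apply]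
        change _ = E.chi₀ _ z
        rw [chi₀_apply]
        split_ifs <;> simp
      · rw [Finset.sum_singleton, sqrtCc_chiNN, hc]

/-- A Toeplitz representation is determined by its values on the characteristic functions. -/
theorem IsToeplitz.ext {ψ ψ' : C_c(E.InfPath, ℂ) →ₗ[ℂ] B} {π π' : C₀(E.InfPath, ℂ) →⋆ₙₐ[ℂ] B}
    (h : E.hat.IsToeplitz ψ π) (h' : E.hat.IsToeplitz ψ' π')
    (hψ : ∀ e, ψ (E.chi (E.edgePath e)) = ψ' (E.chi (E.edgePath e)))
    (hπ : ∀ μ, π (E.chi₀ μ) = π' (E.chi₀ μ)) : ψ = ψ' ∧ π = π' := by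
  obtain rfl : π = π' := ext_chi₀ fun e μ hμ => hπ _
  refine ⟨LinearMap.ext fun x => ?_, rfl⟩
  obtain ⟨F, hF⟩ := exists_finset_edges x
  rw [IsToeplitz.map_eq_sum h x F hF, IsToeplitz.map_eq_sum h' x F hF]
  exact Finset.sum_congr rfl fun e _ => by rw [hψ]

end Covariant

theorem pullback_toC₀_of_notMem {x : C_c(E.InfPath, ℂ)} {F : Finset Ed}
    (hF : ∀ z, x z ≠ 0 → z.1 0 ∈ F) {e : Ed} (he : e ∉ F) : E.pullback e x.toC₀ = 0 := by
  ext z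
  rw [pullback_apply]
  split_ifs with h
  · by_contra hne
    exact he (hF (E.consInf e z h) hne)
  · rfl

variable {q : V → B} {t : Ed → B} [E.NoSources]

/-- Counterpart of `IsToeplitz.edge_mul_pullback` for a family. On the cylinder function of `aμ`
both sides vanish unless `a = e`, by orthogonality, and for `a = e` the factor `t_e* t_e` is
absorbed by `t_μ*`. -/
theorem IsCuntzKriegerFamily.hom_mul_edge (h : E.IsCuntzKriegerFamily q t) (e : Ed)
    (g : C₀(E.InfPath, ℂ)) : h.hom g * t e = t e * h.hom (E.pullback e g) := by
  refine chi_induction (p := fun g => h.hom g * t e = t e * h.hom (E.pullback e g))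
    ?_ ?_ ?_ ?_ ?_ g
  · exact isClosed_eq ((continuous_starAlgHom _).mul continuous_const)
      (continuous_const.mul ((continuous_starAlgHom _).comp (continuous_starAlgHom _)))
  · intro f g hf hg
    simp only [map_add, add_mul, mul_add, hf, hg]
  · intro c f hf
    simp only [map_smul, smul_mul_assoc, mul_smul_comm, hf]
  · intro a μ hμ
    rw [h.hom_chi₀, h.elem_consPath, star_mul]
    by_cases hea : e = a
    · subst hea
      rw [pullback_consPath, h.hom_chi₀]
      have h1 : star (μ.elem q t) * q (E.s e) = star (μ.elem q t) := by
        have := congrArg star (h.vertex_mul_elem μ)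
        rwa [star_mul, h.star_vertex, ← hμ] at this
      rw [mul_assoc, mul_assoc, mul_assoc, h.star_edge_mul_edge, h1]
    · rw [pullback_consPath_of_ne hea, map_zero, mul_zero, mul_assoc, mul_assoc,
        mul_assoc, h.star_edge_mul_of_ne (Ne.symm hea), mul_zero, mul_zero,
        mul_zero]
  · simp

theorem IsCuntzKriegerFamily.hom_vertexPath (h : E.IsCuntzKriegerFamily q t) (v : V) :
    h.hom (E.chi₀ (E.vertexPath v)) = q v := by
  rw [h.hom_chi₀, elem_vertexPath, h.star_vertex, h.vertex_mul_self]

open Classical in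
theorem IsCuntzKriegerFamily.star_edge_mul_hom (h : E.IsCuntzKriegerFamily q t) (e f : Ed)
    (g : C₀(E.InfPath, ℂ)) :
    star (t e) * (h.hom g * t f) = if e = f then h.hom (E.pullback e g) else 0 := by
  rw [h.hom_mul_edge, ← mul_assoc]
  split_ifs with hef
  · subst hef
    rw [h.star_edge_mul_edge, ← h.hom_vertexPath, ← map_mul, chi₀_vertexPath_mul_pullback]
  · rw [h.star_edge_mul_of_ne hef, zero_mul]

/-- Moving `t_e` to the left produces the pull-back of `x` along `e`, which is zero if no path in
the support starts with `e`. The linear part can thus be defined by a sum over all edges, with no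
choice of a finite set. -/
theorem IsCuntzKriegerFamily.support_subset (h : E.IsCuntzKriegerFamily q t)
    {x : C_c(E.InfPath, ℂ)} {F : Finset Ed} (hF : ∀ z, x z ≠ 0 → z.1 0 ∈ F) :
    Function.support (fun e => h.hom x.toC₀ * t e) ⊆ F := by
  intro e he
  by_contra heF
  refine he ?_
  simp only [h.hom_mul_edge, pullback_toC₀_of_notMem hF heF, map_zero, mul_zero]

theorem IsCuntzKriegerFamily.finite_support (h : E.IsCuntzKriegerFamily q t)
    (x : C_c(E.InfPath, ℂ)) : (Function.support fun e => h.hom x.toC₀ * t e).Finite := by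
  obtain ⟨F, hF⟩ := exists_finset_edges x
  exact F.finite_toSet.subset (h.support_subset hF)

/-- The linear map `ψ` with `ψ(χ_{Z(eμ)}) = t_{eμ} t_μ*`. -/
noncomputable def IsCuntzKriegerFamily.lin (h : E.IsCuntzKriegerFamily q t) :
    C_c(E.InfPath, ℂ) →ₗ[ℂ] B where
  -- The default value `0` of an infinite `finsum` never occurs, by `finite_support`.
  toFun x := ∑ᶠ e, h.hom x.toC₀ * t e
  map_add' x y := by
    rw [← finsum_add_distrib (h.finite_support x) (h.finite_support y)]
    refine finsum_congr fun e => ?_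
    rw [← add_mul, ← map_add]
    rfl
  map_smul' c x := by
    rw [RingHom.id_apply, smul_finsum' c (h.finite_support x)]
    refine finsum_congr fun e => ?_
    rw [← smul_mul_assoc, ← map_smul]
    rfl

theorem IsCuntzKriegerFamily.lin_eq_sum (h : E.IsCuntzKriegerFamily q t) (x : C_c(E.InfPath, ℂ))
    (F : Finset Ed) (hF : ∀ z, x z ≠ 0 → z.1 0 ∈ F) :
    h.lin x = ∑ e ∈ F, h.hom x.toC₀ * t e :=
  finsum_eq_sum_of_support_subset _ (h.support_subset hF)

theorem IsCuntzKriegerFamily.isToeplitz (h : E.IsCuntzKriegerFamily q t) :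
    E.hat.IsToeplitz h.lin h.hom := by
  refine isToeplitz_of_star_mul (fun f x => ?_)
    (star_mul_eq_map_ip h.star_edge_mul_hom h.lin_eq_sum)
  obtain ⟨F, hF⟩ := exists_finset_edges x
  have hF' : ∀ z, E.hat.leftMul f x z ≠ 0 → z.1 0 ∈ F := fun z hz =>
    hF z (right_ne_zero_of_mul hz)
  rw [h.lin_eq_sum x F hF, h.lin_eq_sum _ F hF', Finset.mul_sum]
  refine Finset.sum_congr rfl fun e _ => ?_
  rw [← mul_assoc, ← map_mul]
  rfl

theorem IsCuntzKriegerFamily.lin_chi (h : E.IsCuntzKriegerFamily q t) (e : Ed) (μ : E.FinPath)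
    (hμ : E.s e = μ.start) : h.lin (E.chi (E.consPath e μ hμ)) =
      (E.consPath e μ hμ).elem q t * star (μ.elem q t) := by
  rw [h.lin_eq_sum _ {e} fun z hz => ?_, Finset.sum_singleton, toC₀_chi, h.hom_mul_edge,
    pullback_consPath, h.hom_chi₀, h.elem_consPath, mul_assoc]
  by_contra hne
  refine hz ?_
  rw [chi_apply, if_neg]
  exact fun hz => hne (Finset.mem_singleton.2 (mem_cylinder_consPath.1 hz).1)

/-- In `t_{eμ} t_μ* t_μ t_{eμ}*` the middle factor is the source projection of `μ`, which `t_{eμ}`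
absorbs; what remains is `t_{eμ} t_{eμ}*`. -/
theorem IsCuntzKriegerFamily.isCovariant (h : E.IsCuntzKriegerFamily q t) :
    E.hat.IsCovariant h.lin h.hom := by
  refine isCovariant_of_isToeplitz h.isToeplitz fun e μ hμ => ?_
  obtain ⟨v, h1, h2⟩ := h.star_elem_mul_elem μ
  rw [h.lin_chi, h.hom_chi₀, star_mul, star_star, mul_assoc, ← mul_assoc (star (μ.elem q t)), h1,
    h.elem_consPath, ← mul_assoc, mul_assoc (t e) _ (q v), h2]

/-- A Cuntz-Krieger family yields a unique covariant representation of `Ê`. -/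
theorem IsCuntzKriegerFamily.existsUnique_isCovariant (h : E.IsCuntzKriegerFamily q t) :
    ∃! ρ : (C_c(E.InfPath, ℂ) →ₗ[ℂ] B) × (C₀(E.InfPath, ℂ) →⋆ₙₐ[ℂ] B),
      E.hat.IsCovariant ρ.1 ρ.2 ∧
      (∀ (e : Ed) (μ : E.FinPath) (h : E.s e = μ.start),
        ρ.1 (E.chi (E.consPath e μ h)) =
          (E.consPath e μ h).elem q t * star (μ.elem q t)) ∧
      ∀ μ : E.FinPath, ρ.2 (E.chi₀ μ) = μ.elem q t * star (μ.elem q t) := by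
  refine ⟨(h.lin, h.hom), ⟨h.isCovariant, h.lin_chi, h.hom_chi₀⟩, ?_⟩
  rintro ⟨ψ, π⟩ ⟨h1, h2, h3⟩
  have := IsToeplitz.ext h1.toIsToeplitz h.isToeplitz
    (fun e => (h2 e _ rfl).trans (h.lin_chi e _ rfl).symm)
    (fun μ => (h3 μ).trans (h.hom_chi₀ μ).symm)
  exact Prod.ext this.1 this.2

end DirectedGraph

/-! ### The map `ψ⁽¹⁾` of a Toeplitz representation -/

/-- The constant `M` disappears on taking roots of growing order. -/
theorem le_of_pow_two_pow_le {a b M : ℝ} (hb : 0 < b)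
    (h : ∀ k : ℕ, a ^ 2 ^ (k + 1) ≤ M * b ^ 2 ^ (k + 1)) : a ≤ b := by
  by_contra! hab
  obtain ⟨n, hn⟩ := pow_unbounded_of_one_lt M ((one_lt_div hb).2 hab)
  have h1 : (a / b) ^ 2 ^ (n + 1) ≤ M := by
    rw [div_pow, div_le_iff₀ (pow_pos hb _)]
    exact h n
  have h2 : (a / b) ^ n ≤ (a / b) ^ 2 ^ (n + 1) :=
    pow_le_pow_right₀ ((one_lt_div hb).2 hab).le
      ((Nat.le_succ n).trans Nat.lt_two_pow_self.le)
  linarith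

namespace CStarCorrespondence

variable {A X B : Type*} [NonUnitalCStarAlgebra A] [NormedAddCommGroup X] [NormedSpace ℂ X]
  [CompleteSpace X] [NonUnitalCStarAlgebra B] {𝓧 : CStarCorrespondence A X} {ψ : X →ₗ[ℂ] B}
  {π : A →⋆ₙₐ[ℂ] B}

theorem inner_right_left (a : A) (x y : X) :
    𝓧.inner (𝓧.right a x) y = star a * 𝓧.inner x y := by
  rw [← 𝓧.star_inner, 𝓧.inner_right, star_mul, 𝓧.star_inner]

theorem inner_theta (x y z w : X) : 𝓧.inner (𝓧.theta x y z) w = 𝓧.inner z (𝓧.theta y x w) := by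
  rw [theta_apply, theta_apply, inner_right_left, 𝓧.inner_right, 𝓧.star_inner]

theorem IsToeplitz.map_right (h : 𝓧.IsToeplitz ψ π) (a : A) (x : X) :
    ψ (𝓧.right a x) = ψ x * π a := by
  refine eq_of_star_mul_eq ?_ ?_ ?_
  · rw [← mul_assoc, h.star_mul, h.star_mul, 𝓧.inner_right, map_mul]
  · rw [StarMul.star_mul, mul_assoc, h.star_mul, h.star_mul, inner_right_left, map_mul, map_star]
  · rw [StarMul.star_mul, mul_assoc, ← mul_assoc (star (ψ x)), h.star_mul, h.star_mul,
      inner_right_left, 𝓧.inner_right, map_mul, map_mul, map_star]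

variable (𝓧 ψ) in
/-- The span of the pairs `(Θ_{x,y}, ψ(x) ψ(y)*)`. -/
def thetaSpan : Submodule ℂ ((X →L[ℂ] X) × B) :=
  Submodule.span ℂ {p | ∃ x y, p = (𝓧.theta x y, ψ x * star (ψ y))}

/-- The component in `B` implements the operator component on the range of `ψ`. Working with pairs
avoids deciding beforehand that the second component depends only on the first. -/
theorem IsToeplitz.mul_map (h : 𝓧.IsToeplitz ψ π) {p : (X →L[ℂ] X) × B}
    (hp : p ∈ 𝓧.thetaSpan ψ) (z : X) : p.2 * ψ z = ψ (p.1 z) := by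
  induction hp using Submodule.span_induction with
  | mem p hp =>
    obtain ⟨x, y, rfl⟩ := hp
    rw [theta_apply, h.map_right, mul_assoc, h.star_mul]
  | zero => simp
  | add p r _ _ hp hr =>
    rw [Prod.fst_add, Prod.snd_add, add_mul, hp, hr, _root_.add_apply, map_add]
  | smul c p _ hp =>
    rw [Prod.smul_fst, Prod.smul_snd, smul_mul_assoc, hp, _root_.smul_apply, map_smul]

/-- The adjoint of `Θ_{x,y}` is `Θ_{y,x}`, and correspondingly `(ψ(x) ψ(y)*)* = ψ(y) ψ(x)*`. -/
theorem exists_adjoint_mem_thetaSpan {p : (X →L[ℂ] X) × B} (hp : p ∈ 𝓧.thetaSpan ψ) :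
    ∃ T, (T, star p.2) ∈ 𝓧.thetaSpan ψ ∧ ∀ x y, 𝓧.inner (p.1 x) y = 𝓧.inner x (T y) := by
  induction hp using Submodule.span_induction with
  | mem p hp =>
    obtain ⟨x, y, rfl⟩ := hp
    refine ⟨𝓧.theta y x, Submodule.subset_span ⟨y, x, ?_⟩, inner_theta x y⟩
    rw [star_mul, star_star]
  | zero =>
    refine ⟨0, ?_, fun x y => by simp⟩
    rw [Prod.snd_zero, star_zero]
    exact zero_mem _
  | add p r _ _ hp hr =>
    obtain ⟨S, hS, hS'⟩ := hp
    obtain ⟨T, hT, hT'⟩ := hr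
    refine ⟨S + T, ?_, fun x y => by simp [hS', hT']⟩
    rw [Prod.snd_add, star_add]
    exact add_mem hS hT
  | smul c p _ hp =>
    obtain ⟨S, hS, hS'⟩ := hp
    refine ⟨star c • S, ?_, fun x y => by simp [hS']⟩
    rw [Prod.smul_snd, star_smul]
    exact Submodule.smul_mem _ (star c) hS

/-- A crude estimate: `C` comes from a representation of `p` as a finite sum and need not be sharp.
What matters is that it is the same for all `S` and `D`, so that it can be removed by taking high
powers. -/
theorem IsToeplitz.exists_norm_mul_le (h : 𝓧.IsToeplitz ψ π) {p : (X →L[ℂ] X) × B}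
    (hp : p ∈ 𝓧.thetaSpan ψ) : ∃ C, 0 ≤ C ∧ ∀ (S : X →L[ℂ] X) (D : B),
      (∀ z, D * ψ z = ψ (S z)) → ‖D * p.2‖ ≤ C * ‖S‖ := by
  induction hp using Submodule.span_induction with
  | mem p hp =>
    obtain ⟨x, y, rfl⟩ := hp
    refine ⟨‖x‖ * ‖y‖, by positivity, fun S D hSD => ?_⟩
    rw [← mul_assoc, hSD]
    calc ‖ψ (S x) * star (ψ y)‖ ≤ ‖ψ (S x)‖ * ‖star (ψ y)‖ := norm_mul_le _ _
      _ ≤ (‖S‖ * ‖x‖) * ‖y‖ := by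
        rw [norm_star]
        exact mul_le_mul ((h.norm_le _).trans (S.le_opNorm x)) (h.norm_le y) (norm_nonneg _)
          (by positivity)
      _ = _ := by ring
  | zero => exact ⟨0, le_rfl, fun S D _ => by simp⟩
  | add p r _ _ hp hr =>
    obtain ⟨C, hC, hC'⟩ := hp
    obtain ⟨C₂, hC₂, hC₂'⟩ := hr
    refine ⟨C + C₂, add_nonneg hC hC₂, fun S D hSD => ?_⟩
    rw [Prod.snd_add, mul_add, add_mul]
    exact (norm_add_le _ _).trans (add_le_add (hC' S D hSD) (hC₂' S D hSD))
  | smul c p _ hp =>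
    obtain ⟨C, hC, hC'⟩ := hp
    refine ⟨‖c‖ * C, mul_nonneg (norm_nonneg _) hC, fun S D hSD => ?_⟩
    rw [Prod.smul_snd, mul_smul_comm, norm_smul, mul_assoc]
    exact mul_le_mul_of_nonneg_left (hC' S D hSD) (norm_nonneg _)

/-- By Cauchy-Schwarz `‖Ty‖² = ‖⟨S(Ty), y⟩‖ ≤ ‖S‖ ‖Ty‖ ‖y‖`, and a factor `‖Ty‖` cancels. -/
theorem norm_adjoint_le (hcs : ∀ x y, ‖𝓧.inner x y‖ ≤ ‖x‖ * ‖y‖) {S T : X →L[ℂ] X}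
    (hST : ∀ x y, 𝓧.inner (S x) y = 𝓧.inner x (T y)) : ‖T‖ ≤ ‖S‖ := by
  refine T.opNorm_le_bound (norm_nonneg _) fun y => ?_
  by_cases h0 : ‖T y‖ = 0
  · rw [h0]; positivity
  have h1 : ‖T y‖ * ‖T y‖ ≤ ‖S‖ * ‖y‖ * ‖T y‖ := by
    rw [← sq, 𝓧.norm_sq, ← hST]
    calc _ ≤ ‖S (T y)‖ * ‖y‖ := hcs _ _
      _ ≤ (‖S‖ * ‖T y‖) * ‖y‖ := mul_le_mul_of_nonneg_right (S.le_opNorm _) (norm_nonneg _)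
      _ = _ := by ring
  exact le_of_mul_le_mul_right h1 (lt_of_le_of_ne (norm_nonneg _) (Ne.symm h0))

/-- The assignment `Θ_{x,y} ↦ ψ(x) ψ(y)*` is contractive. -/
theorem IsToeplitz.norm_le_of_mem_thetaSpan (h : 𝓧.IsToeplitz ψ π)
    (hcs : ∀ x y, ‖𝓧.inner x y‖ ≤ ‖x‖ * ‖y‖) {p : (X →L[ℂ] X) × B}
    (hp : p ∈ 𝓧.thetaSpan ψ) : ‖p.2‖ ≤ ‖p.1‖ := by
  obtain ⟨K, T⟩ := p
  obtain ⟨K', hK', hadj⟩ := exists_adjoint_mem_thetaSpan hp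
  simp only at hK' hadj ⊢
  obtain ⟨C, hC, hCT⟩ := h.exists_norm_mul_le hK'
  have hact : ∀ z, T * star T * ψ z = ψ ((K.comp K') z) := fun z => by
    rw [mul_assoc, h.mul_map hK', h.mul_map hp]; rfl
  have hsa : star (T * star T) = T * star T := by rw [StarMul.star_mul, star_star]
  -- The norm of a power of order `2 ^ (k + 1)` of the self-adjoint element `T T*` is the power of
  -- its norm. The crude estimate bounds it by a constant times a power of `b`, and roots remove the
  -- constant.
  have key : ‖T * star T‖ ≤ ‖K‖ * ‖K'‖ := by
    refine le_of_forall_gt_imp_ge_of_dense fun b hb => ?_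
    have hb0 : 0 < b := lt_of_le_of_lt (by positivity) hb
    have hKb : ‖K.comp K'‖ ≤ b := (K.opNorm_comp_le K').trans hb.le
    -- Here `D` and `S` are the powers of `T T*` and `K K'` of exponent `2 ^ (k + 1) - 1`. The
    -- factor `b` in the bound for `S` avoids the subtraction in the exponent.
    have hseq : ∀ k : ℕ, ∃ (D : B) (S : X →L[ℂ] X), (∀ z, D * ψ z = ψ (S z)) ∧
        ‖S‖ * b ≤ b ^ 2 ^ (k + 1) ∧ star (D * (T * star T)) = D * (T * star T) ∧
        ‖D * (T * star T)‖ = ‖T * star T‖ ^ 2 ^ (k + 1) := by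
      intro k
      induction k with
      | zero =>
        refine ⟨T * star T, K.comp K', hact, ?_, ?_, ?_⟩
        · rw [zero_add, pow_one, sq]
          exact mul_le_mul_of_nonneg_right hKb hb0.le
        · rw [StarMul.star_mul, hsa]
        · rw [zero_add, pow_one, sq, ← CStarRing.norm_star_mul_self, hsa]
      | succ k ih =>
        obtain ⟨D, S, h1, h2, h3, h4⟩ := ih
        refine ⟨D * (T * star T) * D, S.comp ((K.comp K').comp S), fun z => ?_, ?_, ?_, ?_⟩
        · rw [mul_assoc, mul_assoc, h1, hact, h1]; rfl
        · calc ‖S.comp ((K.comp K').comp S)‖ * b ≤ (‖S‖ * (b * ‖S‖)) * b := by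
                refine mul_le_mul_of_nonneg_right ?_ hb0.le
                refine (S.opNorm_comp_le _).trans (mul_le_mul_of_nonneg_left ?_ (norm_nonneg _))
                exact ((K.comp K').opNorm_comp_le S).trans
                  (mul_le_mul_of_nonneg_right hKb (norm_nonneg _))
            _ = (‖S‖ * b) * (‖S‖ * b) := by ring
            _ ≤ b ^ 2 ^ (k + 1) * b ^ 2 ^ (k + 1) := by gcongr
            _ = b ^ 2 ^ (k + 1 + 1) := by rw [← pow_add, pow_succ 2 (k + 1)]; ring
        · rw [mul_assoc, StarMul.star_mul, h3]
        · rw [mul_assoc, pow_succ 2 (k + 1), pow_mul, ← h4, sq, ← CStarRing.norm_star_mul_self, h3]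
    -- The element `D T` implements `S K`, so `‖D T T*‖ ≤ C ‖S‖ ‖K‖`, and `‖S‖` is at most the power
    -- of `b` divided by `b`.
    refine le_of_pow_two_pow_le (M := C * ‖K‖ / b) hb0 fun k => ?_
    obtain ⟨D, S, h1, h2, -, h4⟩ := hseq k
    rw [← h4, ← mul_assoc, div_mul_eq_mul_div, le_div_iff₀ hb0]
    have h5 := hCT (S.comp K) (D * T) fun z => by rw [mul_assoc, h.mul_map hp, h1]; rfl
    calc ‖D * T * star T‖ * b ≤ C * (‖S‖ * ‖K‖) * b := by
          refine mul_le_mul_of_nonneg_right (h5.trans ?_) hb0.le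
          exact mul_le_mul_of_nonneg_left (S.opNorm_comp_le K) hC
      _ = C * ‖K‖ * (‖S‖ * b) := by ring
      _ ≤ C * ‖K‖ * b ^ 2 ^ (k + 1) := by gcongr
  have h1 : ‖T‖ * ‖T‖ ≤ ‖K‖ * ‖K‖ := by
    rw [← CStarRing.norm_self_mul_star]
    exact key.trans (mul_le_mul_of_nonneg_left (norm_adjoint_le hcs hadj) (norm_nonneg _))
  exact abs_le_of_sq_le_sq' (by nlinarith) (norm_nonneg _) |>.2

/-- The continuous linear map `ψ⁽¹⁾` with `ψ⁽¹⁾(Θ_{x,y}) = ψ(x) ψ(y)*`. -/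
theorem IsToeplitz.exists_compacts_map (h : 𝓧.IsToeplitz ψ π)
    (hcs : ∀ x y, ‖𝓧.inner x y‖ ≤ ‖x‖ * ‖y‖) : ∃ ψ₁ : 𝓧.compacts →L[ℂ] B,
      ∀ x y, ψ₁ ⟨𝓧.theta x y, 𝓧.theta_mem x y⟩ = ψ x * star (ψ y) := by
  have hmem : ∀ p : 𝓧.thetaSpan ψ, p.1.1 ∈ 𝓧.compacts := by
    intro p
    have hle : 𝓧.thetaSpan ψ ≤ 𝓧.compacts.comap (LinearMap.fst ℂ (X →L[ℂ] X) B) := by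
      refine Submodule.span_le.2 ?_
      rintro _ ⟨x, y, rfl⟩
      exact 𝓧.theta_mem x y
    exact hle p.2
  -- The two coordinates of a pair give `f` and `e`. The bound of `f` by `e` makes the passage from
  -- operator to element well defined and continuous, and `e` has dense range.
  let f : 𝓧.thetaSpan ψ →ₗ[ℂ] B := (LinearMap.snd ℂ (X →L[ℂ] X) B).comp (𝓧.thetaSpan ψ).subtype
  let e : 𝓧.thetaSpan ψ →ₗ[ℂ] 𝓧.compacts :=
    ((LinearMap.fst ℂ (X →L[ℂ] X) B).comp (𝓧.thetaSpan ψ).subtype).codRestrict _ hmem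
  have hdense : DenseRange e := by
    refine Subtype.dense_iff.2 ?_
    refine closure_mono fun k hk => ?_
    have hle : Submodule.span ℂ {T | ∃ x y, T = 𝓧.theta x y} ≤
        (𝓧.thetaSpan ψ).map (LinearMap.fst ℂ (X →L[ℂ] X) B) := by
      refine Submodule.span_le.2 ?_
      rintro _ ⟨x, y, rfl⟩
      exact ⟨_, Submodule.subset_span ⟨x, y, rfl⟩, rfl⟩
    obtain ⟨p, hp, rfl⟩ := hle hk
    exact ⟨e ⟨p, hp⟩, ⟨_, rfl⟩, rfl⟩
  have _ : IsBoundedSMul ℂ 𝓧.compacts := .of_norm_smul_le fun c k => norm_smul_le c k.1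
  refine ⟨f.extendOfNorm e, fun x y => ?_⟩
  exact LinearMap.extendOfNorm_eq hdense
    ⟨1, fun p => (h.norm_le_of_mem_thetaSpan hcs p.2).trans_eq (one_mul _).symm⟩
    ⟨(𝓧.theta x y, ψ x * star (ψ y)), Submodule.subset_span ⟨x, y, rfl⟩⟩

end CStarCorrespondence

/-! ### The universal families -/

namespace CStarCorrespondence

variable {A X : Type u} [NonUnitalCStarAlgebra A] [NormedAddCommGroup X] [NormedSpace ℂ X]
  [CompleteSpace X] (𝓧 : CStarCorrespondence A X)

/-- The coordinates of the universal representation are covariant representations. -/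
theorem exists_proj_eq (i : 𝓧.covariantClass.Index) :
    ∃ (ψ : X →ₗ[ℂ] 𝓧.covariantClass.Alg i) (π : A →⋆ₙₐ[ℂ] 𝓧.covariantClass.Alg i),
      𝓧.IsCovariant ψ π ∧ (∀ x, 𝓧.covariantClass.proj i (𝓧.jX x) = ψ x) ∧
      ∀ a, 𝓧.covariantClass.proj i (𝓧.jA a) = π a := by
  obtain ⟨ψ, π, h, hf⟩ := 𝓧.covariantClass.family_holds i
  exact ⟨ψ, π, h, fun x => congrFun hf (Sum.inl x), fun a => congrFun hf (Sum.inr a)⟩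

theorem isToeplitz_jX_jA : 𝓧.IsToeplitz 𝓧.jX 𝓧.jA where
  map_left a x := 𝓧.covariantClass.ext_proj fun i => by
    obtain ⟨ψ, π, h, h1, h2⟩ := 𝓧.exists_proj_eq i
    rw [map_mul, h1, h1, h2, h.map_left]
  star_mul x y := 𝓧.covariantClass.ext_proj fun i => by
    obtain ⟨ψ, π, h, h1, h2⟩ := 𝓧.exists_proj_eq i
    rw [map_mul, map_star, h1, h1, h2, h.star_mul]

/-- Covariance of the universal representation on an element which acts as `Θ_{x,y}`. -/
theorem jA_eq_of_left_eq_theta {a : A} {x y : X} (h : 𝓧.left a = 𝓧.theta x y)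
    (ha : ∀ b, 𝓧.left b = 0 → a * b = 0) : 𝓧.jA a = 𝓧.jX x * star (𝓧.jX y) :=
  𝓧.covariantClass.ext_proj fun i => by
    obtain ⟨ψ, π, ⟨hT, ψ₁, hψ₁, hc⟩, h1, h2⟩ := 𝓧.exists_proj_eq i
    have hK : 𝓧.InKatsuraIdeal a := ⟨h ▸ 𝓧.theta_mem x y, ha⟩
    rw [map_mul, map_star, h1, h1, h2, ← hc a hK, ← hψ₁]
    congr 1
    exact Subtype.ext h

end CStarCorrespondence

namespace TopologicalGraph

variable {E₀ E₁ : Type*} [TopologicalSpace E₀] [T2Space E₀] [LocallyCompactSpace E₀]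
  [TopologicalSpace E₁] [T2Space E₁] [LocallyCompactSpace E₁] (E : TopologicalGraph E₀ E₁)

theorem norm_inner_le (x y : E.GraphModule) :
    ‖E.correspondence.inner x y‖ ≤ ‖x‖ * ‖y‖ := by
  refine E.denseRange_incl.induction_on₂ (isClosed_le (by fun_prop) (by fun_prop))
      (fun a b => ?_) x y
  have ha : ‖E.incl a‖ = ‖E.toPre a‖ := UniformSpace.Completion.norm_coe _
  have hb : ‖E.incl b‖ = ‖E.toPre b‖ := UniformSpace.Completion.norm_coe _
  change ‖E.inner (E.incl a) (E.incl b)‖ ≤ _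
  rw [inner_incl, ha, hb]
  exact E.norm_ip_le (E.toPre a) (E.toPre b)

/-- A representation on `C_c(E₁)` which is compatible with the inner product extends to `X(E)`. -/
theorem exists_extension {B : Type*} [NonUnitalCStarAlgebra B] {ψ : C_c(E₁, ℂ) →ₗ[ℂ] B}
    {π : C₀(E₀, ℂ) →⋆ₙₐ[ℂ] B} (h1 : ∀ f x, ψ (E.leftMul f x) = π f * ψ x)
    (h2 : ∀ x y, star (ψ x) * ψ y = π (E.ip x y)) :
    ∃ Ψ : E.GraphModule →L[ℂ] B, (∀ x, Ψ (E.incl x) = ψ x) ∧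
      E.correspondence.IsToeplitz Ψ.toLinearMap π := by
  have hn : ∀ x, ‖ψ x‖ ≤ 1 * ‖E.incl x‖ := fun x => by
    rw [one_mul]
    refine (sq_le_sq₀ (norm_nonneg _) (norm_nonneg _)).1 ?_
    rw [norm_incl_sq, sq, ← CStarRing.norm_star_mul_self, h2]
    exact NonUnitalStarAlgHom.norm_apply_le _ _
  have hΨ := LinearMap.extendOfNorm_eq E.denseRange_incl ⟨1, hn⟩
  generalize ψ.extendOfNorm E.incl = Ψ at hΨ
  have hπ : Continuous π := DirectedGraph.continuous_starAlgHom π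
  refine ⟨Ψ, hΨ, fun f x => ?_, fun x y => ?_⟩
  · change Ψ (E.left f x) = π f * Ψ x
    refine E.denseRange_incl.induction_on x (isClosed_eq (by fun_prop) (by fun_prop)) fun a => ?_
    rw [left_incl, hΨ, hΨ, h1]
  · change star (Ψ x) * Ψ y = π (E.inner x y)
    refine E.denseRange_incl.induction_on₂ (isClosed_eq (by fun_prop) (by fun_prop))
      (fun a b => ?_) x y
    rw [inner_incl, hΨ, hΨ, h2]

end TopologicalGraph

namespace DirectedGraph

/-! ### The correspondence `X(Ê)` and its covariance condition. -/

section Katsura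

variable {V Ed : Type*} {E : DirectedGraph V Ed} [E.RowFinite]

/-- For `z` in `Z(eμ)` the fibre sum at the shift of `z` has the single term `y(z)`, because `z` is
the only path over it that starts with `e`. -/
theorem rightMul_ip_chi (e : Ed) (μ : E.FinPath) (hμ : E.s e = μ.start) (y : C_c(E.InfPath, ℂ)) :
    E.hat.rightMul (E.chi (E.consPath e μ hμ)) (E.hat.ip (E.chi (E.consPath e μ hμ)) y) =
      E.hat.leftMul (E.chi₀ (E.consPath e μ hμ)) y := by
  classical
  refine CompactlySupportedContinuousMap.ext fun z => ?_
  change E.chi _ z * E.hat.fiberSum _ (E.shift z) = E.chi₀ _ z * y z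
  rw [chi_apply, chi₀_apply]
  split_ifs with hz
  · have h0 := (mem_cylinder_consPath.1 hz).1
    have hs : E.s e = E.r ((E.shift z).1 0) := by rw [range_shift, h0]
    rw [fiberSum_apply_of_support (e := e), dif_pos hs, ← consInf_shift hs h0 rfl,
      CompactlySupportedContinuousMap.mul_apply, CompactlySupportedContinuousMap.star_apply,
      chi_apply, if_pos hz, star_one, one_mul]
    intro w hw
    by_contra hne
    refine hw ?_
    rw [CompactlySupportedContinuousMap.mul_apply, CompactlySupportedContinuousMap.star_apply,
      chi_apply, if_neg fun hw' => hne (mem_cylinder_consPath.1 hw').1, star_zero, zero_mul]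
  · rw [zero_mul, zero_mul]

theorem left_chi₀_eq_theta (e : Ed) (μ : E.FinPath) (hμ : E.s e = μ.start) :
    E.hat.correspondence.left (E.chi₀ (E.consPath e μ hμ)) =
      E.hat.correspondence.theta (E.hat.incl (E.chi (E.consPath e μ hμ)))
        (E.hat.incl (E.chi (E.consPath e μ hμ))) := by
  ext y
  refine E.hat.denseRange_incl.induction_on y (isClosed_eq (by fun_prop) (by fun_prop))
    fun a => ?_
  rw [CStarCorrespondence.theta_apply]
  change E.hat.left _ _ = E.hat.right (E.hat.inner _ _) _
  rw [TopologicalGraph.left_incl, TopologicalGraph.inner_incl, TopologicalGraph.right_incl,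
    rightMul_ip_chi]

/-- Cylinder functions of paths of positive length act as operators `Θ_{χ,χ}`, and their span is
dense. -/
theorem left_mem_compacts (f : C₀(E.InfPath, ℂ)) :
    E.hat.correspondence.left f ∈ E.hat.correspondence.compacts := by
  refine chi_induction (p := fun f => E.hat.correspondence.left f ∈
    E.hat.correspondence.compacts) ?_ ?_ ?_ ?_ ?_ f
  · exact (Submodule.isClosed_topologicalClosure _).preimage E.hat.correspondence.left.continuous
  · intro f g hf hg
    rw [map_add]
    exact add_mem hf hg
  · intro c f hf
    rw [map_smul]
    exact Submodule.smul_mem _ c hf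
  · intro e μ hμ
    rw [left_chi₀_eq_theta]
    exact E.hat.correspondence.theta_mem _ _
  · rw [map_zero]
    exact zero_mem _

/-- The value `f(z)` is read off from the action on the characteristic function of the first edge of
`z`. Together with `left_mem_compacts`, Katsura's ideal is all of `C₀(E^∞)`. -/
theorem left_injective {f : C₀(E.InfPath, ℂ)} (hf : E.hat.correspondence.left f = 0) : f = 0 := by
  ext z
  have h1 : E.hat.left f (E.hat.incl (E.chi (E.edgePath (z.1 0)))) = 0 := by
    change E.hat.correspondence.left f _ = 0
    rw [hf]; rfl
  rw [TopologicalGraph.left_incl] at h1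
  have h2 := E.hat.norm_incl_sq (E.hat.leftMul f (E.chi (E.edgePath (z.1 0))))
  rw [h1, norm_zero, zero_pow two_ne_zero] at h2
  have h3 := E.hat.ip_self_eq_zero (norm_eq_zero.1 h2.symm)
  have h4 : E.hat.leftMul f (E.chi (E.edgePath (z.1 0))) z = 0 := by rw [h3]; rfl
  rwa [leftMul_apply, chi_apply, if_pos (mem_cylinder_edgePath.2 rfl), mul_one] at h4

/-- A covariant representation of `Ê` extends to a covariant representation of `X(Ê)`. -/
theorem IsCovariant.exists_isCovariant {B : Type*} [NonUnitalCStarAlgebra B]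
    {ψ : C_c(E.InfPath, ℂ) →ₗ[ℂ] B} {π : C₀(E.InfPath, ℂ) →⋆ₙₐ[ℂ] B}
    (h : E.hat.IsCovariant ψ π) : ∃ Ψ : E.hat.GraphModule →ₗ[ℂ] B,
      (∀ x, Ψ (E.hat.incl x) = ψ x) ∧ E.hat.correspondence.IsCovariant Ψ π := by
  have hT := h.toIsToeplitz
  obtain ⟨Ψ, hΨ, hΨT⟩ := E.hat.exists_extension hT.map_leftMul (IsToeplitz.star_mul hT)
  obtain ⟨ψ₁, hψ₁⟩ := hΨT.exists_compacts_map E.hat.norm_inner_le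
  refine ⟨Ψ.toLinearMap, hΨ, hΨT, ψ₁, hψ₁, fun f _ => ?_⟩
  -- Both sides are continuous and linear in `f`; on a cylinder function the left side is
  -- `ψ⁽¹⁾(Θ_{χ,χ}) = ψ(χ) ψ(χ)*`.
  refine chi_induction (p := fun f => ψ₁ ⟨E.hat.correspondence.left f, left_mem_compacts f⟩ = π f)
    ?_ ?_ ?_ ?_ ?_ f
  · exact isClosed_eq (ψ₁.continuous.comp
      (E.hat.correspondence.left.continuous.subtype_mk _)) (continuous_starAlgHom π)
  · intro f g hf hg
    rw [map_add π, ← hf, ← hg, ← map_add]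
    exact congrArg ψ₁ (Subtype.ext (map_add _ f g))
  · intro c f hf
    rw [map_smul π, ← hf, ← map_smul]
    exact congrArg ψ₁ (Subtype.ext (map_smul _ c f))
  · intro e μ hμ
    have h1 : ψ₁ ⟨E.hat.correspondence.left (E.chi₀ (E.consPath e μ hμ)), left_mem_compacts _⟩ =
        Ψ (E.hat.incl (E.chi (E.consPath e μ hμ))) *
          star (Ψ (E.hat.incl (E.chi (E.consPath e μ hμ)))) :=
      (congrArg ψ₁ (Subtype.ext (left_chi₀_eq_theta e μ hμ))).trans (hψ₁ _ _)
    rw [h1, hΨ, IsCovariant.map_chi_mul_star h]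
  · rw [map_zero π, ← map_zero ψ₁]
    exact congrArg ψ₁ (Subtype.ext (map_zero _))

end Katsura

/-! ### Universality of `(j₁, j₀)` and the isomorphism with `C*(E)`. -/

variable {V Ed : Type u} (E : DirectedGraph V Ed)

/-- The coordinates of the universal family are Cuntz-Krieger families. -/
theorem exists_proj_eq (i : E.cuntzKriegerClass.Index) :
    ∃ (q : V → E.cuntzKriegerClass.Alg i) (t : Ed → E.cuntzKriegerClass.Alg i),
      E.IsCuntzKriegerFamily q t ∧ (∀ v, E.cuntzKriegerClass.proj i (E.p v) = q v) ∧
      ∀ e, E.cuntzKriegerClass.proj i (E.S e) = t e := by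
  obtain ⟨q, t, h, hf⟩ := E.cuntzKriegerClass.family_holds i
  exact ⟨q, t, h, fun v => congrFun hf (Sum.inl v), fun e => congrFun hf (Sum.inr e)⟩

variable [E.RowFinite]

/-- Cylinder functions act as `Θ_{χ,χ}`, and the orthogonality condition of Katsura's ideal is
vacuous because the left action is injective. -/
theorem isCovariant_j : E.hat.IsCovariant E.hat.j₁ E.hat.j₀ := by
  have hT := E.hat.correspondence.isToeplitz_jX_jA
  refine isCovariant_of_isToeplitz (isToeplitz_of_star_mul (fun f x => ?_) fun x y => ?_) ?_
  · have h1 := hT.map_left f (E.hat.incl x)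
    rw [show E.hat.correspondence.left f (E.hat.incl x) = E.hat.incl (E.hat.leftMul f x) from
      E.hat.left_incl f x] at h1
    exact h1
  · have h1 := hT.star_mul (E.hat.incl x) (E.hat.incl y)
    rw [show E.hat.correspondence.inner (E.hat.incl x) (E.hat.incl y) = E.hat.ip x y from
      E.hat.inner_incl x y] at h1
    exact h1
  · intro e μ hμ
    refine E.hat.correspondence.jA_eq_of_left_eq_theta (left_chi₀_eq_theta e μ hμ) fun b hb => ?_
    rw [left_injective hb, mul_zero]

theorem isUniversalCovariant_j : E.hat.IsUniversalCovariant E.hat.j₁ E.hat.j₀ := by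
  refine ⟨E.isCovariant_j, fun C _ ψ π h => ?_⟩
  obtain ⟨Ψ, hΨ, hc⟩ := IsCovariant.exists_isCovariant h
  obtain ⟨ρ, ⟨h1, h2⟩, -⟩ := E.hat.correspondence.existsUnique_lift hc
  exact ⟨ρ, fun x => (h1 _).trans (hΨ x), h2⟩

/-- A homomorphism on `O(Ê)` is determined by its values on the images of `j₁` and `j₀`. -/
theorem hom_ext_j {C : Type*} [NonUnitalCStarAlgebra C] {φ φ' : E.hat.O →⋆ₙₐ[ℂ] C}
    (h1 : ∀ x, φ (E.hat.j₁ x) = φ' (E.hat.j₁ x)) (h0 : ∀ f, φ (E.hat.j₀ f) = φ' (E.hat.j₀ f)) :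
    φ = φ' := by
  refine RelationClass.hom_ext _ ?_
  rintro (x | f)
  · have hj : Continuous E.hat.correspondence.jX :=
      AddMonoidHomClass.continuous_of_bound E.hat.correspondence.jX 1
        fun x => by simpa using E.hat.correspondence.isToeplitz_jX_jA.norm_le x
    refine E.hat.denseRange_incl.induction_on
      (p := fun x => φ (E.hat.correspondence.jX x) = φ' (E.hat.correspondence.jX x)) x
      (isClosed_eq ((continuous_starAlgHom φ).comp hj) ((continuous_starAlgHom φ').comp hj)) h1
  · exact h0 f

variable [E.NoSources]

/-- Equations can be checked in each coordinate of the universal algebra. The existential form of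
the inequality cannot be checked so directly, which is why the purely equational description is
used. -/
theorem isCuntzKriegerFamily_p_S : E.IsCuntzKriegerFamily E.p E.S := by
  refine isCuntzKriegerFamily_of_eq (fun v => ?_) (fun v => ?_) (fun v w hvw => ?_) (fun e => ?_)
    (fun e => ?_) (fun e f hef => ?_) (fun v => ?_)
  all_goals
    refine E.cuntzKriegerClass.ext_proj fun i => ?_
    obtain ⟨q, t, h, h1, h2⟩ := E.exists_proj_eq i
    simp only [map_mul, map_star, map_sum, map_zero, h1, h2]
  · exact h.star_vertex v
  · exact h.vertex_mul_self v
  · exact h.vertex_mul_vertex v w hvw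
  · exact h.partialIsometry e
  · exact h.star_edge_mul_edge e
  · exact h.star_edge_mul_of_ne hef
  · exact h.vertex_eq_sum v

/-- The algebras `O(Ê)` and `C*(E)` are isomorphic. -/
theorem exists_starAlgEquiv : ∃ Φ : E.hat.O ≃⋆ₐ[ℂ] E.CStar,
    (∀ (e : Ed) (μ : E.FinPath) (h : E.s e = μ.start),
      Φ (E.hat.j₁ (E.chi (E.consPath e μ h))) =
        (E.consPath e μ h).elem E.p E.S * star (μ.elem E.p E.S)) ∧
    ∀ μ : E.FinPath, Φ (E.hat.j₀ (E.chi₀ μ)) = μ.elem E.p E.S * star (μ.elem E.p E.S) := by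
  have hCK := E.isCuntzKriegerFamily_p_S
  have hj := E.isCovariant_j
  have hjT := hj.toIsToeplitz
  -- The universal properties applied to the representation built from `{p_v, s_e}`, and to the
  -- family built from `(j₁, j₀)`, give homomorphisms `φ` and `ρ` in opposite directions.
  obtain ⟨φ, h1, h0⟩ := E.isUniversalCovariant_j.2 E.CStar hCK.lin hCK.hom hCK.isCovariant
  obtain ⟨ρ, ⟨hp, hS⟩, -⟩ := E.existsUnique_lift (IsCovariant.isCuntzKriegerFamily hj)
  have hedge : ∀ e, hCK.lin (E.chi (E.edgePath e)) = E.S e := fun e => by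
    refine (hCK.lin_chi e _ rfl).trans ?_
    change E.S e * star (E.p (E.s e)) = E.S e
    rw [hCK.star_vertex, hCK.edge_mul_vertex]
  have hφρ : ∀ c, φ (ρ c) = c := by
    have : φ.comp ρ = NonUnitalStarAlgHom.id ℂ E.CStar := by
      refine RelationClass.hom_ext _ ?_
      rintro (v | e)
      · change φ (ρ (E.p v)) = E.p v
        rw [hp, h0, hCK.hom_vertexPath]
      · change φ (ρ (E.S e)) = E.S e
        rw [hS, h1, hedge]
    exact fun c => DFunLike.congr_fun this c
  have hρ0 : ∀ f, ρ (φ (E.hat.j₀ f)) = E.hat.j₀ f := by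
    have : (ρ.comp φ).comp E.hat.j₀ = E.hat.j₀ := by
      refine ext_chi₀ fun e μ hμ => ?_
      change ρ (φ (E.hat.j₀ _)) = _
      rw [h0, hCK.hom_chi₀, map_mul, map_star, map_elem, IsCovariant.map_chi₀ hj]
      simp only [hp, hS]
    exact fun f => DFunLike.congr_fun this f
  -- Since `j₁(x) = ∑ j₀(x) j₁(χ_{Z(e)})`, it suffices to know the composite on `j₀` and on the edge
  -- elements.
  have hρ1 : ∀ x, ρ (φ (E.hat.j₁ x)) = E.hat.j₁ x := by
    intro x
    obtain ⟨F, hF⟩ := exists_finset_edges x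
    rw [IsToeplitz.map_eq_sum hjT x F hF, map_sum, map_sum]
    refine Finset.sum_congr rfl fun e _ => ?_
    rw [map_mul, map_mul, hρ0, h1, hedge, hS]
  have hρφ : ∀ a, ρ (φ a) = a := by
    have : ρ.comp φ = NonUnitalStarAlgHom.id ℂ E.hat.O := E.hom_ext_j hρ1 hρ0
    exact fun a => DFunLike.congr_fun this a
  refine ⟨StarAlgEquiv.ofBijective φ ⟨fun a b hab => ?_, fun c => ⟨ρ c, hφρ c⟩⟩, ?_, ?_⟩
  · rw [← hρφ a, hab, hρφ]
  · exact fun e μ h => (h1 _).trans (hCK.lin_chi e μ h)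
  · exact fun μ => (h0 _).trans (hCK.hom_chi₀ μ)

end DirectedGraph

theorem mainTheorem3 {V Ed : Type u} (E : DirectedGraph V Ed) [E.RowFinite] [E.NoSources] :
    -- covariant representations give Cuntz-Krieger families
    (∀ (B : Type w) [NonUnitalCStarAlgebra B] (ψ : C_c(E.InfPath, ℂ) →ₗ[ℂ] B)
        (π : C₀(E.InfPath, ℂ) →⋆ₙₐ[ℂ] B), E.hat.IsCovariant ψ π →
      E.IsCuntzKriegerFamily (fun v => π (E.chi₀ (E.vertexPath v)))
        (fun e => ψ (E.chi (E.edgePath e)))) ∧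
    -- Cuntz-Krieger families give unique covariant representations
    (∀ (B : Type w) [NonUnitalCStarAlgebra B] (q : V → B) (t : Ed → B),
      E.IsCuntzKriegerFamily q t →
      ∃! ρ : (C_c(E.InfPath, ℂ) →ₗ[ℂ] B) × (C₀(E.InfPath, ℂ) →⋆ₙₐ[ℂ] B),
        E.hat.IsCovariant ρ.1 ρ.2 ∧
        (∀ (e : Ed) (μ : E.FinPath) (h : E.s e = μ.start),
          ρ.1 (E.chi (E.consPath e μ h)) =
            (E.consPath e μ h).elem q t * star (μ.elem q t)) ∧
        ∀ μ : E.FinPath, ρ.2 (E.chi₀ μ) = μ.elem q t * star (μ.elem q t)) ∧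
    -- the canonical isomorphism of the algebras
    (E.IsCuntzKriegerFamily E.p E.S ∧
      E.hat.IsUniversalCovariant E.hat.j₁ E.hat.j₀ ∧
      ∃ Φ : E.hat.O ≃⋆ₐ[ℂ] E.CStar,
        (∀ (e : Ed) (μ : E.FinPath) (h : E.s e = μ.start),
          Φ (E.hat.j₁ (E.chi (E.consPath e μ h))) =
            (E.consPath e μ h).elem E.p E.S * star (μ.elem E.p E.S)) ∧
        ∀ μ : E.FinPath, Φ (E.hat.j₀ (E.chi₀ μ)) = μ.elem E.p E.S * star (μ.elem E.p E.S)) :=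
  ⟨fun _ _ _ _ h => DirectedGraph.IsCovariant.isCuntzKriegerFamily h,
    fun _ _ _ _ h => h.existsUnique_isCovariant,
    E.isCuntzKriegerFamily_p_S, E.isUniversalCovariant_j, E.exists_starAlgEquiv⟩
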